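/- Let $\mathbb T=\mathbb R/2\pi\mathbb Z$, let $m_+,T_+,T_-,e>0$ be constants, and write $\langle a\rangle=(1+a^2)^{1/2}$. For $f$ on $\mathbb T\times\mathbb R$ put $\widehat f(k,\xi)=\frac1{2\pi}\iint e^{-i(kx+\xi y)}f\,dx\,dy$ (in the sense of distributions), $k\in\mathbb Z$, $\xi\in\mathbb R$, and $$\|f\|_{H^r_xH^s_y}^2=\sum_{k}\int_{\mathbb R}\langle k\rangle^{2r}\langle\xi\rangle^{2s}|\widehat f(k,\xi)|^2\,d\xi .$$ Let $(\eta,u,\phi)$, $u=(u^x,u^y)$, be a smooth solution on $[0,\infty)\times\mathbb T\times\mathbb R$, with $L^2(\mathbb T\times\mathbb R)$ norms locally bounded in time, of the linearized ion system $$\partial_t\eta+y\partial_x\eta+\nabla\cdot u=0,\qquad \partial_tu+y\partial_xu+\begin{pmatrix}u^y\\0\end{pmatrix}+\frac{T_+}{m_+}\nabla\eta=-\frac{e}{m_+}\nabla\phi,\qquad \Delta\phi=4\pi e\Big(\frac{e}{T_-}\phi-\eta\Big).$$ Let $\eta^{in}$, $\psi^{in}$, $\omega^{in}$ be the values at $t=0$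 of $\eta$, $\psi=\partial_xu^x+\partial_yu^y$ and $\omega=-\partial_yu^x+\partial_xu^y$. Assume that their averages in $x$ vanish for every $y$, that $\eta^{in},\omega^{in}\in L^2_xH^{-1/2}_y$ and that $\psi^{in}\in H^{-3/2}_xH^{-2}_y$. Let $\mathbb Q[u]=\nabla\Delta^{-1}\psi$. Put $\alpha=\alpha(t,k,\xi)=k^2+(\xi-kt)^2$, let $S_L(t,s)$ be the solution operator (for fixed $k\neq0$, $\xi$) of $A'=L_+(t)A$, where $$L_+=\begin{bmatrix}-\frac{\partial_t\alpha}{4\alpha}&-\sqrt{\frac{T_+}{m_+}}\,\alpha^{1/2}\\[1ex] \frac{4\pi e^2}{\sqrt{m_+T_+}}\frac{\alpha^{1/2}}{\alpha+4\pi e^2/T_-}+\sqrt{\frac{m_+}{T_+}}\frac{2k^2}{\alpha^{3/2}}+\sqrt{\frac{T_+}{m_+}}\,\alpha^{1/2}&\frac{\partial_t\alpha}{4\alpha}\end{bmatrix},$$ and set $$\mathcal R(t)=\begin{pmatrix}\sqrt{\frac{T_+}{m_+}}\,\dfrac{\widehat{\eta^{in}}}{(k^2+\xi^2)^{1/4}}\\[2ex]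 \dfrac{\widehat{\psi^{in}}}{(k^2+\xi^2)^{3/4}}\end{pmatrix}+\int_0^tS_L(0,s)\begin{pmatrix}0\\-\dfrac{2k^2}{\alpha(s,k,\xi)^{7/4}}\end{pmatrix}ds\;\big(\widehat{\eta^{in}}+\widehat{\omega^{in}}\big)$$ for $k\ne0$, $\mathcal R(t)=0$ for $k=0$, and $$\mathcal C^{in}_\delta(t)=\Big(\sum_k\int_{\mathbb R}\langle\xi\rangle^{-1}|\mathcal R(t,k,\xi)|^2d\xi\Big)^{1/2}.$$ Then there are constants $c,K>0$ that depend only on $m_+,T_+,T_-,e$ such that for all such solutions and all $t\ge0$ $$\|\mathbb Q[u](t)\|_{L^2}+\sqrt{\tfrac{T_+}{m_+}}\,\|\eta(t)\|_{L^2}\ \ge\ c\,\mathcal C^{in}_\delta(t)\,\langle t\rangle^{1/2},$$ and $\mathcal C^{in}_\delta(t)$ is controlled from below by the norms of the data, uniformly in time: $$\|\psi^{in}\|_{H^{-3/2}_xH^{-2}_y}\ \le\ K\Big(\mathcal C^{in}_\delta(t)+\|\eta^{in}\|_{L^2_xH^{-1/2}_y}+\|\omega^{in}\|_{L^2_xH^{-1/2}_y}\Big).$$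 -/

import Mathlib

open MeasureTheory Set
open scoped ENNReal

noncomputable section

namespace IonCouette

/-- A point of the plane, with the Euclidean norm: values of velocity fields. -/
abbrev Plane : Type := EuclideanSpace ℝ (Fin 2)

/-- The physical constants of the ion system: ion mass, ion temperature, electron temperature and
elementary charge. -/
structure Parameters where
  mPlus : ℝ
  TPlus : ℝ
  TMinus : ℝ
  e : ℝ
  mPlus_pos : 0 < mPlus
  TPlus_pos : 0 < TPlus
  TMinus_pos : 0 < TMinus
  e_pos : 0 < e

/-! ### Functions on the cylinder

A function on `𝕋 × ℝ` is a function of `(x, y) ∈ ℝ × ℝ` that is `2π`-periodic in `x`;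
integration is over one period, `0 < x ≤ 2π`. -/

/-- Lebesgue measure on one period of the cylinder. -/
def cylMeasure : Measure (ℝ × ℝ) :=
  (volume.restrict (Ioc 0 (2 * Real.pi))).prod volume

/-- The `L²(𝕋 × ℝ)` norm, with values in `[0, ∞]`. -/
def L2norm {E : Type*} [NormedAddCommGroup E] (f : ℝ → ℝ → E) : ℝ≥0∞ :=
  eLpNorm (fun p : ℝ × ℝ => f p.1 p.2) 2 cylMeasure

/-- `∇ · v`. -/
def divergence (v : ℝ → ℝ → Plane) (x y : ℝ) : ℝ :=
  deriv (fun x' => v x' y 0) x + deriv (fun y' => v x y' 1) y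

/-- `∇^⊥ · v` with `∇^⊥ = (-∂_y, ∂_x)`. -/
def vorticity (v : ℝ → ℝ → Plane) (x y : ℝ) : ℝ :=
  -deriv (fun y' => v x y' 0) y + deriv (fun x' => v x' y 1) x

/-- The average in `x` vanishes for every `y`. -/
def HasZeroAverage (f : ℝ → ℝ → ℝ) : Prop :=
  ∀ y, ∫ x in (0 : ℝ)..(2 * Real.pi), f x y = 0

/-! ### Fourier transform and Sobolev spaces -/

/-- `g` is the Fourier transform of `f` on `𝕋 × ℝ`, normalized so that
`f(x,y) = (2π)⁻¹ ∑ₖ ∫ e^{i(kx+ξy)} g(k,ξ) dξ`.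
The function `f` is only locally integrable; the transform is taken in the sense of distributions:
for each `k`, the identity `∫₀^{2π} e^{-ikx} f(x,y) dx = ∫ e^{iξy} g(k,ξ) dξ` is tested against all
`θ ∈ C_c^∞(ℝ)` in the variable `y`, and `g(k,·)` is a function in some weighted `L²` space. -/
structure HasFourierTransform (f : ℝ → ℝ → ℝ) (g : ℤ → ℝ → ℂ) : Prop where
  locallyIntegrable : ∀ R : ℝ,
    IntegrableOn (fun p : ℝ × ℝ => f p.1 p.2) (univ ×ˢ Icc (-R) R) cylMeasure
  tempered : ∀ k : ℤ, ∃ N : ℕ,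
    MemLp (fun ξ : ℝ => ((((1 + ξ ^ 2) ^ N)⁻¹ : ℝ) : ℂ) * g k ξ) 2 volume
  pairing : ∀ (k : ℤ) (θ : ℝ → ℂ), ContDiff ℝ (⊤ : ℕ∞) θ → HasCompactSupport θ →
    ∫ y : ℝ, (∫ x in (0 : ℝ)..(2 * Real.pi),
        Complex.exp (-(Complex.I * (k : ℂ) * (x : ℂ))) * (f x y : ℂ)) * θ y
      = ∫ ξ : ℝ, g k ξ * ∫ y : ℝ, Complex.exp (Complex.I * (ξ : ℂ) * (y : ℂ)) * θ y

/-- The Fourier transform of `f` (unique up to null sets; meaningful if there is one). -/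
def fourierTransform (f : ℝ → ℝ → ℝ) : ℤ → ℝ → ℂ :=
  Classical.epsilon (HasFourierTransform f)

/-- `⟨a⟩ = (1 + a²)^{1/2}`. -/
def bracket (a : ℝ) : ℝ := Real.sqrt (1 + a ^ 2)

/-- The norm of `H^r_x H^s_y` in terms of the Fourier transform `g`, with values in `[0, ∞]`. -/
def anisotropicNorm {E : Type*} [NormedAddCommGroup E] (r s : ℝ) (g : ℤ → ℝ → E) : ℝ≥0∞ :=
  (∑' k : ℤ, ∫⁻ ξ : ℝ,
    ENNReal.ofReal (bracket (k : ℝ) ^ (2 * r) * bracket ξ ^ (2 * s)) * ‖g k ξ‖ₑ ^ 2) ^ (1 / 2 : ℝ)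

/-- The norm of a function in `H^r_x H^s_y(𝕋 × ℝ)`. -/
def sobolevNorm (r s : ℝ) (f : ℝ → ℝ → ℝ) : ℝ≥0∞ :=
  anisotropicNorm r s (fourierTransform f)

/-- Membership in `H^r_x H^s_y(𝕋 × ℝ)`. -/
def MemSobolev (r s : ℝ) (f : ℝ → ℝ → ℝ) : Prop :=
  (∃ g, HasFourierTransform f g) ∧ sobolevNorm r s f < ∞

/-! ### The potential part of a velocity field -/

/-- `q ∈ L²(𝕋 × ℝ)` is `∇ Δ⁻¹ (∇ · v)`, the symbols of `∇` and `Δ` being `(ik, iξ)` and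
`-(k² + ξ²)`. -/
structure IsPotentialPart (v q : ℝ → ℝ → Plane) : Prop where
  memLp : MemLp (fun p : ℝ × ℝ => q p.1 p.2) 2 cylMeasure
  fst : HasFourierTransform (fun x y => q x y 0) (fun k ξ =>
    Complex.I * (k : ℂ) * (-((k : ℂ) ^ 2 + (ξ : ℂ) ^ 2))⁻¹ * fourierTransform (divergence v) k ξ)
  snd : HasFourierTransform (fun x y => q x y 1) (fun k ξ =>
    Complex.I * (ξ : ℂ) * (-((k : ℂ) ^ 2 + (ξ : ℂ) ^ 2))⁻¹ * fourierTransform (divergence v) k ξ)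

/-- The Helmholtz projection `ℚ[v] = ∇ Δ⁻¹ (∇ · v)` of a square integrable field `v`
(unique up to null sets). -/
def potentialPart (v : ℝ → ℝ → Plane) : ℝ → ℝ → Plane :=
  Classical.epsilon (IsPotentialPart v)

/-! ### The linearized system -/

/-- `f` is smooth on `[0, ∞) × 𝕋 × ℝ`, and its `L²(𝕋 × ℝ)` norm is locally bounded in time.
Arguments are in the order `t, x, y`. -/
structure IsSmoothField {E : Type*} [NormedAddCommGroup E] [NormedSpace ℝ E]
    (f : ℝ → ℝ → ℝ → E) : Prop where
  smooth : ContDiffOn ℝ (⊤ : ℕ∞) (fun p : ℝ × ℝ × ℝ => f p.1 p.2.1 p.2.2) (Ici 0 ×ˢ univ)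
  periodic : ∀ t, 0 ≤ t → ∀ x y, f t (x + 2 * Real.pi) y = f t x y
  locallyBounded : ∀ τ : ℝ, ∃ B : ℝ, ∀ t ∈ Icc 0 τ, L2norm (f t) ≤ ENNReal.ofReal B

/-- A smooth solution `(η, u, φ)` of the ion Euler-Poisson system linearized at the Couette flow
`(1, (y, 0), 0)`. -/
structure IsSmoothSolution (P : Parameters)
    (η : ℝ → ℝ → ℝ → ℝ) (u : ℝ → ℝ → ℝ → Plane) (φ : ℝ → ℝ → ℝ → ℝ) : Prop where
  density_field : IsSmoothField η
  velocity_field : IsSmoothField u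
  potential_field : IsSmoothField φ
  /-- `∂ₜη + y ∂ₓη + ∇ · u = 0` -/
  continuity_eq : ∀ t, 0 < t → ∀ x y,
    deriv (fun s => η s x y) t + y * deriv (fun x' => η t x' y) x + divergence (u t) x y = 0
  /-- `∂ₜuˣ + y ∂ₓuˣ + uʸ + (T₊/m₊) ∂ₓη = -(e/m₊) ∂ₓφ` -/
  momentum_x_eq : ∀ t, 0 < t → ∀ x y,
    deriv (fun s => u s x y 0) t + y * deriv (fun x' => u t x' y 0) x + u t x y 1
        + P.TPlus / P.mPlus * deriv (fun x' => η t x' y) x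
      = -(P.e / P.mPlus) * deriv (fun x' => φ t x' y) x
  /-- `∂ₜuʸ + y ∂ₓuʸ + (T₊/m₊) ∂_yη = -(e/m₊) ∂_yφ` -/
  momentum_y_eq : ∀ t, 0 < t → ∀ x y,
    deriv (fun s => u s x y 1) t + y * deriv (fun x' => u t x' y 1) x
        + P.TPlus / P.mPlus * deriv (fun y' => η t x y') y
      = -(P.e / P.mPlus) * deriv (fun y' => φ t x y') y
  /-- `Δφ = 4πe ((e/T₋) φ - η)` -/
  poisson_eq : ∀ t, 0 < t → ∀ x y,
    iteratedDeriv 2 (fun x' => φ t x' y) x + iteratedDeriv 2 (fun y' => φ t x y') y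
      = 4 * Real.pi * P.e * (P.e / P.TMinus * φ t x y - η t x y)

/-! ### The functional of the initial data in the lower bound -/

/-- The symbol `α(t,k,ξ) = k² + (ξ - kt)²`. -/
def alpha (k : ℤ) (ξ t : ℝ) : ℝ := (k : ℝ) ^ 2 + (ξ - k * t) ^ 2

/-- `∂ₜα(t,k,ξ) = -2k(ξ - kt)`. -/
def alphaDeriv (k : ℤ) (ξ t : ℝ) : ℝ := -2 * k * (ξ - k * t)

/-- The matrix `L₊(t)` of the symmetrized system at frequency `(k, ξ)`. -/
def Lmatrix (P : Parameters) (k : ℤ) (ξ t : ℝ) : Matrix (Fin 2) (Fin 2) ℝ :=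
  !![-(1 / 4) * (alpha k ξ t)⁻¹ * alphaDeriv k ξ t,
     -(Real.sqrt (P.TPlus / P.mPlus) * alpha k ξ t ^ (1 / 2 : ℝ));
     4 * Real.pi * P.e ^ 2 / Real.sqrt (P.mPlus * P.TPlus)
         * (alpha k ξ t ^ (1 / 2 : ℝ) / (alpha k ξ t + 4 * Real.pi * P.e ^ 2 / P.TMinus))
       + Real.sqrt (P.mPlus / P.TPlus) * (2 * (k : ℝ) ^ 2 / alpha k ξ t ^ (3 / 2 : ℝ))
       + Real.sqrt (P.TPlus / P.mPlus) * alpha k ξ t ^ (1 / 2 : ℝ),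
     1 / 4 * (alpha k ξ t)⁻¹ * alphaDeriv k ξ t]

/-- `S` is the solution operator of `A' = L(t) A`: `S(s,s) = 1` and `∂ₜ S(t,s) = L(t) S(t,s)`. -/
def IsSolutionOperator (L : ℝ → Matrix (Fin 2) (Fin 2) ℝ)
    (S : ℝ → ℝ → Matrix (Fin 2) (Fin 2) ℝ) : Prop :=
  ∀ s, S s s = 1 ∧
    ∀ t i j, HasDerivAt (fun t' => S t' s i j) ((L t * S t s) i j) t

/-- The solution operator `S_L(t,s)` at frequency `(k, ξ)` (unique; it exists for `k ≠ 0`). -/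
def solutionOperator (P : Parameters) (k : ℤ) (ξ : ℝ) : ℝ → ℝ → Matrix (Fin 2) (Fin 2) ℝ :=
  Classical.epsilon (IsSolutionOperator (Lmatrix P k ξ))

/-- The forcing vector `M₊(t) = (0, -2k² / α^{7/4})`. -/
def Mvector (k : ℤ) (ξ t : ℝ) : Fin 2 → ℝ :=
  ![0, -(2 * (k : ℝ) ^ 2 / alpha k ξ t ^ (7 / 4 : ℝ))]

/-- The symmetrized initial data
`A^in = (√(T₊/m₊) η̂^in / (k²+ξ²)^{1/4}, ψ̂^in / (k²+ξ²)^{3/4})`. -/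
def Ain (P : Parameters) (ηin ψin : ℝ → ℝ → ℝ) (k : ℤ) (ξ : ℝ) : Fin 2 → ℂ :=
  ![((Real.sqrt (P.TPlus / P.mPlus) / ((k : ℝ) ^ 2 + ξ ^ 2) ^ (1 / 4 : ℝ) : ℝ) : ℂ)
      * fourierTransform ηin k ξ,
    ((1 / ((k : ℝ) ^ 2 + ξ ^ 2) ^ (3 / 4 : ℝ) : ℝ) : ℂ) * fourierTransform ψin k ξ]

/-- `ℛ(t) = A^in + ∫₀ᵗ S_L(0,s) M₊(s) F̂^in ds`, where `F^in = η^in + ω^in`. -/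
def Rvector (P : Parameters) (ηin ψin ωin : ℝ → ℝ → ℝ) (t : ℝ) (k : ℤ) (ξ : ℝ) :
    EuclideanSpace ℂ (Fin 2) :=
  WithLp.toLp 2 (fun i => Ain P ηin ψin k ξ i
    + ∫ s in (0 : ℝ)..t,
        (((solutionOperator P k ξ 0 s).mulVec (Mvector k ξ s) i : ℝ) : ℂ)
          * (fourierTransform ηin k ξ + fourierTransform ωin k ξ))

/-- The quantity `𝒞^in` of the lower bound at time `t`: the `L²_x H^{-1/2}_y` norm of `ℛ(t)`. -/
def Cin (P : Parameters) (ηin ψin ωin : ℝ → ℝ → ℝ) (t : ℝ) : ℝ≥0∞ :=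
  anisotropicNorm 0 (-1 / 2) (Rvector P ηin ψin ωin t)

end IonCouette

end

/-!
At each frequency `k ≠ 0` the linearized system is a two-dimensional system of ordinary differential
equations along the characteristics `ξ - k t` of the Couette flow. With `ψ = ∇ · u` and
`ω = ∇^⊥ · u`, the combination `F = η̂ + ω̂` is conserved, and the unknowns
`A = (√(T₊/m₊) η̂ / α^{1/4}, ψ̂ / α^{3/4})` solve `A' = L₊ A + M₊ F`. Duhamel's formula read backwards,
`S(0,t) A(t) = A(0) + ∫₀ᵗ S(0,s) M₊(s) F ds`, says that `ℛ(t) = S(0,t) A(t)`. The first inequality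
thus rests on two facts.

* The solution operator is bounded uniformly in time and frequency
  (`exists_abs_solutionOperator_le`). The matrix `L₊` is an oscillator of frequency about `α^{1/2}`
  with trace zero; with frozen coefficients it conserves a quadratic form, whose coefficients vary no
  faster than the bounded phase `arctan (t - ξ/k)` (`sq_add_sq_le_of_slowly_varying`). Hence
  `|ℛ(t)| ≲ |A(t)|`.
* On the one hand `|A(t)|²` is `α^{-1/2}` times the density of
  `(T₊/m₊) ‖η‖² + ‖∇Δ⁻¹ψ‖²` in frequency, on the other hand `⟨t⟩ ≤ 2 ⟨ξ⟩ α^{1/2}`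
  (`bracket_le_mul_alpha`). So `⟨t⟩ ⟨ξ⟩⁻¹ |ℛ(t)|²` is bounded by that density at the frequency
  `ξ - k t`, and Bessel's inequality on the cylinder concludes
  (`exists_lintegral_Rvector_le`, `IsSmoothSolution.tsum_lintegral_energyDensity_le`).

For the second inequality, `|M₊| ≤ 2 k² / α` is twice the derivative of the same phase, so the
integral in `ℛ` is bounded (`exists_norm_integral_forcing_le`), and the second component of `ℛ`
returns `ψ̂` (`exists_sobolevNorm_le`).

Two points need care because the solution is only smooth and square integrable. The derivatives of
the fields need not be square integrable, and the equations have the growing coefficient `y`.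
The system is therefore derived for the transforms of `w f`, with `w` a compactly supported cutoff in
`y` (`IsSmoothSolution.isLocalizedSolution`). The commutators involve only `w'` and `w''`, times the
fields themselves; as `w → 1` they vanish in `L²` uniformly on compact time intervals, and a
subsequence gives the estimate at almost every frequency (`exists_ae_norm_data_add_forcing_le`).
Secondly, `potentialPart` is a choice among the fields with the prescribed transform, and such a field
has to be found: it is the orthogonal projection of the velocity onto the closure of the gradients
(`exists_weak_helmholtz`, `isPotentialPart_potentialPart`).
-/

noncomputable section

namespace IonCouette

/-! ### Linear ordinary differential equations -/

/-- Linear ordinary differential equations with continuous coefficients are globally solvable.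
With `W(t) = ∫ₛᵗ (1 + ‖L‖)` and the weight `ρ = cosh (2W)`, the map
`z ↦ ρ⁻¹ (x₀ + ∫ₛᵗ L ρ z)` is a contraction of the bounded continuous functions, because
`∫ₛᵗ (1 + ‖L‖) ρ = sinh (2W) / 2`; a fixed point `z` gives the solution `ρ z`. -/
theorem exists_linear_ode_solution {E : Type*} [NormedAddCommGroup E] [NormedSpace ℝ E]
    [CompleteSpace E] (L : ℝ → E →L[ℝ] E) (hL : Continuous L) (s : ℝ) (x₀ : E) :
    ∃ x : ℝ → E, x s = x₀ ∧ ∀ t, HasDerivAt x (L t (x t)) t := by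
  set κ : ℝ → ℝ := fun t => 1 + ‖L t‖ with hκ
  have hκc : Continuous κ := by fun_prop
  set W : ℝ → ℝ := fun t => ∫ τ in s..t, κ τ with hW
  have hWd : ∀ t, HasDerivAt W (κ t) t := fun t => hκc.integral_hasStrictDerivAt s t |>.hasDerivAt
  have hWc : Continuous W := continuous_iff_continuousAt.2 fun t => (hWd t).continuousAt
  set ρ : ℝ → ℝ := fun t => Real.cosh (2 * W t) with hρ
  have hρc : Continuous ρ := Real.continuous_cosh.comp (continuous_const.mul hWc)
  have hρ1 : ∀ t, 1 ≤ ρ t := fun t => Real.one_le_cosh _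
  have hρ0 : ∀ t, 0 < ρ t := fun t => lt_of_lt_of_le one_pos (hρ1 t)
  have hint : ∀ t, ∫ τ in s..t, ρ τ * κ τ = Real.sinh (2 * W t) / 2 := by
    intro t
    have : ∀ τ ∈ uIcc s t, HasDerivAt (fun τ => Real.sinh (2 * W τ) / 2) (ρ τ * κ τ) τ := by
      intro τ _
      have := (((hWd τ).const_mul 2).sinh).div_const 2
      refine HasDerivAt.congr_deriv this ?_
      simp only [hρ]
      ring
    rw [intervalIntegral.integral_eq_sub_of_hasDerivAt this
      ((hρc.mul hκc).intervalIntegrable _ _)]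
    simp [hW]
  have hsinh : ∀ t, |Real.sinh (2 * W t)| ≤ ρ t := by
    intro t
    rw [Real.abs_sinh]
    simp only [hρ]
    rw [← Real.cosh_abs]
    exact (Real.sinh_lt_cosh _).le
  have key : ∀ (f : ℝ → E) (B : ℝ), 0 ≤ B → Continuous f → (∀ τ, ‖f τ‖ ≤ B) → ∀ t,
      ‖∫ τ in s..t, L τ (ρ τ • f τ)‖ ≤ B / 2 * ρ t := by
    intro f B hB hf hfB t
    have h1 : ‖∫ τ in s..t, L τ (ρ τ • f τ)‖ ≤ |∫ τ in s..t, B * (ρ τ * κ τ)| := by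
      apply intervalIntegral.norm_integral_le_abs_of_norm_le
      · refine Filter.Eventually.of_forall fun τ => ?_
        calc ‖L τ (ρ τ • f τ)‖ ≤ ‖L τ‖ * ‖ρ τ • f τ‖ := (L τ).le_opNorm _
          _ = ‖L τ‖ * (ρ τ * ‖f τ‖) := by rw [norm_smul, Real.norm_of_nonneg (hρ0 τ).le]
          _ ≤ κ τ * (ρ τ * B) := by
            have := hρ0 τ
            gcongr
            · simp [hκ]
            · exact hfB τ
          _ = B * (ρ τ * κ τ) := by ring
      · exact (continuous_const.mul (hρc.mul hκc)).intervalIntegrable _ _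
    rw [intervalIntegral.integral_const_mul, hint, abs_mul, abs_of_nonneg hB, abs_div,
      abs_of_pos (two_pos : (0:ℝ) < 2)] at h1
    calc _ ≤ _ := h1
      _ ≤ B * (ρ t / 2) := by gcongr; exact hsinh t
      _ = _ := by ring
  have hcont : ∀ f : ℝ → E, Continuous f →
      Continuous fun t => (ρ t)⁻¹ • (x₀ + ∫ τ in s..t, L τ (ρ τ • f τ)) := by
    intro f hf
    refine (hρc.inv₀ fun t => (hρ0 t).ne').smul (continuous_const.add ?_)
    have : Continuous fun τ => L τ (ρ τ • f τ) := hL.clm_apply (hρc.smul hf)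
    exact continuous_iff_continuousAt.2 fun t =>
      (this.integral_hasStrictDerivAt s t).hasDerivAt.continuousAt
  let Φ : BoundedContinuousFunction ℝ E → BoundedContinuousFunction ℝ E := fun z =>
    BoundedContinuousFunction.ofNormedAddCommGroup
      (fun t => (ρ t)⁻¹ • (x₀ + ∫ τ in s..t, L τ (ρ τ • z τ))) (hcont z z.continuous)
      (‖x₀‖ + ‖z‖ / 2) (by
        intro t
        rw [norm_smul, norm_inv, Real.norm_of_nonneg (hρ0 t).le, inv_mul_le_iff₀ (hρ0 t)]
        calc _ ≤ ‖x₀‖ + ‖z‖ / 2 * ρ t := (norm_add_le _ _).trans (by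
                gcongr; exact key z ‖z‖ (norm_nonneg _) z.continuous z.norm_coe_le_norm t)
          _ ≤ ρ t * ‖x₀‖ + ‖z‖ / 2 * ρ t := by
                gcongr; exact le_mul_of_one_le_left (norm_nonneg _) (hρ1 t)
          _ = _ := by ring)
  have hΦ : ContractingWith (1 / 2) Φ := by
    refine ⟨by norm_num, LipschitzWith.of_dist_le_mul fun z z' => ?_⟩
    rw [BoundedContinuousFunction.dist_le (by positivity)]
    intro t
    have hi : ∀ z : BoundedContinuousFunction ℝ E,
        IntervalIntegrable (fun τ => L τ (ρ τ • z τ)) volume s t := fun z =>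
      (hL.clm_apply (hρc.smul z.continuous)).intervalIntegrable _ _
    have e : Φ z t - Φ z' t = (ρ t)⁻¹ • ∫ τ in s..t, L τ (ρ τ • (z - z') τ) := by
      simp only [Φ, BoundedContinuousFunction.coe_ofNormedAddCommGroup, ← smul_sub]
      rw [add_sub_add_left_eq_sub, ← intervalIntegral.integral_sub (hi z) (hi z')]
      simp [smul_sub]
    rw [dist_eq_norm, e, norm_smul, norm_inv, Real.norm_of_nonneg (hρ0 t).le,
      inv_mul_le_iff₀ (hρ0 t)]
    have := key (z - z') ‖z - z'‖ (norm_nonneg _) (z - z').continuous (z - z').norm_coe_le_norm t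
    rw [dist_eq_norm]
    refine this.trans (le_of_eq ?_)
    push_cast; ring
  obtain ⟨z, hz⟩ : ∃ z, Φ z = z := ⟨_, hΦ.fixedPoint_isFixedPt⟩
  have hx : ∀ t, ρ t • z t = x₀ + ∫ τ in s..t, L τ (ρ τ • z τ) := by
    intro t
    conv_lhs => rw [← hz]
    simp only [Φ, BoundedContinuousFunction.coe_ofNormedAddCommGroup]
    rw [smul_inv_smul₀ (hρ0 t).ne']
  refine ⟨fun t => ρ t • z t, (hx s).trans (by rw [intervalIntegral.integral_same, add_zero]),
    fun t => ?_⟩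
  have hc : Continuous fun τ => L τ (ρ τ • z τ) := hL.clm_apply (hρc.smul z.continuous)
  have := ((hc.integral_hasStrictDerivAt s t).hasDerivAt).const_add x₀
  exact this.congr_of_eventuallyEq (Filter.Eventually.of_forall hx)

/-- Solution operators of two-dimensional linear systems exist. -/
theorem exists_isSolutionOperator (L : ℝ → Matrix (Fin 2) (Fin 2) ℝ) (hL : Continuous L) :
    ∃ S, IsSolutionOperator L S := by
  let Λ : Matrix (Fin 2) (Fin 2) ℝ →ₗ[ℝ] ((Fin 2 → ℝ) →L[ℝ] (Fin 2 → ℝ)) :=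
    (LinearMap.toContinuousLinearMap.toLinearMap).comp Matrix.toLin'.toLinearMap
  have hΛ : Continuous Λ := LinearMap.continuous_of_finiteDimensional _
  choose X hX hX' using fun (s : ℝ) (j : Fin 2) =>
    exists_linear_ode_solution (fun t => Λ (L t)) (hΛ.comp hL) s (Pi.single j (1 : ℝ))
  refine ⟨fun t s => Matrix.of fun i j => X s j t i, fun s => ⟨?_, fun t i j => ?_⟩⟩
  · ext i j
    simp [hX, Matrix.one_apply, Pi.single_apply]
  · have := (hasDerivAt_pi.1 (hX' s j t)) i
    refine HasDerivAt.congr_deriv this ?_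
    simp [Λ, Matrix.mul_apply, Matrix.mulVec, dotProduct]

/-! ### Energy estimates for slowly varying oscillators -/

/-- The system `x' = -b r x - b y`, `y' = b q x + b r y` with frozen coefficients conserves
`E = q x² + y² + 2 r x y`. Hence `E' = q' x² + 2 r' x y`, and when the variations of `q` and `r`
are dominated by that of a bounded phase `θ`, all solutions stay comparable to their values at any
other time, whatever the size of `b`. -/
theorem sq_add_sq_le_of_slowly_varying {x y b q r q' r' θ g : ℝ → ℝ} {c Λ : ℝ} (hc : 0 ≤ c)
    (hx : ∀ t, HasDerivAt x (-(b t * r t) * x t - b t * y t) t)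
    (hy : ∀ t, HasDerivAt y (b t * q t * x t + b t * r t * y t) t)
    (hq : ∀ t, HasDerivAt q (q' t) t) (hr : ∀ t, HasDerivAt r (r' t) t)
    (hθ : ∀ t, HasDerivAt θ (g t) t) (hθb : ∀ t, |θ t| ≤ Real.pi / 2) (hg : ∀ t, 0 ≤ g t)
    (hq' : ∀ t, |q' t| ≤ c * g t) (hr' : ∀ t, |r' t| ≤ c * g t)
    (hlow : ∀ t, 1 / 2 + 2 * r t ^ 2 ≤ q t) (hup : ∀ t, q t ≤ Λ) (hup' : ∀ t, |r t| ≤ Λ)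
    (hΛ : 1 ≤ Λ) (s t : ℝ) :
    x t ^ 2 + y t ^ 2 ≤ 4 * Λ * Real.exp (4 * c * Real.pi) * (x s ^ 2 + y s ^ 2) := by
  set E : ℝ → ℝ := fun t => q t * x t ^ 2 + y t ^ 2 + 2 * r t * (x t * y t) with hE
  have hElow : ∀ t, (x t ^ 2 + y t ^ 2) / 2 ≤ E t := by
    intro t
    have := mul_le_mul_of_nonneg_right (hlow t) (sq_nonneg (x t))
    simp only [hE]
    -- the cross term is absorbed by `2 (r x + y / 2)² ≥ 0`
    nlinarith [sq_nonneg (r t * x t + y t / 2)]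
  have hEup : ∀ t, E t ≤ 2 * Λ * (x t ^ 2 + y t ^ 2) := by
    intro t
    have h1 := mul_le_mul_of_nonneg_right (hup t) (sq_nonneg (x t))
    have h2 : r t * (2 * (x t * y t)) ≤ Λ * (x t ^ 2 + y t ^ 2) := by
      calc _ ≤ |r t * (2 * (x t * y t))| := le_abs_self _
        _ = |r t| * |2 * (x t * y t)| := abs_mul _ _
        _ ≤ _ := by
          gcongr
          · exact hup' t
          · rw [abs_le]; constructor <;> nlinarith [sq_nonneg (x t - y t), sq_nonneg (x t + y t)]
    have h3 := mul_le_mul_of_nonneg_right hΛ (sq_nonneg (y t))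
    simp only [hE]
    linarith
  have hEd : ∀ t, HasDerivAt E (q' t * x t ^ 2 + 2 * r' t * (x t * y t)) t := by
    intro t
    have := (((hq t).mul ((hx t).pow 2)).add ((hy t).pow 2)).add
      (((hr t).const_mul 2).mul ((hx t).mul (hy t)))
    refine HasDerivAt.congr_deriv this ?_
    push_cast
    simp only [Pi.pow_apply, Pi.mul_apply]
    ring
  have hEd' : ∀ t, |q' t * x t ^ 2 + 2 * r' t * (x t * y t)| ≤ 4 * c * g t * E t := by
    intro t
    have h1 : |q' t * x t ^ 2| ≤ c * g t * x t ^ 2 := by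
      rw [abs_mul, abs_of_nonneg (sq_nonneg (x t))]
      gcongr; exact hq' t
    have h2 : |2 * r' t * (x t * y t)| ≤ c * g t * (x t ^ 2 + y t ^ 2) := by
      rw [show 2 * r' t * (x t * y t) = r' t * (2 * (x t * y t)) by ring, abs_mul]
      have h0 : 0 ≤ c * g t := mul_nonneg hc (hg t)
      gcongr
      · exact hr' t
      · rw [abs_le]; constructor <;> nlinarith [sq_nonneg (x t - y t), sq_nonneg (x t + y t)]
    have h3 := mul_le_mul_of_nonneg_left (hElow t) (mul_nonneg hc (hg t))
    have h4 := mul_nonneg (mul_nonneg hc (hg t)) (sq_nonneg (y t))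
    refine (abs_add_le _ _).trans ?_
    linarith
  have hE0 : ∀ t, 0 ≤ E t := fun t => le_trans (by positivity) (hElow t)
  have hcomp : ∀ s t, E t ≤ Real.exp (4 * c * Real.pi) * E s := by
    intro s t
    -- `E exp (-4 c θ)` decreases and `E exp (4 c θ)` increases
    have hder : ∀ σ : ℝ, ∀ t, HasDerivAt (fun t => E t * Real.exp (σ * θ t))
        ((q' t * x t ^ 2 + 2 * r' t * (x t * y t) + σ * g t * E t) * Real.exp (σ * θ t)) t := by
      intro σ t
      refine HasDerivAt.congr_deriv ((hEd t).mul ((hθ t).const_mul σ).exp) ?_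
      ring
    have hπ : ∀ s t, θ s - θ t ≤ Real.pi := fun s t => by
      have h1 := abs_le.1 (hθb s); have h2 := abs_le.1 (hθb t); linarith [h1.2, h2.1]
    rcases le_total s t with hst | hst
    · have hanti : Antitone fun t => E t * Real.exp (-(4 * c) * θ t) := by
        refine antitone_of_hasDerivAt_nonpos (hder (-(4 * c))) fun t => ?_
        refine mul_nonpos_of_nonpos_of_nonneg ?_ (Real.exp_pos _).le
        have := (abs_le.1 (hEd' t)).2
        simp only at *
        linarith
      have h := hanti hst
      simp only at h
      have : E t ≤ Real.exp (4 * c * (θ t - θ s)) * E s := by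
        have e : Real.exp (4 * c * (θ t - θ s))
          = Real.exp (-(4 * c) * θ s) * Real.exp (4 * c * θ t) := by
          rw [← Real.exp_add]; ring_nf
        have e2 : Real.exp (-(4 * c) * θ t) * Real.exp (4 * c * θ t) = 1 := by
          rw [← Real.exp_add]; ring_nf; exact Real.exp_zero
        have := mul_le_mul_of_nonneg_right h (Real.exp_pos (4 * c * θ t)).le
        rw [mul_assoc, e2, mul_one] at this
        rw [e]; linarith
      refine this.trans ?_
      have := hE0 s
      gcongr
      exact hπ t s
    · have hmono : Monotone fun t => E t * Real.exp (4 * c * θ t) := by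
        refine monotone_of_hasDerivAt_nonneg (hder (4 * c)) fun t => ?_
        refine mul_nonneg ?_ (Real.exp_pos _).le
        have := (abs_le.1 (hEd' t)).1
        linarith
      have h := hmono hst
      simp only at h
      have : E t ≤ Real.exp (4 * c * (θ s - θ t)) * E s := by
        have e : Real.exp (4 * c * (θ s - θ t))
          = Real.exp (4 * c * θ s) * Real.exp (-(4 * c) * θ t) := by
          rw [← Real.exp_add]; ring_nf
        have e2 : Real.exp (4 * c * θ t) * Real.exp (-(4 * c) * θ t) = 1 := by
          rw [← Real.exp_add]; ring_nf; exact Real.exp_zero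
        have := mul_le_mul_of_nonneg_right h (Real.exp_pos (-(4 * c) * θ t)).le
        rw [mul_assoc, e2, mul_one] at this
        rw [e]; linarith
      refine this.trans ?_
      have := hE0 s
      gcongr
      exact hπ s t
  have h1 := hcomp s t
  have h2 := mul_le_mul_of_nonneg_left (hEup s) (Real.exp_pos (4 * c * Real.pi)).le
  linarith [hElow t]

/-! ### The symbol and the symmetrized system -/

lemma one_le_sq_intCast {k : ℤ} (hk : k ≠ 0) : (1 : ℝ) ≤ (k : ℝ) ^ 2 := by
  have : (1 : ℤ) ≤ k ^ 2 := by have := sq_nonneg k; have := pow_ne_zero 2 hk; omega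
  exact_mod_cast this

/-- `α` in terms of the time elapsed since the critical time `ξ / k`. -/
lemma alpha_eq {k : ℤ} (hk : k ≠ 0) (ξ t : ℝ) :
    alpha k ξ t = (k : ℝ) ^ 2 * (1 + (t - ξ / k) ^ 2) := by
  have : (k : ℝ) ≠ 0 := by exact_mod_cast hk
  simp only [alpha]; field_simp; ring

lemma one_le_alpha {k : ℤ} (hk : k ≠ 0) (ξ t : ℝ) : 1 ≤ alpha k ξ t := by
  have := one_le_sq_intCast hk
  simp only [alpha]; nlinarith [sq_nonneg (ξ - k * t)]

lemma alpha_pos {k : ℤ} (hk : k ≠ 0) (ξ t : ℝ) : 0 < alpha k ξ t :=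
  lt_of_lt_of_le one_pos (one_le_alpha hk ξ t)

lemma sq_le_alpha (k : ℤ) (ξ t : ℝ) : (k : ℝ) ^ 2 ≤ alpha k ξ t := by
  simp only [alpha]; nlinarith [sq_nonneg (ξ - k * t)]

lemma hasDerivAt_alpha (k : ℤ) (ξ t : ℝ) :
    HasDerivAt (alpha k ξ) (alphaDeriv k ξ t) t := by
  have h : HasDerivAt (fun t : ℝ => ξ - k * t) (-(k : ℝ)) t := by
    simpa using ((hasDerivAt_id t).const_mul (k : ℝ)).const_sub ξ
  refine HasDerivAt.congr_deriv ((h.pow 2).const_add ((k : ℝ) ^ 2)) ?_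
  simp only [alphaDeriv]; push_cast; ring

lemma hasDerivAt_alphaDeriv (k : ℤ) (ξ t : ℝ) :
    HasDerivAt (alphaDeriv k ξ) (2 * (k : ℝ) ^ 2) t := by
  have h : HasDerivAt (fun t : ℝ => ξ - k * t) (-(k : ℝ)) t := by
    simpa using ((hasDerivAt_id t).const_mul (k : ℝ)).const_sub ξ
  refine HasDerivAt.congr_deriv (h.const_mul (-2 * (k : ℝ))) ?_
  ring

lemma continuous_alpha (k : ℤ) (ξ : ℝ) : Continuous (alpha k ξ) :=
  continuous_iff_continuousAt.2 fun t => (hasDerivAt_alpha k ξ t).continuousAt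

lemma alphaDeriv_sq (k : ℤ) (ξ t : ℝ) :
    alphaDeriv k ξ t ^ 2 ≤ 4 * (k : ℝ) ^ 2 * alpha k ξ t := by
  simp only [alphaDeriv, alpha]
  nlinarith [sq_nonneg (ξ - k * t), sq_nonneg ((k : ℝ) ^ 2)]

lemma abs_alphaDeriv_le (k : ℤ) (ξ t : ℝ) : |alphaDeriv k ξ t| ≤ alpha k ξ t := by
  simp only [alphaDeriv, alpha]
  rw [abs_le]
  constructor <;> nlinarith [sq_nonneg ((k : ℝ) - (ξ - k * t)), sq_nonneg ((k : ℝ) + (ξ - k * t))]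

/-- The phase whose variation dominates the variation of the coefficients of `L₊`. -/
lemma hasDerivAt_arctan_phase {k : ℤ} (hk : k ≠ 0) (ξ t : ℝ) :
    HasDerivAt (fun t => Real.arctan (t - ξ / k)) ((k : ℝ) ^ 2 / alpha k ξ t) t := by
  have h := ((hasDerivAt_id t).sub_const (ξ / k)).arctan
  refine HasDerivAt.congr_deriv h ?_
  have : (k : ℝ) ≠ 0 := by exact_mod_cast hk
  rw [alpha_eq hk]
  have : (1 + (t - ξ / k) ^ 2) ≠ 0 := by positivity
  simp only [id_eq]
  field_simp

/-- Solutions of the symmetrized system at nonzero frequency stay comparable to their values at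
any other time, uniformly in the frequency. -/
theorem exists_sq_add_sq_le {κ p β : ℝ} (hκ : 0 < κ) (hp : 0 < p) (hβ : 0 < β) :
    ∃ C : ℝ, 0 < C ∧ ∀ (k : ℤ) (_ : k ≠ 0) (ξ : ℝ) (x y : ℝ → ℝ),
      (∀ t, HasDerivAt x (-(1 / 4 * (alpha k ξ t)⁻¹ * alphaDeriv k ξ t) * x t
        - κ⁻¹ * √(alpha k ξ t) * y t) t) →
      (∀ t, HasDerivAt y (κ⁻¹ * √(alpha k ξ t) * (1 + p / (alpha k ξ t + β)
          + 2 * κ ^ 2 * k ^ 2 / alpha k ξ t ^ 2) * x t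
        + 1 / 4 * (alpha k ξ t)⁻¹ * alphaDeriv k ξ t * y t) t) →
      ∀ s t, x t ^ 2 + y t ^ 2 ≤ C * (x s ^ 2 + y s ^ 2) := by
  refine ⟨4 * (1 + p + 2 * κ ^ 2 + κ) * Real.exp (4 * (p + 4 * κ ^ 2 + 2 * κ) * Real.pi),
    by positivity, fun k hk ξ x y hx hy => ?_⟩
  set a := alpha k ξ with ha
  set a' := alphaDeriv k ξ with ha'
  set ρ : ℝ → ℝ := fun t => √(a t) with hρ
  have h1 : ∀ t, 1 ≤ a t := one_le_alpha hk ξ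
  have h0 : ∀ t, 0 < a t := alpha_pos hk ξ
  have hk1 := one_le_sq_intCast hk
  have hρ0 : ∀ t, 0 < ρ t := fun t => Real.sqrt_pos.2 (h0 t)
  have hρ1 : ∀ t, 1 ≤ ρ t := fun t => Real.one_le_sqrt.2 (h1 t)
  have hρ2 : ∀ t, ρ t ^ 2 = a t := fun t => Real.sq_sqrt (h0 t).le
  have hka : ∀ t, (k : ℝ) ^ 2 ≤ a t := sq_le_alpha k ξ
  have had := hasDerivAt_alpha k ξ
  have had' := hasDerivAt_alphaDeriv k ξ
  have hρd : ∀ t, HasDerivAt ρ (a' t / (2 * ρ t)) t := fun t => (had t).sqrt (h0 t).ne'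
  have hsq : ∀ t, a' t ^ 2 ≤ 4 * (k : ℝ) ^ 2 * a t := alphaDeriv_sq k ξ
  have hrsq : ∀ t, (κ * a' t / (4 * ρ t ^ 3)) ^ 2 ≤ κ ^ 2 * (k : ℝ) ^ 2 / (4 * a t ^ 2) := by
    intro t
    have e : (κ * a' t / (4 * ρ t ^ 3)) ^ 2 = κ ^ 2 * a' t ^ 2 / (16 * a t ^ 3) := by
      rw [← hρ2]; field_simp; norm_num
    rw [e, div_le_div_iff₀ (by have := h0 t; positivity) (by have := h0 t; positivity)]
    have := mul_le_mul_of_nonneg_left (hsq t)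
      (by have := h0 t; positivity : 0 ≤ κ ^ 2 * (4 * a t ^ 2))
    nlinarith
  have hkaa : ∀ t, (k : ℝ) ^ 2 / a t ^ 2 ≤ 1 := by
    intro t
    rw [div_le_one (by have := h0 t; positivity)]
    nlinarith [hka t, h1 t]
  -- the coefficients in the form `b`, `q`, `r`; the derivatives of `q` and `r` are at most a
  -- multiple of `k² / α`, the derivative of `arctan (t - ξ/k)`
  refine sq_add_sq_le_of_slowly_varying (c := p + 4 * κ ^ 2 + 2 * κ)
    (Λ := 1 + p + 2 * κ ^ 2 + κ)
    (b := fun t => κ⁻¹ * ρ t) (r := fun t => κ * a' t / (4 * ρ t ^ 3))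
    (q := fun t => 1 + p / (a t + β) + 2 * κ ^ 2 * k ^ 2 / a t ^ 2)
    (q' := fun t => -(p * a' t) / (a t + β) ^ 2 - 4 * κ ^ 2 * k ^ 2 * a' t / a t ^ 3)
    (r' := fun t => κ / 4 * (2 * k ^ 2 / ρ t ^ 3 - 3 / 2 * a' t ^ 2 / ρ t ^ 5))
    (by positivity) (fun t => ?_) (fun t => ?_) (fun t => ?_) (fun t => ?_)
    (hasDerivAt_arctan_phase hk ξ) (fun t => ?_) (fun t => ?_) (fun t => ?_) (fun t => ?_)
    (fun t => ?_) (fun t => ?_) (fun t => ?_) ?_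
  · refine HasDerivAt.congr_deriv (hx t) ?_
    have := (hρ0 t).ne'
    have e : κ⁻¹ * ρ t * (κ * a' t / (4 * ρ t ^ 3)) = 1 / 4 * (a t)⁻¹ * a' t := by
      rw [← hρ2]; field_simp
    rw [e]
  · refine HasDerivAt.congr_deriv (hy t) ?_
    have := (hρ0 t).ne'
    have e : κ⁻¹ * ρ t * (κ * a' t / (4 * ρ t ^ 3)) = 1 / 4 * (a t)⁻¹ * a' t := by
      rw [← hρ2]; field_simp
    rw [e]
  · have hb : a t + β ≠ 0 := by have := h0 t; positivity
    have h2 : a t ^ 2 ≠ 0 := by have := h0 t; positivity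
    have := (((hasDerivAt_const t p).div ((had t).add_const β) hb).const_add 1).add
      ((hasDerivAt_const t (2 * κ ^ 2 * (k : ℝ) ^ 2)).div ((had t).pow 2) h2)
    refine HasDerivAt.congr_deriv this ?_
    have := (h0 t).ne'
    simp only [← ha, ← ha', Pi.pow_apply]
    push_cast
    field_simp
    ring
  · have h2 : 4 * ρ t ^ 3 ≠ 0 := by have := hρ0 t; positivity
    have := ((had' t).const_mul κ).div (((hρd t).pow 3).const_mul 4) h2
    refine HasDerivAt.congr_deriv this ?_
    have := (hρ0 t).ne'
    simp only [← ha', Pi.pow_apply]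
    push_cast
    field_simp
  · exact (abs_lt.2 ⟨Real.neg_pi_div_two_lt_arctan _, Real.arctan_lt_pi_div_two _⟩).le
  · have := h0 t; positivity
  · have h0t := h0 t
    have hat : |a' t| ≤ a t := abs_alphaDeriv_le k ξ t
    have b1 : |-(p * a' t) / (a t + β) ^ 2| ≤ p * (k ^ 2 / a t) := by
      rw [abs_div, abs_neg, abs_mul, abs_of_pos hp, abs_of_pos (by positivity : 0 < (a t + β) ^ 2),
        div_le_iff₀ (by positivity)]
      calc p * |a' t| ≤ p * a t := by gcongr
        _ = p * (1 / a t) * a t ^ 2 := by field_simp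
        _ ≤ p * (k ^ 2 / a t) * (a t + β) ^ 2 := by gcongr; linarith
    have b2 : |4 * κ ^ 2 * k ^ 2 * a' t / a t ^ 3| ≤ 4 * κ ^ 2 * (k ^ 2 / a t) := by
      rw [abs_div, abs_mul, abs_of_nonneg (by positivity : (0:ℝ) ≤ 4 * κ ^ 2 * k ^ 2),
        abs_of_pos (by positivity : 0 < a t ^ 3), div_le_iff₀ (by positivity)]
      calc 4 * κ ^ 2 * k ^ 2 * |a' t| ≤ 4 * κ ^ 2 * k ^ 2 * (a t * a t) := by
            gcongr; nlinarith [h1 t]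
        _ = _ := by field_simp
    refine (abs_sub _ _).trans ((add_le_add b1 b2).trans ?_)
    have : 0 ≤ (k : ℝ) ^ 2 / a t := by positivity
    nlinarith [mul_nonneg hκ.le this]
  · have h0t := hρ0 t
    have hr1 := hρ1 t
    have b0 : a' t ^ 2 / ρ t ^ 5 ≤ 4 * (k ^ 2 / ρ t ^ 3) := by
      rw [div_le_iff₀ (by positivity)]
      calc a' t ^ 2 ≤ 4 * k ^ 2 * ρ t ^ 2 := by rw [hρ2]; exact hsq t
        _ = _ := by field_simp
    have b1 : (k : ℝ) ^ 2 / ρ t ^ 3 ≤ k ^ 2 / a t := by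
      rw [← hρ2]
      apply div_le_div_of_nonneg_left (by positivity) (by positivity)
      exact pow_le_pow_right₀ hr1 (by norm_num)
    have b2 : 0 ≤ a' t ^ 2 / ρ t ^ 5 := by positivity
    have b3 : 0 ≤ (k : ℝ) ^ 2 / ρ t ^ 3 := by positivity
    have hb : |2 * (k : ℝ) ^ 2 / ρ t ^ 3 - 3 / 2 * a' t ^ 2 / ρ t ^ 5| ≤ 8 * (k ^ 2 / a t) := by
      rw [mul_div_assoc, mul_div_assoc, abs_le]
      constructor <;> linarith
    rw [abs_mul, abs_of_pos (by positivity : 0 < κ / 4)]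
    have := mul_le_mul_of_nonneg_left hb (by positivity : 0 ≤ κ / 4)
    have h4 : 0 ≤ (k : ℝ) ^ 2 / a t := by have := h0 t; positivity
    nlinarith [mul_nonneg hp.le h4, mul_nonneg (sq_nonneg κ) h4]
  · have h0t := h0 t
    have h2 := hrsq t
    have h3 : 0 ≤ p / (a t + β) := by positivity
    have h4 : κ ^ 2 * k ^ 2 / (4 * a t ^ 2) = 1 / 4 * (κ ^ 2 * k ^ 2 / a t ^ 2) := by field_simp
    have h5 : 2 * κ ^ 2 * k ^ 2 / a t ^ 2 = 2 * (κ ^ 2 * k ^ 2 / a t ^ 2) := by ring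
    have h6 : 0 ≤ κ ^ 2 * (k : ℝ) ^ 2 / a t ^ 2 := by positivity
    rw [h4] at h2
    rw [h5]
    linarith
  · have h0t := h0 t
    have h3 : p / (a t + β) ≤ p := div_le_self hp.le (by linarith [h1 t])
    have h5 : 2 * κ ^ 2 * k ^ 2 / a t ^ 2 = 2 * κ ^ 2 * (k ^ 2 / a t ^ 2) := by ring
    have := mul_le_mul_of_nonneg_left (hkaa t) (by positivity : 0 ≤ 2 * κ ^ 2)
    rw [h5]
    linarith
  · have h0t := h0 t
    have : |κ * a' t / (4 * ρ t ^ 3)| ≤ κ := by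
      apply abs_le_of_sq_le_sq _ hκ.le
      refine (hrsq t).trans ?_
      have e : κ ^ 2 * k ^ 2 / (4 * a t ^ 2) = κ ^ 2 * (1 / 4 * (k ^ 2 / a t ^ 2)) := by field_simp
      rw [e]
      have := hkaa t
      nlinarith [sq_nonneg κ]
    have := sq_nonneg κ
    linarith
  · have := sq_nonneg κ
    linarith

/-! ### Bounds for the solution operator -/

lemma Lmatrix_apply (P : Parameters) {k : ℤ} (hk : k ≠ 0) (ξ t : ℝ) :
    Lmatrix P k ξ t 0 0 = -(1 / 4 * (alpha k ξ t)⁻¹ * alphaDeriv k ξ t) ∧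
    Lmatrix P k ξ t 0 1 = -((√(P.mPlus / P.TPlus))⁻¹ * √(alpha k ξ t)) ∧
    Lmatrix P k ξ t 1 0 = (√(P.mPlus / P.TPlus))⁻¹ * √(alpha k ξ t)
      * (1 + 4 * Real.pi * P.e ^ 2 / P.TPlus
            / (alpha k ξ t + 4 * Real.pi * P.e ^ 2 / P.TMinus)
          + 2 * √(P.mPlus / P.TPlus) ^ 2 * k ^ 2 / alpha k ξ t ^ 2) ∧
    Lmatrix P k ξ t 1 1 = 1 / 4 * (alpha k ξ t)⁻¹ * alphaDeriv k ξ t := by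
  have hm := P.mPlus_pos
  have hT := P.TPlus_pos
  have hα := alpha_pos hk ξ t
  have hβ : 0 < 4 * Real.pi * P.e ^ 2 / P.TMinus := by
    have := P.TMinus_pos; have := P.e_pos; positivity
  have e1 : √(P.TPlus / P.mPlus) = (√(P.mPlus / P.TPlus))⁻¹ := by
    rw [← Real.sqrt_inv, inv_div]
  have e2 : √(P.mPlus * P.TPlus) = √(P.mPlus / P.TPlus) * P.TPlus := by
    rw [show P.mPlus * P.TPlus = P.mPlus / P.TPlus * P.TPlus ^ 2 by field_simp,
      Real.sqrt_mul (by positivity), Real.sqrt_sq hT.le]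
  have e3 : alpha k ξ t ^ (3 / 2 : ℝ) = √(alpha k ξ t) ^ 3 := by
    rw [Real.sqrt_eq_rpow, ← Real.rpow_natCast, ← Real.rpow_mul hα.le]; norm_num
  have hκ : 0 < √(P.mPlus / P.TPlus) := Real.sqrt_pos.2 (by positivity)
  refine ⟨by simp [Lmatrix], ?_, ?_, by simp [Lmatrix]⟩
  · simp only [Lmatrix, Matrix.of_apply, Matrix.cons_val_one, Matrix.cons_val_zero,
      ← Real.sqrt_eq_rpow, e1]
  · simp only [Lmatrix, Matrix.of_apply, Matrix.cons_val_one, Matrix.cons_val_zero,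
      ← Real.sqrt_eq_rpow, e1, e2, e3]
    generalize √(P.mPlus / P.TPlus) = κ at *
    have h2 : √(alpha k ξ t) ^ 2 = alpha k ξ t := Real.sq_sqrt hα.le
    have h0 : 0 < √(alpha k ξ t) := Real.sqrt_pos.2 hα
    rw [← h2] at hα ⊢
    rw [Real.sqrt_sq h0.le]
    generalize √(alpha k ξ t) = ρ at *
    generalize 4 * Real.pi * P.e ^ 2 / P.TMinus = β at *
    have : ρ ^ 2 + β ≠ 0 := by positivity
    field_simp
    ring

lemma continuous_Lmatrix (P : Parameters) {k : ℤ} (hk : k ≠ 0) (ξ : ℝ) :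
    Continuous (Lmatrix P k ξ) := by
  have ha := continuous_alpha k ξ
  have ha' : Continuous (alphaDeriv k ξ) :=
    continuous_iff_continuousAt.2 fun t => (hasDerivAt_alphaDeriv k ξ t).continuousAt
  have hβ : 0 < 4 * Real.pi * P.e ^ 2 / P.TMinus := by
    have := P.TMinus_pos; have := P.e_pos; positivity
  have h0 : ∀ t, alpha k ξ t ≠ 0 := fun t => (alpha_pos hk ξ t).ne'
  have h1 : ∀ t, alpha k ξ t + 4 * Real.pi * P.e ^ 2 / P.TMinus ≠ 0 := fun t => by
    have := alpha_pos hk ξ t; positivity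
  have h2 : ∀ t, alpha k ξ t ^ 2 ≠ 0 := fun t => pow_ne_zero 2 (h0 t)
  refine continuous_matrix fun i j => ?_
  obtain ⟨e1, e2, e3, e4⟩ : _ ∧ _ ∧ _ ∧ _ :=
    ⟨fun t => (Lmatrix_apply P hk ξ t).1, fun t => (Lmatrix_apply P hk ξ t).2.1,
      fun t => (Lmatrix_apply P hk ξ t).2.2.1, fun t => (Lmatrix_apply P hk ξ t).2.2.2⟩
  fin_cases i <;> fin_cases j <;>
    simp only [Fin.zero_eta, Fin.mk_one, Fin.isValue, e1, e2, e3, e4] <;>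
    fun_prop (disch := assumption)

lemma isSolutionOperator_solutionOperator (P : Parameters) {k : ℤ} (hk : k ≠ 0) (ξ : ℝ) :
    IsSolutionOperator (Lmatrix P k ξ) (solutionOperator P k ξ) :=
  Classical.epsilon_spec (exists_isSolutionOperator _ (continuous_Lmatrix P hk ξ))

/-- The solution operators are bounded uniformly in time and frequency. -/
theorem exists_abs_solutionOperator_le (P : Parameters) :
    ∃ C : ℝ, 0 < C ∧ ∀ (k : ℤ) (_ : k ≠ 0) (ξ s t : ℝ) (i j : Fin 2),
      |solutionOperator P k ξ t s i j| ≤ C := by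
  have hm := P.mPlus_pos
  have hT := P.TPlus_pos
  have hT' := P.TMinus_pos
  have he := P.e_pos
  obtain ⟨C, hC, h⟩ := exists_sq_add_sq_le (κ := √(P.mPlus / P.TPlus))
    (p := 4 * Real.pi * P.e ^ 2 / P.TPlus) (β := 4 * Real.pi * P.e ^ 2 / P.TMinus)
    (Real.sqrt_pos.2 (by positivity)) (by positivity) (by positivity)
  refine ⟨√C, Real.sqrt_pos.2 hC, fun k hk ξ s t i j => ?_⟩
  have hS := isSolutionOperator_solutionOperator P hk ξ s
  have h0 : ∀ t, HasDerivAt (fun t => solutionOperator P k ξ t s 0 j) _ t := fun t => hS.2 t 0 j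
  have h1 : ∀ t, HasDerivAt (fun t => solutionOperator P k ξ t s 1 j) _ t := fun t => hS.2 t 1 j
  have key := h k hk ξ (fun t => solutionOperator P k ξ t s 0 j)
    (fun t => solutionOperator P k ξ t s 1 j)
    (fun t => (h0 t).congr_deriv (by
      obtain ⟨e1, e2, e3, e4⟩ := Lmatrix_apply P hk ξ t
      rw [Matrix.mul_apply, Fin.sum_univ_two, e1, e2]; ring))
    (fun t => (h1 t).congr_deriv (by
      obtain ⟨e1, e2, e3, e4⟩ := Lmatrix_apply P hk ξ t
      rw [Matrix.mul_apply, Fin.sum_univ_two, e3, e4])) s t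
  have hs : solutionOperator P k ξ s s 0 j ^ 2 + solutionOperator P k ξ s s 1 j ^ 2 = 1 := by
    rw [hS.1]; clear h0 h1 key; revert j; simp [Fin.forall_fin_two]
  simp only [hs, mul_one] at key
  apply Real.abs_le_sqrt
  fin_cases i
  · exact le_trans (by simp [sq_nonneg]) key
  · exact le_trans (by simp [sq_nonneg]) key

/-- `S(0,s)` is the inverse of `S(s,0)`, which is its adjugate because `L₊` has trace zero. -/
theorem solutionOperator_zero_left (P : Parameters) {k : ℤ} (hk : k ≠ 0) (ξ s : ℝ) :
    solutionOperator P k ξ 0 s = (solutionOperator P k ξ s 0).adjugate := by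
  set S := solutionOperator P k ξ with hSdef
  have hS : IsSolutionOperator (Lmatrix P k ξ) S := isSolutionOperator_solutionOperator P hk ξ
  have e : ∀ t, Lmatrix P k ξ t 1 1 = - Lmatrix P k ξ t 0 0 := fun t => by
    obtain ⟨e1, e2, e3, e4⟩ := Lmatrix_apply P hk ξ t
    rw [e1, e4]; ring
  have hd : ∀ a t i j, HasDerivAt (fun t => S t a i j) (Lmatrix P k ξ t i 0 * S t a 0 j
      + Lmatrix P k ξ t i 1 * S t a 1 j) t := fun a t i j => by
    have := (hS a).2 t i j
    rwa [Matrix.mul_apply, Fin.sum_univ_two] at this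
  have hconst : ∀ i j, (S 0 0).adjugate i 0 * S 0 s 0 j + (S 0 0).adjugate i 1 * S 0 s 1 j
      = (S s 0).adjugate i 0 * S s s 0 j + (S s 0).adjugate i 1 * S s s 1 j := by
    intro i j
    have hz : ∀ t, HasDerivAt (fun t => (S t 0).adjugate i 0 * S t s 0 j
        + (S t 0).adjugate i 1 * S t s 1 j) 0 t := by
      intro t
      have a := hd 0 t
      have b := hd s t
      fin_cases i
      · have := ((a 1 1).mul (b 0 j)).sub ((a 0 1).mul (b 1 j))
        refine (this.congr_deriv ?_).congr_of_eventuallyEq (.of_forall fun t => ?_)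
        · simp only [e]; ring
        · simp [Matrix.adjugate_fin_two]; ring
      · have := ((a 0 0).mul (b 1 j)).sub ((a 1 0).mul (b 0 j))
        refine (this.congr_deriv ?_).congr_of_eventuallyEq (.of_forall fun t => ?_)
        · simp only [e]; ring
        · simp [Matrix.adjugate_fin_two]; ring
    have hdiff : Differentiable ℝ (fun t => (S t 0).adjugate i 0 * S t s 0 j
        + (S t 0).adjugate i 1 * S t s 1 j) := fun t => (hz t).differentiableAt
    exact is_const_of_deriv_eq_zero hdiff (fun t => (hz t).deriv) 0 s
  simp [(hS 0).1, (hS s).1, Fin.forall_fin_two] at hconst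
  obtain ⟨⟨h00, h01⟩, h10, h11⟩ := hconst
  ext i j
  fin_cases i <;> fin_cases j <;> assumption

/-! ### The localized system -/

/-- The backward equation `∂ₛ S(0,s) = -S(0,s) L(s)`. -/
lemma hasDerivAt_solutionOperator_zero_left (P : Parameters) {k : ℤ} (hk : k ≠ 0) (ξ s : ℝ)
    (i j : Fin 2) :
    HasDerivAt (fun s => solutionOperator P k ξ 0 s i j)
      (-(solutionOperator P k ξ 0 s i 0 * Lmatrix P k ξ s 0 j
        + solutionOperator P k ξ 0 s i 1 * Lmatrix P k ξ s 1 j)) s := by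
  have e : Lmatrix P k ξ s 1 1 = - Lmatrix P k ξ s 0 0 := by
    obtain ⟨e1, e2, e3, e4⟩ := Lmatrix_apply P hk ξ s
    rw [e1, e4]; ring
  have hd : ∀ i j, HasDerivAt (fun t => solutionOperator P k ξ t 0 i j)
      (Lmatrix P k ξ s i 0 * solutionOperator P k ξ s 0 0 j
      + Lmatrix P k ξ s i 1 * solutionOperator P k ξ s 0 1 j) s := fun i j => by
    have := (isSolutionOperator_solutionOperator P hk ξ 0).2 s i j
    rwa [Matrix.mul_apply, Fin.sum_univ_two] at this
  simp only [solutionOperator_zero_left P hk, Matrix.adjugate_fin_two]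
  fin_cases i <;> fin_cases j
  · refine (hd 1 1).congr_deriv ?_
    simp [e]; ring
  · refine (hd 0 1).neg.congr_deriv ?_
    simp [e]; ring
  · refine (hd 1 0).neg.congr_deriv ?_
    simp [e]; ring
  · refine (hd 0 0).congr_deriv ?_
    simp [e]; ring

lemma norm_sub_le_integral_of_hasDerivAt {f f' : ℝ → ℂ} {g : ℝ → ℝ} {T : ℝ} (hT : 0 ≤ T)
    (hf : ContinuousOn f (Icc 0 T)) (hd : ∀ t ∈ Ioo 0 T, HasDerivAt f (f' t) t)
    (hb : ∀ t ∈ Ioo 0 T, ‖f' t‖ ≤ g t) (hg : ContinuousOn g (Icc 0 T)) :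
    ‖f T - f 0‖ ≤ ∫ t in (0 : ℝ)..T, g t := by
  refine norm_sub_le_integral_of_norm_deriv_le_of_le hT hf
    (fun t ht => (hd t ht).differentiableAt.differentiableWithinAt)
    (.of_forall fun t ht => by rw [(hd t ht).deriv]; exact hb t ht)
    (ContinuousOn.intervalIntegrable (by rwa [uIcc_of_le hT]))

/-- The localized system at frequency `(k, ξ)`: the Fourier transforms `N, U, V, Φ` of cut-offs of
the density, the two velocity components and the potential, in coordinates that move with the
shear. The terms `N₁, V₁, Φ₁, Φ₂` are commutators with the cut-off: transforms of the fields cut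
off by the first and second derivative of the cut-off. -/
structure IsLocalizedSolution (P : Parameters) (k : ℤ) (ξ : ℝ)
    (N U V Φ N₁ V₁ Φ₁ Φ₂ : ℝ → ℂ) : Prop where
  contN : ContinuousOn N (Ici 0)
  contU : ContinuousOn U (Ici 0)
  contV : ContinuousOn V (Ici 0)
  contN₁ : ContinuousOn N₁ (Ici 0)
  contV₁ : ContinuousOn V₁ (Ici 0)
  contΦ₁ : ContinuousOn Φ₁ (Ici 0)
  contΦ₂ : ContinuousOn Φ₂ (Ici 0)
  derivN : ∀ s, 0 < s → HasDerivAt N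
    (-(Complex.I * k * U s + (Complex.I * (ξ - k * s) * V s - V₁ s))) s
  derivU : ∀ s, 0 < s → HasDerivAt U
    (-V s - (P.TPlus / P.mPlus) * (Complex.I * k * N s)
      - (P.e / P.mPlus) * (Complex.I * k * Φ s)) s
  derivV : ∀ s, 0 < s → HasDerivAt V
    (-(P.TPlus / P.mPlus) * (Complex.I * (ξ - k * s) * N s - N₁ s)
      - (P.e / P.mPlus) * (Complex.I * (ξ - k * s) * Φ s - Φ₁ s)) s
  poisson : ∀ s, 0 < s →
    -(k : ℂ) ^ 2 * Φ s + (Complex.I * (ξ - k * s) * (Complex.I * (ξ - k * s) * Φ s - Φ₁ s)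
      - (Complex.I * (ξ - k * s) * Φ₁ s - Φ₂ s))
      = 4 * Real.pi * P.e * (P.e / P.TMinus * Φ s - N s)

/-- The symmetrized unknowns `(√(T₊/m₊) N / α^{1/4}, Ψ / α^{3/4})`. -/
def symmetrized (P : Parameters) (k : ℤ) (ξ s : ℝ) (N Ψ : ℂ) : Fin 2 → ℂ :=
  ![((√(P.TPlus / P.mPlus) / alpha k ξ s ^ (1 / 4 : ℝ) : ℝ) : ℂ) * N,
    ((1 / alpha k ξ s ^ (3 / 4 : ℝ) : ℝ) : ℂ) * Ψ]

lemma hasDerivAt_div_alpha_rpow {k : ℤ} (hk : k ≠ 0) (ξ s c r : ℝ) :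
    HasDerivAt (fun s => ((c / alpha k ξ s ^ r : ℝ) : ℂ))
      ((-r * (alpha k ξ s)⁻¹ * alphaDeriv k ξ s * (c / alpha k ξ s ^ r) : ℝ) : ℂ) s := by
  have h0 := alpha_pos hk ξ s
  have h := ((hasDerivAt_alpha k ξ s).rpow_const (p := -r) (Or.inl h0.ne')).const_mul c
  have h2 : HasDerivAt (fun s => c / alpha k ξ s ^ r)
      (-r * (alpha k ξ s)⁻¹ * alphaDeriv k ξ s * (c / alpha k ξ s ^ r)) s := by
    refine (h.congr_deriv ?_).congr_of_eventuallyEq (.of_forall fun t => ?_)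
    · rw [Real.rpow_sub h0, Real.rpow_neg h0.le, Real.rpow_one]
      field_simp
    · simp only [Real.rpow_neg (alpha_pos hk ξ t).le]
      rfl
  exact h2.ofReal_comp

/-- The equation for `Ψ / α^{3/4}` as an identity between rational functions; here `p = ik`,
`q = i(ξ - ks)`, `a = α` and `B = α + 4πe²/T₋`. -/
lemma symmetrized_momentum_identity {w a B p q c m T e N U V Φ E₂ N₁ Φ₁ Φ₂ : ℂ} (ha : a ≠ 0)
    (hB : B ≠ 0) (hm : m ≠ 0) (hapq : a = -(p ^ 2 + q ^ 2))
    (hΦ : Φ = (c * e * N - 2 * q * Φ₁ + Φ₂) / B) (hE : E₂ = T / m * N₁ + e / m * Φ₁) :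
    -(3 / 4) * a⁻¹ * (2 * p * q) * w * (p * U + q * V)
      + w * (p * (-V - T / m * (p * N) - e / m * (p * Φ))
        + (-p * V + q * (-(T / m) * (q * N - N₁) - e / m * (q * Φ - Φ₁))))
      = w * (T / m * a + c * e ^ 2 / m * (a / B) + -2 * p ^ 2 / a) * N
        + 1 / 4 * a⁻¹ * (2 * p * q) * (w * (p * U + q * V))
        + -(-2 * p ^ 2 / a * w) * (N - q * U + p * V)
        + w * (q * E₂ + e / m * (a / B * (-(2 * q * Φ₁) + Φ₂))) := by
  subst hΦ hE hapq
  have h : p ^ 2 + q ^ 2 ≠ 0 := neg_ne_zero.1 ha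
  field_simp
  ring

/-- The symmetrized unknowns solve `A' = L₊ A + M₊ F + error`, where `F = N + Ω` is conserved up
to errors. -/
lemma IsLocalizedSolution.hasDerivAt_symmetrized {P : Parameters} {k : ℤ} {ξ : ℝ}
    {N U V Φ N₁ V₁ Φ₁ Φ₂ : ℝ → ℂ} (h : IsLocalizedSolution P k ξ N U V Φ N₁ V₁ Φ₁ Φ₂)
    (hk : k ≠ 0) {Ψ F : ℝ → ℂ} {A : ℝ → Fin 2 → ℂ}
    (hΨ : Ψ = fun s => Complex.I * k * U s + Complex.I * (ξ - k * s) * V s)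
    (hF : F = fun s => N s - Complex.I * (ξ - k * s) * U s + Complex.I * k * V s)
    (hA : A = fun s => symmetrized P k ξ s (N s) (Ψ s)) :
    ∃ E₀ E₁ D : ℝ → ℂ, ∀ s, 0 < s →
      HasDerivAt (fun s => A s 0) (Lmatrix P k ξ s 0 0 * A s 0 + Lmatrix P k ξ s 0 1 * A s 1
        + E₀ s) s ∧
      HasDerivAt (fun s => A s 1) (Lmatrix P k ξ s 1 0 * A s 0 + Lmatrix P k ξ s 1 1 * A s 1
        + Mvector k ξ s 1 * F s + E₁ s) s ∧
      HasDerivAt F (D s) s ∧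
      ‖E₀ s‖ ≤ √(P.TPlus / P.mPlus) * ‖V₁ s‖ ∧
      ‖E₁ s‖ ≤ P.TPlus / P.mPlus * ‖N₁ s‖ + P.e / P.mPlus * (3 * ‖Φ₁ s‖ + ‖Φ₂ s‖) ∧
      ‖D s‖ ≤ ‖V₁ s‖ + |(k : ℝ)| * (P.TPlus / P.mPlus * ‖N₁ s‖ + P.e / P.mPlus * ‖Φ₁ s‖) := by
  subst hΨ hF hA
  have hm := P.mPlus_pos
  have hT := P.TPlus_pos
  have hT' := P.TMinus_pos
  have he := P.e_pos
  set β : ℝ := 4 * Real.pi * P.e ^ 2 / P.TMinus with hβ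
  have hβ0 : 0 < β := by positivity
  set w₁ : ℝ → ℝ := fun s => √(P.TPlus / P.mPlus) / alpha k ξ s ^ (1 / 4 : ℝ) with hw₁
  set w₃ : ℝ → ℝ := fun s => 1 / alpha k ξ s ^ (3 / 4 : ℝ) with hw₃
  set E₂ : ℝ → ℂ := fun s => P.TPlus / P.mPlus * N₁ s + P.e / P.mPlus * Φ₁ s with hE₂
  refine ⟨fun s => w₁ s * V₁ s, fun s => w₃ s * (Complex.I * (ξ - k * s) * E₂ s
    + P.e / P.mPlus * (alpha k ξ s / (alpha k ξ s + β)
      * (-(2 * Complex.I * (ξ - k * s) * Φ₁ s) + Φ₂ s))),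
    fun s => V₁ s + Complex.I * k * E₂ s, fun s hs => ?_⟩
  have hα := alpha_pos hk ξ s
  have hα1 := one_le_alpha hk ξ s
  have hζ : HasDerivAt (fun s : ℝ => Complex.I * ((ξ : ℂ) - k * s)) (-(Complex.I * k)) s := by
    have := ((((hasDerivAt_id (s : ℂ)).const_mul (k : ℂ)).const_sub (ξ : ℂ)).const_mul
      Complex.I).comp_ofReal
    exact this.congr_deriv (by simp)
  have dU := h.derivU s hs
  have dV := h.derivV s hs
  have dN := h.derivN s hs
  have hP := h.poisson s hs
  have dΨ := (dU.const_mul (Complex.I * k)).add (hζ.mul dV)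
  have dF := (dN.sub (hζ.mul dU)).add (dV.const_mul (Complex.I * k))
  have hI : Complex.I ^ 2 = -1 := Complex.I_sq
  -- the algebraic relations between the weights
  have hw₁₃ : √(P.TPlus / P.mPlus) * √(alpha k ξ s) * w₃ s = w₁ s := by
    simp only [hw₁, hw₃]
    rw [Real.sqrt_eq_rpow (alpha k ξ s), show (3 / 4 : ℝ) = 1 / 2 + 1 / 4 by norm_num,
      Real.rpow_add hα]
    have := Real.rpow_pos_of_pos hα (1 / 2)
    field_simp
  have hκ : (√(P.mPlus / P.TPlus))⁻¹ = √(P.TPlus / P.mPlus) := by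
    rw [← Real.sqrt_inv, inv_div]
  obtain ⟨l00, l01, l10, l11⟩ := Lmatrix_apply P hk ξ s
  rw [hκ] at l01 l10
  have hM : Mvector k ξ s 1 = -(2 * k ^ 2 / alpha k ξ s * w₃ s) := by
    simp only [Mvector, hw₃, Matrix.cons_val_one, Matrix.cons_val_fin_one]
    rw [show (7 / 4 : ℝ) = 1 + 3 / 4 by norm_num, Real.rpow_add hα, Real.rpow_one]
    field_simp
  have hl10 : Lmatrix P k ξ s 1 0 * w₁ s = w₃ s * (P.TPlus / P.mPlus * alpha k ξ s
      + 4 * Real.pi * P.e ^ 2 / P.mPlus * (alpha k ξ s / (alpha k ξ s + β))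
      + 2 * k ^ 2 / alpha k ξ s) := by
    rw [l10, ← hw₁₃, ← hβ, Real.sq_sqrt (by positivity)]
    have e1 : √(P.TPlus / P.mPlus) * √(P.TPlus / P.mPlus) = P.TPlus / P.mPlus :=
      Real.mul_self_sqrt (by positivity)
    have e2 : √(alpha k ξ s) * √(alpha k ξ s) = alpha k ξ s := Real.mul_self_sqrt hα.le
    calc _ = (√(P.TPlus / P.mPlus) * √(P.TPlus / P.mPlus))
          * (√(alpha k ξ s) * √(alpha k ξ s)) * w₃ s * (1 + 4 * Real.pi * P.e ^ 2 / P.TPlus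
            / (alpha k ξ s + β) + 2 * (P.mPlus / P.TPlus) * k ^ 2 / alpha k ξ s ^ 2) := by ring
      _ = _ := by
        rw [e1, e2]
        have : alpha k ξ s + β ≠ 0 := by positivity
        field_simp
  have hαc : (alpha k ξ s : ℂ) = (k : ℂ) ^ 2 + (ξ - k * s) ^ 2 := by
    simp only [alpha]; push_cast; ring
  have hα'c : (alphaDeriv k ξ s : ℂ) = -2 * k * (ξ - k * s) := by
    simp only [alphaDeriv]; push_cast; ring
  have hβc : (4 * Real.pi * P.e * (P.e / P.TMinus) : ℂ) = β := by
    rw [hβ]; push_cast; ring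
  have hα0 : (alpha k ξ s : ℂ) ≠ 0 := by exact_mod_cast hα.ne'
  have hαβ : (alpha k ξ s : ℂ) + β ≠ 0 := by
    exact_mod_cast (by positivity : alpha k ξ s + β ≠ 0)
  have hmc : (P.mPlus : ℂ) ≠ 0 := by exact_mod_cast hm.ne'
  have hΦ : Φ s = (4 * Real.pi * P.e * N s - 2 * Complex.I * (ξ - k * s) * Φ₁ s + Φ₂ s)
      / (alpha k ξ s + β) := by
    rw [eq_div_iff hαβ, ← hβc, hαc]
    linear_combination -hP + (ξ - k * s) ^ 2 * Φ s * hI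
  have hζα : |ξ - k * s| * w₃ s ≤ 1 := by
    have h1 : |ξ - k * s| ≤ alpha k ξ s ^ (1 / 2 : ℝ) := by
      rw [← Real.sqrt_eq_rpow]
      exact Real.abs_le_sqrt (by simp only [alpha]; nlinarith [sq_nonneg (k : ℝ)])
    have h2 : alpha k ξ s ^ (1 / 2 : ℝ) ≤ alpha k ξ s ^ (3 / 4 : ℝ) :=
      Real.rpow_le_rpow_of_exponent_le hα1 (by norm_num)
    simp only [hw₃]
    rw [mul_one_div, div_le_one (Real.rpow_pos_of_pos hα _)]
    exact h1.trans h2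
  have hw₃0 : 0 < w₃ s := by have := Real.rpow_pos_of_pos hα (3 / 4); simp only [hw₃]; positivity
  have hw₃1 : w₃ s ≤ 1 := by
    simp only [hw₃]
    rw [div_le_one (Real.rpow_pos_of_pos hα _)]
    exact Real.one_le_rpow hα1 (by norm_num)
  have hw₁0 : 0 ≤ w₁ s := by have := Real.rpow_pos_of_pos hα (1 / 4); simp only [hw₁]; positivity
  have hw₁1 : w₁ s ≤ √(P.TPlus / P.mPlus) :=
    div_le_self (Real.sqrt_nonneg _) (Real.one_le_rpow hα1 (by norm_num))
  have hζn : ‖Complex.I * ((ξ : ℂ) - k * s)‖ = |ξ - k * s| := by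
    rw [norm_mul, Complex.norm_I, one_mul,
      show (ξ : ℂ) - k * s = ((ξ - k * s : ℝ) : ℂ) by push_cast; ring, Complex.norm_real,
      Real.norm_eq_abs]
  have hE₂n : ‖E₂ s‖ ≤ P.TPlus / P.mPlus * ‖N₁ s‖ + P.e / P.mPlus * ‖Φ₁ s‖ := by
    refine (norm_add_le _ _).trans (le_of_eq ?_)
    simp only [norm_mul, norm_div, Complex.norm_real, Real.norm_eq_abs, abs_of_pos hm,
      abs_of_pos hT, abs_of_pos he]
  refine ⟨?_, ?_, ?_, ?_, ?_, ?_⟩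
  · have := (hasDerivAt_div_alpha_rpow hk ξ s √(P.TPlus / P.mPlus) (1 / 4)).mul dN
    simp only [symmetrized, Matrix.cons_val_zero, Matrix.cons_val_one]
    refine this.congr_deriv ?_
    have hw₁₃c : (√(P.TPlus / P.mPlus) * √(alpha k ξ s) * w₃ s : ℂ) = w₁ s := by
      exact_mod_cast congrArg ((↑) : ℝ → ℂ) hw₁₃
    rw [l00, l01]
    simp only [hw₁, hw₃] at hw₁₃c ⊢
    push_cast at hw₁₃c ⊢
    linear_combination (Complex.I * k * U s + Complex.I * (ξ - k * s) * V s) * hw₁₃c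
  · have := (hasDerivAt_div_alpha_rpow hk ξ s 1 (3 / 4)).mul dΨ
    simp only [symmetrized, Matrix.cons_val_zero, Matrix.cons_val_one]
    refine this.congr_deriv ?_
    have hl10c : (Lmatrix P k ξ s 1 0 : ℂ) * w₁ s = w₃ s * (P.TPlus / P.mPlus * alpha k ξ s
      + 4 * Real.pi * P.e ^ 2 / P.mPlus * (alpha k ξ s / (alpha k ξ s + β))
      + 2 * k ^ 2 / alpha k ξ s) := by
      exact_mod_cast congrArg ((↑) : ℝ → ℂ) hl10
    change ((-(3 / 4) * (alpha k ξ s)⁻¹ * alphaDeriv k ξ s * w₃ s : ℝ) : ℂ) * _ + (w₃ s : ℂ) * _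
      = (Lmatrix P k ξ s 1 0 : ℂ) * (w₁ s * N s) + (Lmatrix P k ξ s 1 1 : ℂ) * (w₃ s * _) + _ + _
    have key := symmetrized_momentum_identity (w := (w₃ s : ℂ)) (p := Complex.I * k)
      (q := Complex.I * (ξ - k * s)) (N := N s) (U := U s) (V := V s) (Φ := Φ s)
      (E₂ := E₂ s) (N₁ := N₁ s) (Φ₁ := Φ₁ s) (Φ₂ := Φ₂ s) (c := 4 * Real.pi) (e := P.e)
      (T := P.TPlus) hα0 hαβ hmc
      (by rw [hαc]; linear_combination (k ^ 2 + (ξ - k * s : ℂ) ^ 2) * hI)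
      (by rw [hΦ, ← mul_assoc 2]) rfl
    have hk2 : 2 * (k : ℂ) ^ 2 = -2 * (Complex.I * k) ^ 2 := by linear_combination 2 * k ^ 2 * hI
    have hα'I : (alphaDeriv k ξ s : ℂ)
        = 2 * (Complex.I * k) * (Complex.I * (ξ - k * s)) := by
      rw [hα'c]; linear_combination -2 * k * (ξ - k * s) * hI
    rw [← mul_assoc _ (w₁ s : ℂ) (N s), hl10c, l11, hM]
    push_cast
    rw [hα'I, hk2, mul_assoc 2 Complex.I]
    exact key
  · refine dF.congr_deriv ?_
    simp only [hE₂]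
    linear_combination (k * V s - k * V s) * hI
  · rw [norm_mul, Complex.norm_real, Real.norm_of_nonneg hw₁0]
    gcongr
  · have hq : ‖(alpha k ξ s : ℂ) / (alpha k ξ s + β)‖ ≤ 1 := by
      rw [← Complex.ofReal_add, ← Complex.ofReal_div, Complex.norm_real,
        Real.norm_of_nonneg (by positivity), div_le_one (by positivity)]
      linarith
    have hem : ‖(P.e / P.mPlus : ℂ)‖ = P.e / P.mPlus := by
      rw [norm_div, Complex.norm_real, Complex.norm_real, Real.norm_of_nonneg he.le,
        Real.norm_of_nonneg hm.le]
    have hb1 : w₃ s * ‖Complex.I * (ξ - k * s) * E₂ s‖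
        ≤ P.TPlus / P.mPlus * ‖N₁ s‖ + P.e / P.mPlus * ‖Φ₁ s‖ := by
      rw [norm_mul, hζn]
      calc _ = (|ξ - k * s| * w₃ s) * ‖E₂ s‖ := by ring
        _ ≤ 1 * (P.TPlus / P.mPlus * ‖N₁ s‖ + P.e / P.mPlus * ‖Φ₁ s‖) := by gcongr
        _ = _ := one_mul _
    have hb2 : w₃ s * ‖-(2 * Complex.I * (ξ - k * s) * Φ₁ s) + Φ₂ s‖ ≤ 2 * ‖Φ₁ s‖ + ‖Φ₂ s‖ := by
      have e : ‖2 * Complex.I * (ξ - k * s) * Φ₁ s‖ = 2 * (|ξ - k * s| * ‖Φ₁ s‖) := by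
        rw [mul_assoc 2, mul_assoc 2, norm_mul, norm_mul, hζn, Complex.norm_ofNat]
      calc _ ≤ w₃ s * (2 * (|ξ - k * s| * ‖Φ₁ s‖) + ‖Φ₂ s‖) := by
            gcongr
            refine (norm_add_le _ _).trans ?_
            rw [norm_neg, e]
        _ = 2 * ((|ξ - k * s| * w₃ s) * ‖Φ₁ s‖) + w₃ s * ‖Φ₂ s‖ := by ring
        _ ≤ 2 * (1 * ‖Φ₁ s‖) + 1 * ‖Φ₂ s‖ := by gcongr
        _ = _ := by ring
    rw [norm_mul, Complex.norm_real, Real.norm_of_nonneg hw₃0.le]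
    calc _ ≤ w₃ s * (‖Complex.I * (ξ - k * s) * E₂ s‖ + P.e / P.mPlus * (1 *
            ‖-(2 * Complex.I * (ξ - k * s) * Φ₁ s) + Φ₂ s‖)) := by
          gcongr
          refine (norm_add_le _ _).trans ?_
          rw [norm_mul (P.e / P.mPlus : ℂ), hem, norm_mul ((alpha k ξ s : ℂ) / _)]
          gcongr
      _ = w₃ s * ‖Complex.I * (ξ - k * s) * E₂ s‖ + P.e / P.mPlus * (w₃ s *
            ‖-(2 * Complex.I * (ξ - k * s) * Φ₁ s) + Φ₂ s‖) := by ring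
      _ ≤ _ := by
        refine (add_le_add hb1 (mul_le_mul_of_nonneg_left hb2 (by positivity))).trans
          (le_of_eq (by ring))
  · refine (norm_add_le _ _).trans ?_
    rw [norm_mul, norm_mul, Complex.norm_I, one_mul, Complex.norm_intCast]
    gcongr

/-! ### Duhamel's formula -/

lemma continuous_Mvector_one {k : ℤ} (hk : k ≠ 0) (ξ : ℝ) :
    Continuous fun s => Mvector k ξ s 1 := by
  simp only [Mvector, Matrix.cons_val_one, Matrix.cons_val_fin_one]
  exact (continuous_const.div ((continuous_alpha k ξ).rpow_const
    fun s => Or.inl (alpha_pos hk ξ s).ne')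
    fun s => (Real.rpow_pos_of_pos (alpha_pos hk ξ s) _).ne').neg

lemma continuous_solutionOperator_zero_left (P : Parameters) {k : ℤ} (hk : k ≠ 0) (ξ : ℝ)
    (i j : Fin 2) : Continuous fun s => solutionOperator P k ξ 0 s i j :=
  continuous_iff_continuousAt.2 fun s =>
    (hasDerivAt_solutionOperator_zero_left P hk ξ s i j).continuousAt

lemma mulVec_Mvector (P : Parameters) (k : ℤ) (ξ s : ℝ) (i : Fin 2) :
    (solutionOperator P k ξ 0 s).mulVec (Mvector k ξ s) i
      = solutionOperator P k ξ 0 s i 1 * Mvector k ξ s 1 := by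
  rw [Matrix.mulVec, dotProduct, Fin.sum_univ_two]
  simp [Mvector]

/-- The forcing is dominated by the derivative of a bounded phase. -/
lemma abs_Mvector_one_le {k : ℤ} (hk : k ≠ 0) (ξ s : ℝ) :
    |Mvector k ξ s 1| ≤ 2 * ((k : ℝ) ^ 2 / alpha k ξ s) := by
  have hα := alpha_pos hk ξ s
  have h : alpha k ξ s ≤ alpha k ξ s ^ (7 / 4 : ℝ) := by
    conv_lhs => rw [← Real.rpow_one (alpha k ξ s)]
    exact Real.rpow_le_rpow_of_exponent_le (one_le_alpha hk ξ s) (by norm_num)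
  simp only [Mvector, Matrix.cons_val_one, Matrix.cons_val_fin_one]
  rw [abs_neg, abs_of_nonneg (by positivity), mul_div_assoc]
  gcongr

lemma abs_Mvector_one_le' {k : ℤ} (hk : k ≠ 0) (ξ s : ℝ) :
    |Mvector k ξ s 1| ≤ 2 * (k : ℝ) ^ 2 := by
  refine (abs_Mvector_one_le hk ξ s).trans ?_
  gcongr
  exact div_le_self (sq_nonneg _) (one_le_alpha hk ξ s)

/-- Duhamel's formula for the localized system, read backwards: the data and the accumulated
forcing are controlled by the solution at the final time, with a constant that does not depend on
the frequency, and by the commutators. -/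
theorem exists_norm_data_add_forcing_le (P : Parameters) :
    ∃ C : ℝ, 0 < C ∧ ∀ (k : ℤ) (_ : k ≠ 0) (T : ℝ) (_ : 0 ≤ T), ∃ C' : ℝ, 0 ≤ C' ∧
      ∀ (ξ : ℝ) (N U V Φ N₁ V₁ Φ₁ Φ₂ : ℝ → ℂ),
        IsLocalizedSolution P k ξ N U V Φ N₁ V₁ Φ₁ Φ₂ → ∀ i,
        ‖symmetrized P k ξ 0 (N 0) (Complex.I * k * U 0 + Complex.I * ξ * V 0) i
            + (∫ s in (0 : ℝ)..T, ((solutionOperator P k ξ 0 s).mulVec (Mvector k ξ s) i : ℂ))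
              * (N 0 - Complex.I * ξ * U 0 + Complex.I * k * V 0)‖
          ≤ C * ∑ j, ‖symmetrized P k ξ T (N T)
                (Complex.I * k * U T + Complex.I * (ξ - k * T) * V T) j‖
            + C' * ∫ s in (0 : ℝ)..T, (‖N₁ s‖ + ‖V₁ s‖ + ‖Φ₁ s‖ + ‖Φ₂ s‖) := by
  obtain ⟨C, hC, hS⟩ := exists_abs_solutionOperator_le P
  have hm := P.mPlus_pos
  have hT' := P.TPlus_pos
  have he := P.e_pos
  set b : ℝ := √(P.TPlus / P.mPlus) + P.TPlus / P.mPlus + P.e / P.mPlus * 3 with hb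
  have hb0 : 0 ≤ b := by positivity
  refine ⟨C, hC, fun k hk T hT => ?_⟩
  set b₂ : ℝ := 1 + |(k : ℝ)| * (P.TPlus / P.mPlus + P.e / P.mPlus) with hb₂
  have hb₂0 : 0 ≤ b₂ := by positivity
  refine ⟨C * (2 * b + T * (2 * k ^ 2 * b₂)), by positivity, ?_⟩
  intro ξ N U V Φ N₁ V₁ Φ₁ Φ₂ h i
  set Ψ : ℝ → ℂ := fun s => Complex.I * k * U s + Complex.I * (ξ - k * s) * V s with hΨ
  set F : ℝ → ℂ := fun s => N s - Complex.I * (ξ - k * s) * U s + Complex.I * k * V s with hF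
  set A : ℝ → Fin 2 → ℂ := fun s => symmetrized P k ξ s (N s) (Ψ s) with hA
  obtain ⟨E₀, E₁, D, hE⟩ := h.hasDerivAt_symmetrized hk hΨ hF hA
  set ε : ℝ → ℝ := fun s => ‖N₁ s‖ + ‖V₁ s‖ + ‖Φ₁ s‖ + ‖Φ₂ s‖ with hε
  have hIcc : Icc 0 T ⊆ Ici (0 : ℝ) := fun s hs => hs.1
  have hεc : ContinuousOn ε (Ici 0) :=
    ((h.contN₁.norm.add h.contV₁.norm).add h.contΦ₁.norm).add h.contΦ₂.norm
  have hε0 : ∀ s, 0 ≤ ε s := fun s => by positivity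
  have hεi : ∀ s t, 0 ≤ s → 0 ≤ t → IntervalIntegrable ε volume s t := fun s t hs ht =>
    (hεc.mono fun x hx => (le_inf hs ht).trans hx.1).intervalIntegrable
  have hlin : Continuous fun s : ℝ => Complex.I * ((ξ : ℂ) - k * s) := by fun_prop
  have hFc : ContinuousOn F (Ici 0) :=
    (h.contN.sub (hlin.continuousOn.mul h.contU)).add (continuousOn_const.mul h.contV)
  have hΨc : ContinuousOn Ψ (Ici 0) :=
    (continuousOn_const.mul h.contU).add (hlin.continuousOn.mul h.contV)
  have hw : ∀ c r : ℝ, Continuous fun s => ((c / alpha k ξ s ^ r : ℝ) : ℂ) := fun c r =>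
    continuous_iff_continuousAt.2 fun s => (hasDerivAt_div_alpha_rpow hk ξ s c r).continuousAt
  have hA0 : ContinuousOn (fun s => A s 0) (Ici 0) := by
    simp only [hA, symmetrized, Matrix.cons_val_zero]
    exact (hw _ _).continuousOn.mul h.contN
  have hA1 : ContinuousOn (fun s => A s 1) (Ici 0) := by
    simp only [hA, symmetrized, Matrix.cons_val_one, Matrix.cons_val_fin_one]
    exact (hw _ _).continuousOn.mul hΨc
  have hV : ∀ s, 0 < s → ‖E₀ s‖ ≤ b * ε s ∧ ‖E₁ s‖ ≤ b * ε s ∧ ‖D s‖ ≤ b₂ * ε s := by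
    intro s hs
    obtain ⟨-, -, -, h0, h1, h2⟩ := hE s hs
    have n1 := norm_nonneg (N₁ s)
    have n2 := norm_nonneg (V₁ s)
    have n3 := norm_nonneg (Φ₁ s)
    have n4 := norm_nonneg (Φ₂ s)
    have p1 := Real.sqrt_nonneg (P.TPlus / P.mPlus)
    have p2 : 0 ≤ P.TPlus / P.mPlus := by positivity
    have p3 : 0 ≤ P.e / P.mPlus := by positivity
    refine ⟨h0.trans ?_, h1.trans ?_, h2.trans ?_⟩
    · exact mul_le_mul (by linarith) (by simp only [hε]; linarith) n2 hb0
    · calc _ ≤ (P.TPlus / P.mPlus + P.e / P.mPlus * 3) * ε s := by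
            simp only [hε]; nlinarith
        _ ≤ _ := by have := hε0 s; gcongr; linarith
    · have : |(k : ℝ)| * (P.TPlus / P.mPlus * ‖N₁ s‖ + P.e / P.mPlus * ‖Φ₁ s‖)
          ≤ |(k : ℝ)| * ((P.TPlus / P.mPlus + P.e / P.mPlus) * ε s) := by
        gcongr; simp only [hε]; nlinarith
      have h3 : ‖V₁ s‖ ≤ ε s := by simp only [hε]; linarith
      calc _ ≤ _ := add_le_add h3 this
        _ = _ := by ring
  set I : ℝ := ∫ s in (0 : ℝ)..T, ε s with hI
  have hI0 : 0 ≤ I := intervalIntegral.integral_nonneg hT fun s _ => hε0 s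
  -- `F` is conserved, up to the commutators
  have hFF : ∀ s ∈ Icc 0 T, ‖F s - F 0‖ ≤ b₂ * I := by
    intro s hs
    have := norm_sub_le_integral_of_hasDerivAt (f := F) (f' := D) (g := fun s => b₂ * ε s) hs.1
      (hFc.mono fun x hx => hx.1) (fun t ht => (hE t ht.1).2.2.1) (fun t ht => (hV t ht.1).2.2)
      (continuousOn_const.mul (hεc.mono fun x hx => hx.1))
    rw [intervalIntegral.integral_const_mul] at this
    refine this.trans ?_
    gcongr
    rw [hI, ← intervalIntegral.integral_add_adjacent_intervals (hεi 0 s le_rfl hs.1)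
      (hεi s T hs.1 hT)]
    have := intervalIntegral.integral_nonneg (μ := volume) hs.2 (fun s _ => hε0 s)
    linarith
  have hSM : Continuous fun s => (((solutionOperator P k ξ 0 s).mulVec (Mvector k ξ s) i : ℝ) : ℂ)
      := by
    simp only [mulVec_Mvector]
    exact Complex.continuous_ofReal.comp
      ((continuous_solutionOperator_zero_left P hk ξ i 1).mul (continuous_Mvector_one hk ξ))
  -- `J = S(0,s) A(s) - ∫₀ˢ S(0,σ) M₊(σ) dσ F(0)` is constant, up to the commutators
  set J : ℝ → ℂ := fun s => solutionOperator P k ξ 0 s i 0 * A s 0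
    + solutionOperator P k ξ 0 s i 1 * A s 1
    - (∫ s in (0 : ℝ)..s, (((solutionOperator P k ξ 0 s).mulVec (Mvector k ξ s) i : ℝ) : ℂ)) * F 0
    with hJ
  have hSc : ∀ j, Continuous fun s => (solutionOperator P k ξ 0 s i j : ℂ) := fun j =>
    Complex.continuous_ofReal.comp (continuous_solutionOperator_zero_left P hk ξ i j)
  have hint : ∀ s, HasDerivAt (fun s => ∫ s in (0 : ℝ)..s,
      (((solutionOperator P k ξ 0 s).mulVec (Mvector k ξ s) i : ℝ) : ℂ)) _ s := fun s =>
    (hSM.integral_hasStrictDerivAt 0 s).hasDerivAt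
  have hJc : ContinuousOn J (Ici 0) :=
    (((hSc 0).continuousOn.mul hA0).add ((hSc 1).continuousOn.mul hA1)).sub
      ((continuous_iff_continuousAt.2 fun s => (hint s).continuousAt).continuousOn.mul
        continuousOn_const)
  have key := norm_sub_le_integral_of_hasDerivAt (f := J)
    (f' := fun s => solutionOperator P k ξ 0 s i 0 * E₀ s + solutionOperator P k ξ 0 s i 1 * E₁ s
      + solutionOperator P k ξ 0 s i 1 * Mvector k ξ s 1 * (F s - F 0))
    (g := fun s => C * (2 * b) * ε s + C * (2 * k ^ 2 * (b₂ * I))) hT (hJc.mono hIcc)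
    (fun s hs => by
      obtain ⟨d0, d1, -⟩ := hE s hs.1
      have s0 := (hasDerivAt_solutionOperator_zero_left P hk ξ s i 0).ofReal_comp
      have s1 := (hasDerivAt_solutionOperator_zero_left P hk ξ s i 1).ofReal_comp
      refine (((s0.mul d0).add (s1.mul d1)).sub ((hint s).mul_const (F 0))).congr_deriv ?_
      rw [mulVec_Mvector]
      push_cast
      ring)
    (fun s hs => by
      obtain ⟨h0, h1, -⟩ := hV s hs.1
      have h2 := hFF s ⟨hs.1.le, hs.2.le⟩
      have hε := hε0 s
      refine (norm_add₃_le).trans ?_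
      simp only [norm_mul, Complex.norm_real, Real.norm_eq_abs]
      calc _ ≤ C * (b * ε s) + C * (b * ε s) + C * (2 * k ^ 2) * (b₂ * I) := by
            gcongr
            · exact hS k hk ξ s 0 i 0
            · exact hS k hk ξ s 0 i 1
            · exact hS k hk ξ s 0 i 1
            · exact abs_Mvector_one_le' hk ξ s
        _ = _ := by ring)
    ((continuousOn_const.mul (hεc.mono hIcc)).add continuousOn_const)
  rw [intervalIntegral.integral_add ((hεi 0 T le_rfl hT).const_mul _) intervalIntegrable_const,
    intervalIntegral.integral_const_mul, intervalIntegral.integral_const] at key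
  have hJ0 : J 0 = A 0 i := by
    simp only [hJ, intervalIntegral.integral_same, zero_mul, sub_zero]
    rw [((isSolutionOperator_solutionOperator P hk ξ) 0).1]
    have : ∀ i : Fin 2, (((1 : Matrix (Fin 2) (Fin 2) ℝ) i 0 : ℝ) : ℂ) * A 0 0
        + (((1 : Matrix (Fin 2) (Fin 2) ℝ) i 1 : ℝ) : ℂ) * A 0 1 = A 0 i := by
      simp [Fin.forall_fin_two]
    exact this i
  have hAT : ‖J T + (∫ s in (0 : ℝ)..T,
      (((solutionOperator P k ξ 0 s).mulVec (Mvector k ξ s) i : ℝ) : ℂ)) * F 0‖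
      ≤ C * ∑ j, ‖A T j‖ := by
    simp only [hJ, sub_add_cancel]
    refine (norm_add_le _ _).trans ?_
    simp only [norm_mul, Complex.norm_real, Real.norm_eq_abs, Fin.sum_univ_two, mul_add]
    gcongr
    · exact hS k hk ξ T 0 i 0
    · exact hS k hk ξ T 0 i 1
  have e1 : Complex.I * k * U 0 + Complex.I * ξ * V 0 = Ψ 0 := by simp [hΨ]
  have e2 : N 0 - Complex.I * ξ * U 0 + Complex.I * k * V 0 = F 0 := by simp [hF]
  rw [e1, e2]
  change ‖A 0 i + _‖ ≤ C * ∑ j, ‖A T j‖ + _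
  calc _ = ‖(J T + (∫ s in (0 : ℝ)..T,
      (((solutionOperator P k ξ 0 s).mulVec (Mvector k ξ s) i : ℝ) : ℂ)) * F 0) - (J T - J 0)‖ := by
        rw [hJ0]; congr 1; ring
    _ ≤ C * ∑ j, ‖A T j‖ + _ := (norm_sub_le _ _).trans (add_le_add hAT key)
    _ = _ := by simp only [sub_zero, smul_eq_mul]; ring

/-! ### Plancherel's theorem on the line -/

section Plancherel

open FourierTransform

/-- The Fourier integral `∫ e^{-iξy} h(y) dy` on the line. -/
def fourierLine (h : ℝ → ℂ) (ξ : ℝ) : ℂ :=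
  ∫ y : ℝ, Complex.exp (-(Complex.I * (ξ : ℂ) * (y : ℂ))) * h y

/-- Test functions on the line. -/
def IsTest (θ : ℝ → ℂ) : Prop := ContDiff ℝ (⊤ : ℕ∞) θ ∧ HasCompactSupport θ

lemma fourierLine_eq (h : ℝ → ℂ) (ξ : ℝ) : fourierLine h ξ = 𝓕 h (ξ / (2 * Real.pi)) := by
  rw [Real.fourier_eq', fourierLine]
  congr 1 with y
  rw [smul_eq_mul]
  congr 2
  have : (Real.pi : ℂ) ≠ 0 := by exact_mod_cast Real.pi_ne_zero
  simp only [RCLike.inner_apply, conj_trivial]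
  push_cast
  field_simp

lemma fourierLine_neg (h : ℝ → ℂ) (ξ : ℝ) :
    fourierLine h (-ξ) = ∫ y : ℝ, Complex.exp (Complex.I * (ξ : ℂ) * (y : ℂ)) * h y := by
  rw [fourierLine]
  congr 1 with y
  push_cast
  congr 2
  ring

lemma lintegral_comp_div (f : ℝ → ℝ≥0∞) {c : ℝ} (hc : 0 < c) :
    ∫⁻ ξ, f (ξ / c) = ENNReal.ofReal c * ∫⁻ ξ, f ξ := by
  have h := lintegral_map_equiv (μ := volume) f (Homeomorph.mulLeft₀ c⁻¹ (by positivity)).toMeasurableEquiv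
  have e : (⇑(Homeomorph.mulLeft₀ c⁻¹ (by positivity)).toMeasurableEquiv : ℝ → ℝ) = (c⁻¹ * ·) := rfl
  rw [e, Real.map_volume_mul_left (by positivity), inv_inv, abs_of_pos hc, lintegral_smul_measure]
    at h
  rw [← smul_eq_mul, h]
  simp only [div_eq_inv_mul]

lemma eLpNorm_two_sq {α E : Type*} [MeasurableSpace α] [NormedAddCommGroup E] {μ : Measure α}
    (f : α → E) : eLpNorm f 2 μ ^ 2 = ∫⁻ x, ‖f x‖ₑ ^ 2 ∂μ := by
  have := eLpNorm_nnreal_pow_eq_lintegral (f := f) (μ := μ) (p := 2) two_ne_zero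
  simpa using this

lemma eLpNorm_two_eq {α E : Type*} [MeasurableSpace α] [NormedAddCommGroup E] {μ : Measure α}
    (f : α → E) : eLpNorm f 2 μ = (∫⁻ x, ‖f x‖ₑ ^ 2 ∂μ) ^ (1 / 2 : ℝ) := by
  rw [← eLpNorm_two_sq, ← ENNReal.rpow_natCast, ← ENNReal.rpow_mul]
  norm_num

lemma integral_fourier_mul_eq {f g : ℝ → ℂ} (hf : Integrable f) (hg : Integrable g) :
    ∫ ξ, 𝓕 f ξ * g ξ = ∫ x, f x * 𝓕 g x := by
  have := VectorFourier.integral_fourierIntegral_smul_eq_flip (μ := volume) (ν := volume)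
    (L := innerₗ ℝ) (f := f) (g := g) Real.continuous_fourierChar continuous_inner hf hg
  simp only [flip_innerₗ, smul_eq_mul] at this
  exact this

/-- On `L¹ ∩ L²` the Plancherel extension is given by the Fourier integral. -/
lemma fourier_toLp_ae_eq {f : ℝ → ℂ} (hf : Integrable f) (hf2 : MemLp f 2) :
    (𝓕 (hf2.toLp f) : Lp ℂ 2 (volume : Measure ℝ)) =ᵐ[volume] 𝓕 f := by
  refine ae_eq_of_integral_contDiff_smul_eq
    ((Lp.memLp _).locallyIntegrable one_le_two)
    (Continuous.locallyIntegrable ?_) fun g hg hgc => ?_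
  · exact VectorFourier.fourierIntegral_continuous Real.continuous_fourierChar
      (L := innerₗ ℝ) continuous_inner hf
  · have hg' : ContDiff ℝ (⊤ : ℕ∞) fun x => (g x : ℂ) := Complex.ofRealCLM.contDiff.comp hg
    have hgc' : HasCompactSupport fun x => (g x : ℂ) := hgc.comp_left Complex.ofReal_zero
    set G := hgc'.toSchwartzMap hg' with hG
    have hGx : ∀ x, G x = g x := fun x => rfl
    have h := congrArg (fun T : TemperedDistribution ℝ ℂ => T G)
      (Lp.fourier_toTemperedDistribution_eq (hf2.toLp f))
    simp only [TemperedDistribution.fourier_apply, Lp.toTemperedDistribution_apply] at h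
    simp only [smul_eq_mul] at h
    have e1 : ∫ x, g x • (𝓕 (hf2.toLp f) : Lp ℂ 2 (volume : Measure ℝ)) x = ∫ x, G x * (𝓕 (hf2.toLp f) : Lp ℂ 2 (volume : Measure ℝ)) x := by
      simp only [hGx, Complex.real_smul]
    have e2 : ∫ x, g x • 𝓕 f x = ∫ x, 𝓕 f x * G x := by
      simp only [hGx, Complex.real_smul, mul_comm]
    rw [e1, e2, integral_fourier_mul_eq hf G.integrable, ← h]
    apply integral_congr_ae
    filter_upwards [hf2.coeFn_toLp] with x hx
    rw [hx, mul_comm, SchwartzMap.fourier_coe]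

/-- Square integrable functions have a Plancherel transform `G`: it is the `L²` limit of Fourier
integrals, and obeys the duality with test functions. -/
theorem exists_plancherel {h : ℝ → ℂ} (hh : MemLp h 2) :
    ∃ G : ℝ → ℂ, MemLp G 2 ∧
      (∀ f : ℝ → ℂ, Integrable f → MemLp f 2 →
        ∫⁻ ξ, ‖fourierLine f ξ - G ξ‖ₑ ^ 2 = ENNReal.ofReal (2 * Real.pi) * ∫⁻ y, ‖f y - h y‖ₑ ^ 2) ∧
      ∀ θ, IsTest θ →
        ∫ y, h y * θ y = ∫ ξ, (((2 * Real.pi)⁻¹ : ℝ) : ℂ) * G ξ * fourierLine θ (-ξ) := by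
  have hπ : 0 < 2 * Real.pi := by positivity
  set H : Lp ℂ 2 (volume : Measure ℝ) := hh.toLp h with hH
  set FH : Lp ℂ 2 (volume : Measure ℝ) := 𝓕 H with hFH
  refine ⟨fun ξ => FH (ξ / (2 * Real.pi)), ?_, ?_, ?_⟩
  · refine ⟨?_, ?_⟩
    · refine (Lp.aestronglyMeasurable FH).comp_quasiMeasurePreserving (f := fun x : ℝ => x / (2 * Real.pi)) ?_
      refine ⟨by fun_prop, ?_⟩
      have : (fun x : ℝ => x / (2 * Real.pi)) = ((2 * Real.pi)⁻¹ * ·) := by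
        ext x; rw [div_eq_inv_mul]
      rw [this, Real.map_volume_mul_left (by positivity)]
      exact Measure.smul_absolutelyContinuous
    · rw [eLpNorm_two_eq, lintegral_comp_div (fun ξ => ‖FH ξ‖ₑ ^ 2) hπ, ← eLpNorm_two_sq]
      refine ENNReal.rpow_lt_top_of_nonneg (by norm_num) (ENNReal.mul_ne_top ENNReal.ofReal_ne_top
        (ENNReal.pow_ne_top (Lp.memLp FH).2.ne))
  · intro f hf hf2
    simp only [fourierLine_eq]
    rw [lintegral_comp_div (fun ξ => ‖𝓕 f ξ - FH ξ‖ₑ ^ 2) hπ]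
    congr 1
    have e1 : ∫⁻ ξ, ‖𝓕 f ξ - FH ξ‖ₑ ^ 2 = ‖(𝓕 (hf2.toLp f) - FH : Lp ℂ 2 (volume : Measure ℝ))‖ₑ ^ 2 := by
      rw [Lp.enorm_def, eLpNorm_two_sq]
      apply lintegral_congr_ae
      filter_upwards [fourier_toLp_ae_eq hf hf2, Lp.coeFn_sub (𝓕 (hf2.toLp f)) FH] with x h1 h2
      rw [h2, Pi.sub_apply, h1]
    have e2 : ∫⁻ y, ‖f y - h y‖ₑ ^ 2 = ‖hf2.toLp f - H‖ₑ ^ 2 := by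
      rw [hH, ← MemLp.toLp_sub, Lp.enorm_toLp, eLpNorm_two_sq]
      rfl
    rw [e1, e2, hFH, ← (show 𝓕 (hf2.toLp f - H) = 𝓕 (hf2.toLp f) - 𝓕 H from
      (Lp.fourierTransformₗᵢ ℝ ℂ).map_sub (hf2.toLp f) H), ← ofReal_norm, ← ofReal_norm,
      Lp.norm_fourier_eq]
  · rintro θ ⟨hθ, hθc⟩
    set Θ := hθc.toSchwartzMap hθ with hΘ
    have hΘx : ∀ x, Θ x = θ x := fun x => rfl
    have h1 := congrArg (fun T : TemperedDistribution ℝ ℂ => T (𝓕⁻ Θ))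
      (Lp.fourier_toTemperedDistribution_eq H)
    simp only [TemperedDistribution.fourier_apply, Lp.toTemperedDistribution_apply,
      fourier_fourierInv_eq, smul_eq_mul] at h1
    have e1 : ∫ y, h y * θ y = ∫ x, Θ x * H x := by
      apply integral_congr_ae
      filter_upwards [hh.coeFn_toLp] with x hx
      rw [hx, hΘx, mul_comm]
    have e2 : ∀ ξ, fourierLine θ (-ξ) = (𝓕⁻ Θ) (ξ / (2 * Real.pi)) := by
      intro ξ
      rw [fourierLine_eq, SchwartzMap.fourierInv_coe, Real.fourierInv_eq_fourier_neg, neg_div]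
      rfl
    rw [e1, h1]
    simp only [e2, mul_assoc]
    have := Measure.integral_comp_div (fun ξ => FH ξ * (𝓕⁻ Θ) ξ) (2 * Real.pi)
    rw [integral_const_mul, this, abs_of_pos hπ, Complex.real_smul, ← mul_assoc, ← Complex.ofReal_mul,
      inv_mul_cancel₀ hπ.ne', Complex.ofReal_one, one_mul]
    simp only [mul_comm]
    rfl

end Plancherel

/-! ### Test functions and functions of polynomial growth -/

section Tempered

open FourierTransform

lemma IsTest.integrable {θ : ℝ → ℂ} (hθ : IsTest θ) : Integrable θ :=
  hθ.1.continuous.integrable_of_hasCompactSupport hθ.2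

lemma continuous_fourierLine {f : ℝ → ℂ} (hf : Integrable f) : Continuous (fourierLine f) := by
  have h : Continuous (𝓕 f) := VectorFourier.fourierIntegral_continuous Real.continuous_fourierChar
    (L := innerₗ ℝ) continuous_inner hf
  have : fourierLine f = fun ξ => 𝓕 f (ξ / (2 * Real.pi)) := funext (fourierLine_eq f)
  rw [this]
  exact h.comp (by fun_prop)

/-- An integrable function that annihilates the Fourier integrals of test functions vanishes. -/
lemma ae_eq_zero_of_integral_mul_fourierLine {u : ℝ → ℂ} (hu : Integrable u)
    (h : ∀ θ, IsTest θ → ∫ ξ, u ξ * fourierLine θ (-ξ) = 0) : u =ᵐ[volume] 0 := by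
  have hπ : 0 < 2 * Real.pi := by positivity
  set v : ℝ → ℂ := fun η => u (2 * Real.pi * η) with hv
  have hvi : Integrable v := hu.comp_mul_left' hπ.ne'
  have hvc : Continuous (𝓕 v) := VectorFourier.fourierIntegral_continuous
    Real.continuous_fourierChar (L := innerₗ ℝ) continuous_inner hvi
  have h1 : ∀ θ, IsTest θ → ∫ η, 𝓕 v η * θ η = 0 := by
    intro θ hθ
    have hneg : IsTest fun y => θ (-y) :=
      ⟨hθ.1.comp contDiff_neg, hθ.2.comp_homeomorph (Homeomorph.neg ℝ)⟩
    have h2 := h _ hneg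
    have e : ∀ ξ, u ξ * fourierLine (fun y => θ (-y)) (-ξ)
        = (fun η => v η * 𝓕 θ η) (ξ / (2 * Real.pi)) := by
      intro ξ
      simp only [hv]
      rw [mul_div_cancel₀ _ hπ.ne', fourierLine_eq, neg_div, ← Real.fourierInv_eq_fourier_neg,
        Real.fourierInv_eq_fourier_comp_neg]
      simp only [neg_neg]
    simp only [e] at h2
    rw [Measure.integral_comp_div (fun η => v η * 𝓕 θ η) (2 * Real.pi), abs_of_pos hπ] at h2
    rw [integral_fourier_mul_eq hvi hθ.integrable]
    exact (smul_eq_zero.1 h2).resolve_left hπ.ne'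
  have hreal : ∀ g : ℝ → ℝ, ContDiff ℝ (⊤ : ℕ∞) g → HasCompactSupport g →
      IsTest fun x => (g x : ℂ) := fun g hg hgc =>
    ⟨Complex.ofRealCLM.contDiff.comp hg, hgc.comp_left Complex.ofReal_zero⟩
  have hF : 𝓕 v =ᵐ[volume] 0 :=
    ae_eq_zero_of_integral_contDiff_smul_eq_zero hvc.locallyIntegrable fun g hg hgc => by
      simpa only [Complex.real_smul, mul_comm] using h1 _ (hreal g hg hgc)
  have hv0 : v =ᵐ[volume] 0 :=
    ae_eq_zero_of_integral_contDiff_smul_eq_zero hvi.locallyIntegrable fun g hg hgc => by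
      have hT := hreal g hg hgc
      set G := hT.2.toSchwartzMap hT.1
      have e : ∀ x, g x • v x = v x * 𝓕 (⇑(𝓕⁻ G : SchwartzMap ℝ ℂ)) x := by
        intro x
        rw [← SchwartzMap.fourier_coe, fourier_fourierInv_eq, Complex.real_smul, mul_comm]
        rfl
      simp only [e]
      rw [← integral_fourier_mul_eq hvi (𝓕⁻ G : SchwartzMap ℝ ℂ).integrable]
      rw [integral_congr_ae (g := fun _ => (0 : ℂ)), integral_zero]
      filter_upwards [hF] with x hx
      rw [hx, Pi.zero_apply, zero_mul]
  have hq : Measure.QuasiMeasurePreserving (fun ξ : ℝ => (2 * Real.pi)⁻¹ * ξ) := by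
    refine ⟨by fun_prop, ?_⟩
    rw [Real.map_volume_mul_left (by positivity)]
    exact Measure.smul_absolutelyContinuous
  filter_upwards [hq.ae hv0] with ξ hξ
  simp only [hv, mul_inv_cancel_left₀ hπ.ne'] at hξ
  exact hξ

lemma IsTest.deriv {θ : ℝ → ℂ} (hθ : IsTest θ) : IsTest (deriv θ) :=
  ⟨(contDiff_infty_iff_deriv.1 hθ.1).2, hθ.2.deriv⟩

lemma IsTest.sub {θ ϑ : ℝ → ℂ} (hθ : IsTest θ) (hϑ : IsTest ϑ) : IsTest (θ - ϑ) :=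
  ⟨hθ.1.sub hϑ.1, hθ.2.sub hϑ.2⟩

lemma IsTest.const_mul {θ : ℝ → ℂ} (hθ : IsTest θ) (c : ℂ) : IsTest fun y => c * θ y :=
  ⟨contDiff_const.mul hθ.1, hθ.2.mul_left⟩

lemma fourierLine_sub {f g : ℝ → ℂ} (hf : Integrable f) (hg : Integrable g) (ξ : ℝ) :
    fourierLine (f - g) ξ = fourierLine f ξ - fourierLine g ξ := by
  have hb : ∀ {f : ℝ → ℂ}, Integrable f →
      Integrable fun y : ℝ => Complex.exp (-(Complex.I * (ξ : ℂ) * (y : ℂ))) * f y := by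
    intro f hf
    refine hf.bdd_mul (c := 1) (by fun_prop) (.of_forall fun y => ?_)
    rw [Complex.norm_exp]; simp
  simp only [fourierLine, Pi.sub_apply, mul_sub]
  exact integral_sub (hb hf) (hb hg)

lemma IsTest.fourierLine_deriv {θ : ℝ → ℂ} (hθ : IsTest θ) (ξ : ℝ) :
    fourierLine (_root_.deriv θ) (-ξ) = -(Complex.I * ξ * fourierLine θ (-ξ)) := by
  rw [fourierLine_eq, fourierLine_eq, Real.fourier_deriv hθ.integrable
    (hθ.1.differentiable (by simp)) hθ.deriv.integrable]
  simp only [smul_eq_mul]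
  have : (Real.pi : ℂ) ≠ 0 := by exact_mod_cast Real.pi_ne_zero
  push_cast
  field_simp

/-- The Fourier integral of a test function decays faster than any power, in the sense of `L²`:
`1 + ξ²` is the symbol of `1 - ∂²`. -/
lemma IsTest.weighted_memLp {θ : ℝ → ℂ} (hθ : IsTest θ) (N : ℕ) :
    MemLp (fun ξ => (((1 + ξ ^ 2) ^ N : ℝ) : ℂ) * fourierLine θ (-ξ)) 2 := by
  induction N generalizing θ with
  | zero =>
    have hθ2 : MemLp θ 2 := hθ.1.continuous.memLp_of_hasCompactSupport hθ.2
    obtain ⟨G, hG, h, -⟩ := exists_plancherel hθ2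
    have h0 := h θ hθ.integrable hθ2
    simp only [sub_self, enorm_zero] at h0
    simp only [ne_eq, OfNat.ofNat_ne_zero, not_false_eq_true, zero_pow, lintegral_const, zero_mul,
      mul_zero] at h0
    have hm : AEMeasurable (fun ξ => ‖fourierLine θ ξ - G ξ‖ₑ ^ 2) volume :=
      (((continuous_fourierLine hθ.integrable).aestronglyMeasurable.sub
        hG.aestronglyMeasurable).enorm.pow_const 2)
    rw [lintegral_eq_zero_iff' hm] at h0
    have h1 : MemLp (fourierLine θ) 2 := hG.ae_eq (by
      filter_upwards [h0] with ξ hξ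
      have : fourierLine θ ξ - G ξ = 0 := by simpa using hξ
      exact (sub_eq_zero.1 this).symm)
    simpa [Function.comp_def] using
      h1.comp_measurePreserving (Measure.measurePreserving_neg volume)
  | succ N ih =>
    have h := ih (hθ.sub hθ.deriv.deriv)
    refine h.ae_eq (.of_forall fun ξ => ?_)
    simp only
    rw [fourierLine_sub hθ.integrable hθ.deriv.deriv.integrable, hθ.deriv.fourierLine_deriv,
      hθ.fourierLine_deriv]
    push_cast
    linear_combination (-(1 + (ξ : ℂ) ^ 2) ^ N * ξ ^ 2 * fourierLine θ (-ξ)) * Complex.I_sq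

/-- Functions of polynomial growth in the sense of `L²`. -/
def IsTempered (u : ℝ → ℂ) : Prop :=
  ∃ N : ℕ, MemLp (fun ξ : ℝ => ((((1 + ξ ^ 2) ^ N)⁻¹ : ℝ) : ℂ) * u ξ) 2 volume

lemma IsTempered.integrable_mul_fourierLine {u : ℝ → ℂ} (hu : IsTempered u) {θ : ℝ → ℂ}
    (hθ : IsTest θ) : Integrable fun ξ => u ξ * fourierLine θ (-ξ) := by
  obtain ⟨N, hu⟩ := hu
  refine (hu.integrable_mul (hθ.weighted_memLp N)).congr (.of_forall fun ξ => ?_)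
  have hpos : 0 < (1 + ξ ^ 2) ^ N := by positivity
  have : (((1 + ξ ^ 2) ^ N : ℝ) : ℂ) ≠ 0 := by exact_mod_cast hpos.ne'
  simp only [Pi.mul_apply, Complex.ofReal_inv]
  field_simp

lemma IsTempered.aestronglyMeasurable {u : ℝ → ℂ} (hu : IsTempered u) :
    AEStronglyMeasurable u volume := by
  obtain ⟨N, hu⟩ := hu
  have hc : Continuous fun ξ : ℝ => (((1 + ξ ^ 2) ^ N : ℝ) : ℂ) := by fun_prop
  refine (hc.aestronglyMeasurable.mul hu.aestronglyMeasurable).congr (.of_forall fun ξ => ?_)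
  have hpos : 0 < (1 + ξ ^ 2) ^ N := by positivity
  have : (((1 + ξ ^ 2) ^ N : ℝ) : ℂ) ≠ 0 := by exact_mod_cast hpos.ne'
  simp only [Pi.mul_apply, Complex.ofReal_inv]
  field_simp

/-- Multiplication by a function of polynomial growth. -/
lemma IsTempered.mul_of_le {u w : ℝ → ℂ} (hu : IsTempered u) (hw : Continuous w) (M : ℕ)
    (h : ∀ ξ, ‖w ξ‖ ≤ (1 + ξ ^ 2) ^ M) : IsTempered fun ξ => w ξ * u ξ := by
  have hm := hu.aestronglyMeasurable
  obtain ⟨N, hu⟩ := hu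
  refine ⟨N + M, hu.of_le ?_ (.of_forall fun ξ => ?_)⟩
  · refine AEStronglyMeasurable.mul ?_ (hw.aestronglyMeasurable.mul hm)
    refine Continuous.aestronglyMeasurable (Complex.continuous_ofReal.comp
      (Continuous.inv₀ (by fun_prop) fun ξ => ?_))
    positivity
  · have hpos : 0 < (1 + ξ ^ 2) ^ M := by positivity
    simp only [norm_mul, Complex.norm_real, norm_inv, Real.norm_eq_abs, pow_add, mul_inv,
      abs_of_pos hpos]
    calc _ = |(1 + ξ ^ 2) ^ N|⁻¹ * (((1 + ξ ^ 2) ^ M)⁻¹ * ‖w ξ‖) * ‖u ξ‖ := by ring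
      _ ≤ |(1 + ξ ^ 2) ^ N|⁻¹ * 1 * ‖u ξ‖ := by
        gcongr
        rw [inv_mul_le_one₀ hpos]
        exact h ξ
      _ = _ := by ring

lemma IsTempered.sub {u v : ℝ → ℂ} (hu : IsTempered u) (hv : IsTempered v) :
    IsTempered fun ξ => u ξ - v ξ := by
  have lift : ∀ {u : ℝ → ℂ} {N : ℕ} (M : ℕ),
      MemLp (fun ξ : ℝ => ((((1 + ξ ^ 2) ^ N)⁻¹ : ℝ) : ℂ) * u ξ) 2 volume →
      MemLp (fun ξ : ℝ => ((((1 + ξ ^ 2) ^ (N + M))⁻¹ : ℝ) : ℂ) * u ξ) 2 volume := by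
    intro u N M hu
    have hc : Continuous fun ξ : ℝ => ((((1 + ξ ^ 2) ^ M)⁻¹ : ℝ) : ℂ) :=
      Complex.continuous_ofReal.comp (Continuous.inv₀ (by fun_prop) fun ξ => by positivity)
    have e : (fun ξ : ℝ => ((((1 + ξ ^ 2) ^ (N + M))⁻¹ : ℝ) : ℂ) * u ξ) = fun ξ : ℝ =>
        ((((1 + ξ ^ 2) ^ M)⁻¹ : ℝ) : ℂ) * (((((1 + ξ ^ 2) ^ N)⁻¹ : ℝ) : ℂ) * u ξ) := by
      ext ξ
      rw [pow_add, mul_inv]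
      push_cast
      ring
    rw [e]
    refine hu.of_le (hc.aestronglyMeasurable.mul hu.aestronglyMeasurable) (.of_forall fun ξ => ?_)
    rw [norm_mul _ (_ * u ξ)]
    refine mul_le_of_le_one_left (norm_nonneg _) ?_
    have hpos : 0 < (1 + ξ ^ 2) ^ M := by positivity
    rw [Complex.norm_real, norm_inv, Real.norm_of_nonneg hpos.le]
    exact inv_le_one_of_one_le₀ (one_le_pow₀ (by nlinarith [sq_nonneg ξ]))
  obtain ⟨N, hu⟩ := hu
  obtain ⟨M, hv⟩ := hv
  refine ⟨N + M, ?_⟩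
  have h1 := lift M hu
  have h2 := lift N hv
  rw [add_comm M N] at h2
  refine (h1.sub h2).ae_eq (.of_forall fun ξ => ?_)
  simp only [Pi.sub_apply]
  ring

lemma IsTempered.const_mul {u : ℝ → ℂ} (hu : IsTempered u) (c : ℂ) :
    IsTempered fun ξ => c * u ξ := by
  obtain ⟨N, hu⟩ := hu
  refine ⟨N, (hu.const_mul c).ae_eq (.of_forall fun ξ => ?_)⟩
  ring

lemma IsTempered.add {u v : ℝ → ℂ} (hu : IsTempered u) (hv : IsTempered v) :
    IsTempered fun ξ => u ξ + v ξ := by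
  have := hu.sub (hv.const_mul (-1))
  simpa using this

lemma IsTempered.mul_freq {u : ℝ → ℂ} (hu : IsTempered u) :
    IsTempered fun ξ => Complex.I * ξ * u ξ := by
  refine hu.mul_of_le (w := fun ξ => Complex.I * ξ) (by fun_prop) 1 fun ξ => ?_
  rw [norm_mul, Complex.norm_I, one_mul, Complex.norm_real, Real.norm_eq_abs, pow_one, abs_le]
  constructor <;> nlinarith [sq_nonneg (ξ - 1), sq_nonneg (ξ + 1)]

lemma isTempered_of_memLp {u : ℝ → ℂ} (hu : MemLp u 2) : IsTempered u := ⟨0, by simpa using hu⟩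

lemma IsTempered.congr {u v : ℝ → ℂ} (hu : IsTempered u) (h : u =ᵐ[volume] v) :
    IsTempered v := by
  obtain ⟨N, hu⟩ := hu
  refine ⟨N, hu.ae_eq ?_⟩
  filter_upwards [h] with ξ hξ
  rw [hξ]

/-- A function of polynomial growth in `L²` that annihilates the Fourier integrals of test
functions vanishes. Multiplication by the transform of a test function `ρ` makes it integrable,
and the hypothesis is inherited because convolution with `ρ` preserves test functions. -/
theorem IsTempered.ae_eq_zero {u : ℝ → ℂ} (hu : IsTempered u)
    (h : ∀ θ, IsTest θ → ∫ ξ, u ξ * fourierLine θ (-ξ) = 0) : u =ᵐ[volume] 0 := by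
  have hint : ∀ ρ, IsTest ρ → Integrable (fun ξ => u ξ * fourierLine ρ (-ξ)) := fun ρ hρ =>
    hu.integrable_mul_fourierLine hρ
  have hprod : ∀ ρ, IsTest ρ → (fun ξ => u ξ * fourierLine ρ (-ξ)) =ᵐ[volume] 0 := by
    intro ρ hρ
    refine ae_eq_zero_of_integral_mul_fourierLine (hint ρ hρ) fun θ hθ => ?_
    have hconv : IsTest (convolution ρ θ (ContinuousLinearMap.mul ℝ ℂ) volume) :=
      ⟨hθ.2.contDiff_convolution_right _ hρ.integrable.locallyIntegrable hθ.1,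
        hρ.2.convolution _ hθ.2⟩
    rw [← h _ hconv]
    congr 1 with ξ
    have e := Real.fourier_mul_convolution_eq hρ.integrable hθ.integrable (-ξ / (2 * Real.pi))
    simp only [fourierLine_eq]
    rw [mul_assoc, ← e]
    rfl
  change volume {ξ | u ξ ≠ 0} = 0
  refine measure_null_of_locally_null _ fun ξ₀ _ => ?_
  -- a test function whose transform does not vanish near `ξ₀`
  let b : ContDiffBump (0 : ℝ) := ⟨1, 2, one_pos, one_lt_two⟩
  let ρ : ℝ → ℂ := fun y => Complex.exp (-(Complex.I * ξ₀ * y)) * (b y : ℂ)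
  have hρ : IsTest ρ := by
    refine ⟨?_, ?_⟩
    · refine ContDiff.mul ?_ (Complex.ofRealCLM.contDiff.comp b.contDiff)
      exact ((contDiff_const.mul Complex.ofRealCLM.contDiff).neg).cexp
    · exact (b.hasCompactSupport.comp_left Complex.ofReal_zero).mul_left
  have h0 : fourierLine ρ (-ξ₀) ≠ 0 := by
    rw [fourierLine_neg]
    have : ∀ y : ℝ, Complex.exp (Complex.I * ξ₀ * y) * ρ y = ((b y : ℝ) : ℂ) := fun y => by
      simp only [ρ]
      rw [← mul_assoc, ← Complex.exp_add, add_neg_cancel, Complex.exp_zero, one_mul]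
    simp only [this]
    rw [integral_complex_ofReal]
    exact_mod_cast b.integral_pos.ne'
  have hc : Continuous fun ξ => fourierLine ρ (-ξ) :=
    (continuous_fourierLine hρ.integrable).comp continuous_neg
  have hU : {ξ | fourierLine ρ (-ξ) ≠ 0} ∈ nhds ξ₀ := hc.continuousAt.eventually_ne h0
  refine ⟨{ξ | u ξ ≠ 0} ∩ {ξ | fourierLine ρ (-ξ) ≠ 0}, ?_, ?_⟩
  · exact Filter.inter_mem self_mem_nhdsWithin (mem_nhdsWithin_of_mem_nhds hU)
  · refine measure_mono_null ?_ (hprod ρ hρ)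
    rintro ξ ⟨h1, h2⟩
    exact mul_ne_zero h1 h2

theorem IsTempered.ae_eq {u v : ℝ → ℂ} (hu : IsTempered u) (hv : IsTempered v)
    (h : ∀ θ, IsTest θ → ∫ ξ, u ξ * fourierLine θ (-ξ) = ∫ ξ, v ξ * fourierLine θ (-ξ)) :
    u =ᵐ[volume] v := by
  have := (hu.sub hv).ae_eq_zero fun θ hθ => by
    simp only [sub_mul]
    rw [integral_sub (hu.integrable_mul_fourierLine hθ) (hv.integrable_mul_fourierLine hθ),
      h θ hθ, sub_self]
  filter_upwards [this] with ξ hξ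
  exact sub_eq_zero.1 hξ

end Tempered

/-! ### Fourier transforms on the cylinder -/

/-- The Fourier mode `∫₀^{2π} e^{-ikx} f(x,y) dx`. -/
def mode (k : ℤ) (f : ℝ → ℝ → ℝ) (y : ℝ) : ℂ :=
  ∫ x in (0 : ℝ)..(2 * Real.pi),
    Complex.exp (-(Complex.I * (k : ℂ) * (x : ℂ))) * (f x y : ℂ)

lemma enorm_ofReal (r : ℝ) : ‖(r : ℂ)‖ₑ = ‖r‖ₑ := by
  rw [← ofReal_norm, ← ofReal_norm, Complex.norm_real]

lemma eLpNorm_two_lt_top_iff {α E : Type*} [MeasurableSpace α] [NormedAddCommGroup E]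
    {μ : Measure α} {f : α → E} : eLpNorm f 2 μ < ∞ ↔ ∫⁻ x, ‖f x‖ₑ ^ 2 ∂μ < ∞ := by
  rw [← eLpNorm_two_sq, ENNReal.pow_lt_top_iff]
  simp

/-- Square integrability on the cylinder. -/
def IsL2 (f : ℝ → ℝ → ℝ) : Prop := MemLp (fun p : ℝ × ℝ => f p.1 p.2) 2 cylMeasure

lemma HasFourierTransform.pairing' {f : ℝ → ℝ → ℝ} {g : ℤ → ℝ → ℂ} (h : HasFourierTransform f g)
    (k : ℤ) {θ : ℝ → ℂ} (hθ : IsTest θ) :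
    ∫ y, mode k f y * θ y = ∫ ξ, g k ξ * fourierLine θ (-ξ) := by
  simp only [fourierLine_neg]
  exact h.pairing k θ hθ.1 hθ.2

/-- Fourier transforms are unique up to null sets. -/
lemma HasFourierTransform.ae_eq {f : ℝ → ℝ → ℝ} {g g' : ℤ → ℝ → ℂ} (h : HasFourierTransform f g)
    (h' : HasFourierTransform f g') (k : ℤ) : g k =ᵐ[volume] g' k :=
  IsTempered.ae_eq (h.tempered k) (h'.tempered k) fun θ hθ => by
    rw [← h.pairing' k hθ, h'.pairing' k hθ]

lemma hasFourierTransform_fourierTransform {f : ℝ → ℝ → ℝ} {g : ℤ → ℝ → ℂ}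
    (h : HasFourierTransform f g) : HasFourierTransform f (fourierTransform f) :=
  Classical.epsilon_spec ⟨g, h⟩

lemma fourierTransform_ae_eq {f : ℝ → ℝ → ℝ} {g : ℤ → ℝ → ℂ}
    (h : HasFourierTransform f g) (k : ℤ) : fourierTransform f k =ᵐ[volume] g k :=
  (hasFourierTransform_fourierTransform h).ae_eq h k

/-- Bessel's inequality in `x`. -/
lemma tsum_enorm_mode_sq_le {f : ℝ → ℝ → ℝ} {y : ℝ}
    (hf : MemLp (fun x => f x y) 2 (volume.restrict (Ioc 0 (2 * Real.pi)))) :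
    ∑' k : ℤ, ‖mode k f y‖ₑ ^ 2
      ≤ ENNReal.ofReal (2 * Real.pi) * ∫⁻ x in Ioc 0 (2 * Real.pi), ‖f x y‖ₑ ^ 2 := by
  have hπ : 0 < 2 * Real.pi := by positivity
  have hfc : MemLp (fun x => (f x y : ℂ)) 2 (volume.restrict (Ioc 0 (2 * Real.pi))) := hf.ofReal
  have h := hasSum_sq_fourierCoeffOn hπ hfc
  have e : ∀ k, ‖mode k f y‖ ^ 2
      = (2 * Real.pi) ^ 2 * ‖fourierCoeffOn hπ (fun x => (f x y : ℂ)) k‖ ^ 2 := by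
    intro k
    have : fourierCoeffOn hπ (fun x => (f x y : ℂ)) k = ((2 * Real.pi)⁻¹ : ℝ) • mode k f y := by
      rw [fourierCoeffOn_eq_integral, mode, sub_zero, one_div]
      congr 1
      apply intervalIntegral.integral_congr
      intro x _
      simp only [smul_eq_mul]
      congr 1
      rw [fourier_coe_apply]
      congr 1
      have : (Real.pi : ℂ) ≠ 0 := by exact_mod_cast Real.pi_ne_zero
      push_cast
      field_simp
    rw [this, norm_smul, mul_pow, Real.norm_of_nonneg (by positivity)]
    field_simp
  have hs : HasSum (fun k => ‖mode k f y‖ ^ 2)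
      ((2 * Real.pi) * ∫ x in Ioc 0 (2 * Real.pi), ‖(f x y : ℂ)‖ ^ 2) := by
    have h2 := h.mul_left ((2 * Real.pi) ^ 2)
    simp only [← e] at h2
    rw [intervalIntegral.integral_of_le hπ.le, sub_zero, smul_eq_mul, ← mul_assoc] at h2
    rwa [show (2 * Real.pi) ^ 2 * (2 * Real.pi)⁻¹ = 2 * Real.pi by field_simp] at h2
  have hi : ENNReal.ofReal (∫ x in Ioc 0 (2 * Real.pi), ‖(f x y : ℂ)‖ ^ 2)
      = ∫⁻ x in Ioc 0 (2 * Real.pi), ‖f x y‖ₑ ^ 2 := by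
    rw [ofReal_integral_eq_lintegral_ofReal (hfc.integrable_norm_pow two_ne_zero)
      (.of_forall fun x => by positivity)]
    congr 1 with x
    rw [ENNReal.ofReal_pow (norm_nonneg _), ofReal_norm, enorm_ofReal]
  have e2 : ∀ k, ‖mode k f y‖ₑ ^ 2 = ENNReal.ofReal (‖mode k f y‖ ^ 2) := fun k => by
    rw [ENNReal.ofReal_pow (norm_nonneg _), ofReal_norm]
  simp only [e2]
  rw [← ENNReal.ofReal_tsum_of_nonneg (fun k => by positivity) hs.summable, hs.tsum_eq,
    ENNReal.ofReal_mul hπ.le, hi]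

lemma IsL2.ae_slice {f : ℝ → ℝ → ℝ} (hf : IsL2 f) :
    ∀ᵐ y : ℝ, MemLp (fun x => f x y) 2 (volume.restrict (Ioc 0 (2 * Real.pi))) := by
  have hm : AEStronglyMeasurable (fun p : ℝ × ℝ => f p.2 p.1)
      ((volume : Measure ℝ).prod (volume.restrict (Ioc 0 (2 * Real.pi)))) :=
    hf.aestronglyMeasurable.prod_swap
  have hfin : ∫⁻ p : ℝ × ℝ, ‖f p.2 p.1‖ₑ ^ 2
      ∂((volume : Measure ℝ).prod (volume.restrict (Ioc 0 (2 * Real.pi)))) < ∞ := by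
    have := eLpNorm_two_lt_top_iff.1 hf.2
    rw [cylMeasure, ← lintegral_prod_swap] at this
    exact this
  rw [lintegral_prod _ (hm.enorm.pow_const 2)] at hfin
  have h1 := ae_lt_top' ((hm.enorm.pow_const 2).lintegral_prod_right') hfin.ne
  filter_upwards [h1, hm.prodMk_left] with y hy hmy
  exact ⟨hmy, eLpNorm_two_lt_top_iff.2 hy⟩

lemma L2norm_sq {E : Type*} [NormedAddCommGroup E] {f : ℝ → ℝ → E}
    (hf : AEStronglyMeasurable (fun p : ℝ × ℝ => f p.1 p.2) cylMeasure) :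
    L2norm f ^ 2 = ∫⁻ y, ∫⁻ x in Ioc 0 (2 * Real.pi), ‖f x y‖ₑ ^ 2 := by
  rw [L2norm, eLpNorm_two_sq, cylMeasure, lintegral_prod_symm _ (hf.enorm.pow_const 2)]

lemma IsL2.aestronglyMeasurable_mode {f : ℝ → ℝ → ℝ} (hf : IsL2 f) (k : ℤ) :
    AEStronglyMeasurable (mode k f) volume := by
  have hm : AEStronglyMeasurable (fun p : ℝ × ℝ => f p.2 p.1)
      ((volume : Measure ℝ).prod (volume.restrict (Ioc 0 (2 * Real.pi)))) :=
    hf.aestronglyMeasurable.prod_swap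
  have hc : Continuous fun p : ℝ × ℝ => Complex.exp (-(Complex.I * (k : ℂ) * (p.2 : ℂ))) := by
    fun_prop
  have := (hc.aestronglyMeasurable.mul
    (Complex.continuous_ofReal.comp_aestronglyMeasurable hm)).integral_prod_right'
  refine this.congr (.of_forall fun y => ?_)
  rw [mode, intervalIntegral.integral_of_le (by positivity)]
  rfl

/-- Bessel's inequality on the cylinder. -/
lemma IsL2.tsum_lintegral_mode_le {f : ℝ → ℝ → ℝ} (hf : IsL2 f) :
    ∑' k : ℤ, ∫⁻ y, ‖mode k f y‖ₑ ^ 2 ≤ ENNReal.ofReal (2 * Real.pi) * L2norm f ^ 2 := by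
  rw [← lintegral_tsum fun k => ((hf.aestronglyMeasurable_mode k).enorm.pow_const 2),
    L2norm_sq hf.aestronglyMeasurable, ← lintegral_const_mul' _ _ ENNReal.ofReal_ne_top]
  apply lintegral_mono_ae
  filter_upwards [hf.ae_slice] with y hy
  exact tsum_enorm_mode_sq_le hy

lemma IsL2.memLp_mode {f : ℝ → ℝ → ℝ} (hf : IsL2 f) (k : ℤ) : MemLp (mode k f) 2 := by
  refine ⟨hf.aestronglyMeasurable_mode k, ?_⟩
  rw [eLpNorm_two_lt_top_iff]
  refine lt_of_le_of_lt ((ENNReal.le_tsum k).trans hf.tsum_lintegral_mode_le) ?_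
  exact ENNReal.mul_lt_top ENNReal.ofReal_lt_top (ENNReal.pow_lt_top hf.2)

lemma IsL2.integrableOn {f : ℝ → ℝ → ℝ} (hf : IsL2 f) (R : ℝ) :
    IntegrableOn (fun p : ℝ × ℝ => f p.1 p.2) (univ ×ˢ Icc (-R) R) cylMeasure := by
  have hfin : cylMeasure (univ ×ˢ Icc (-R) R) < ∞ := by
    rw [cylMeasure, Measure.prod_prod]
    exact ENNReal.mul_lt_top (by rw [Measure.restrict_apply_univ]; exact measure_Ioc_lt_top)
      measure_Icc_lt_top
  have : IsFiniteMeasure (cylMeasure.restrict (univ ×ˢ Icc (-R) R)) := ⟨by simpa using hfin⟩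
  exact (hf.restrict _).integrable one_le_two

/-- Fourier transforms of square integrable functions: existence, and the approximation by Fourier
integrals. -/
theorem IsL2.exists_hasFourierTransform {f : ℝ → ℝ → ℝ} (hf : IsL2 f) :
    ∃ g, HasFourierTransform f g ∧ ∀ k, MemLp (g k) 2 ∧
      ∀ φ : ℝ → ℂ, Integrable φ → MemLp φ 2 →
        ∫⁻ ξ, ‖(((2 * Real.pi)⁻¹ : ℝ) : ℂ) * fourierLine φ ξ - g k ξ‖ₑ ^ 2
          = ENNReal.ofReal (2 * Real.pi)⁻¹ * ∫⁻ y, ‖φ y - mode k f y‖ₑ ^ 2 := by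
  have hπ : 0 < 2 * Real.pi := by positivity
  choose G hG hP hD using fun k => exists_plancherel (hf.memLp_mode k)
  refine ⟨fun k ξ => (((2 * Real.pi)⁻¹ : ℝ) : ℂ) * G k ξ, ⟨hf.integrableOn, fun k => ?_,
    fun k θ hθ hθc => ?_⟩, fun k => ⟨(hG k).const_mul _, fun φ hφ hφ2 => ?_⟩⟩
  · exact isTempered_of_memLp ((hG k).const_mul _)
  · have := hD k θ ⟨hθ, hθc⟩
    simp only [fourierLine_neg] at this
    exact this
  · have := hP k φ hφ hφ2
    simp only [← mul_sub, enorm_mul, mul_pow]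
    rw [lintegral_const_mul' _ _ (by finiteness), this, ← mul_assoc]
    congr 1
    rw [enorm_ofReal, Real.enorm_of_nonneg (by positivity), ← ENNReal.ofReal_pow (by positivity),
      ← ENNReal.ofReal_mul (by positivity)]
    congr 1
    field_simp

theorem IsL2.hasFourierTransform {f : ℝ → ℝ → ℝ} (hf : IsL2 f) :
    HasFourierTransform f (fourierTransform f) := by
  obtain ⟨g, hg, -⟩ := hf.exists_hasFourierTransform
  exact hasFourierTransform_fourierTransform hg

theorem IsL2.lintegral_fourierLine_sub {f : ℝ → ℝ → ℝ} (hf : IsL2 f) (k : ℤ) {φ : ℝ → ℂ}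
    (hφ : Integrable φ) (hφ2 : MemLp φ 2) :
    ∫⁻ ξ, ‖(((2 * Real.pi)⁻¹ : ℝ) : ℂ) * fourierLine φ ξ - fourierTransform f k ξ‖ₑ ^ 2
      = ENNReal.ofReal (2 * Real.pi)⁻¹ * ∫⁻ y, ‖φ y - mode k f y‖ₑ ^ 2 := by
  obtain ⟨g, hg, h⟩ := hf.exists_hasFourierTransform
  rw [← (h k).2 φ hφ hφ2]
  apply lintegral_congr_ae
  filter_upwards [fourierTransform_ae_eq hg k] with ξ hξ
  rw [hξ]

theorem IsL2.memLp_fourierTransform {f : ℝ → ℝ → ℝ} (hf : IsL2 f) (k : ℤ) :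
    MemLp (fourierTransform f k) 2 := by
  obtain ⟨g, hg, h⟩ := hf.exists_hasFourierTransform
  exact (h k).1.ae_eq (fourierTransform_ae_eq hg k).symm

/-- Bessel's inequality for the Fourier transform on the cylinder. -/
theorem HasFourierTransform.tsum_lintegral_le {f : ℝ → ℝ → ℝ} {g : ℤ → ℝ → ℂ}
    (hg : HasFourierTransform f g) (hf : IsL2 f) :
    ∑' k : ℤ, ∫⁻ ξ, ‖g k ξ‖ₑ ^ 2 ≤ L2norm f ^ 2 := by
  have h : ∀ k, ∫⁻ ξ, ‖g k ξ‖ₑ ^ 2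
      = ENNReal.ofReal (2 * Real.pi)⁻¹ * ∫⁻ y, ‖mode k f y‖ₑ ^ 2 := by
    intro k
    have := hf.lintegral_fourierLine_sub k (φ := fun _ => 0) (integrable_zero ℝ ℂ volume) MemLp.zero
    simp only [fourierLine, mul_zero, integral_zero, zero_sub, enorm_neg] at this
    rw [← this]
    apply lintegral_congr_ae
    filter_upwards [fourierTransform_ae_eq hg k] with ξ hξ
    rw [hξ]
  simp only [h]
  rw [ENNReal.tsum_mul_left]
  calc _ ≤ ENNReal.ofReal (2 * Real.pi)⁻¹ * (ENNReal.ofReal (2 * Real.pi) * L2norm f ^ 2) := by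
        gcongr; exact hf.tsum_lintegral_mode_le
    _ = _ := by
        rw [← mul_assoc, ← ENNReal.ofReal_mul (by positivity), inv_mul_cancel₀ (by positivity)]
        simp

/-! ### Smooth functions on the cylinder -/

/-- Differentiation under an integral over a compact interval. -/
lemma hasDerivAt_intervalIntegral_param {F F' : ℝ → ℝ → ℂ} {U : Set ℝ} (hU : IsOpen U) {t₀ : ℝ}
    (ht₀ : t₀ ∈ U) (a b : ℝ) (hF : ∀ t ∈ U, Continuous (F t))
    (hd : ∀ t ∈ U, ∀ x, HasDerivAt (fun t => F t x) (F' t x) t)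
    (hF' : ContinuousOn (fun p : ℝ × ℝ => F' p.1 p.2) (U ×ˢ univ)) :
    HasDerivAt (fun t => ∫ x in a..b, F t x) (∫ x in a..b, F' t₀ x) t₀ := by
  obtain ⟨ε, hε, hball⟩ := Metric.nhds_basis_closedBall.mem_iff.1 (hU.mem_nhds ht₀)
  have hK : IsCompact (Metric.closedBall t₀ ε ×ˢ uIcc a b) :=
    (isCompact_closedBall t₀ ε).prod isCompact_uIcc
  obtain ⟨C, hC⟩ := hK.exists_bound_of_continuousOn
    (hF'.mono (prod_mono hball (subset_univ _)))
  have hs : Continuous fun x => F' t₀ x := by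
    have h1 : ContinuousOn (fun x : ℝ => F' t₀ x) univ :=
      hF'.comp (f := fun x : ℝ => (t₀, x)) (by fun_prop) fun x _ => ⟨ht₀, mem_univ _⟩
    exact continuousOn_univ.1 h1
  refine (intervalIntegral.hasDerivAt_integral_of_dominated_loc_of_deriv_le (F := F)
    (bound := fun _ => C) (Metric.closedBall_mem_nhds t₀ hε)
    ?_ ((hF t₀ ht₀).intervalIntegrable _ _) hs.aestronglyMeasurable ?_
    intervalIntegrable_const ?_).2
  · filter_upwards [hU.mem_nhds ht₀] with t ht
    exact (hF t ht).aestronglyMeasurable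
  · exact .of_forall fun x hx t ht => hC (t, x) ⟨ht, uIoc_subset_uIcc hx⟩
  · exact .of_forall fun x hx t ht => hd t (hball ht) x

/-- Smooth functions on the cylinder. -/
structure IsSmoothPeriodic (f : ℝ → ℝ → ℝ) : Prop where
  smooth : ContDiff ℝ (⊤ : ℕ∞) fun p : ℝ × ℝ => f p.1 p.2
  periodic : ∀ x y, f (x + 2 * Real.pi) y = f x y

namespace IsSmoothPeriodic

variable {f : ℝ → ℝ → ℝ}

lemma continuous (hf : IsSmoothPeriodic f) : Continuous fun p : ℝ × ℝ => f p.1 p.2 :=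
  hf.smooth.continuous

lemma hasDerivAt_fst (hf : IsSmoothPeriodic f) (x y : ℝ) :
    HasDerivAt (fun x' => f x' y) (fderiv ℝ (fun p : ℝ × ℝ => f p.1 p.2) (x, y) (1, 0)) x := by
  have h := (hf.smooth.differentiable (by simp) (x, y)).hasFDerivAt
  exact h.comp_hasDerivAt x (((hasDerivAt_id x).prodMk (hasDerivAt_const x y)))

lemma hasDerivAt_snd (hf : IsSmoothPeriodic f) (x y : ℝ) :
    HasDerivAt (fun y' => f x y') (fderiv ℝ (fun p : ℝ × ℝ => f p.1 p.2) (x, y) (0, 1)) y := by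
  have h := (hf.smooth.differentiable (by simp) (x, y)).hasFDerivAt
  exact h.comp_hasDerivAt y (((hasDerivAt_const y x).prodMk (hasDerivAt_id y)))

lemma deriv_fst (hf : IsSmoothPeriodic f) :
    IsSmoothPeriodic fun x y => deriv (fun x' => f x' y) x := by
  refine ⟨?_, fun x y => ?_⟩
  · simp only [fun p : ℝ × ℝ => (hf.hasDerivAt_fst p.1 p.2).deriv]
    exact (hf.smooth.fderiv_right (m := (⊤ : ℕ∞)) (by simp)).clm_apply contDiff_const
  · have h := deriv_comp_add_const (fun x' => f x' y) (2 * Real.pi) x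
    simp only [hf.periodic] at h
    exact h.symm

lemma deriv_snd (hf : IsSmoothPeriodic f) :
    IsSmoothPeriodic fun x y => deriv (fun y' => f x y') y := by
  refine ⟨?_, fun x y => ?_⟩
  · simp only [fun p : ℝ × ℝ => (hf.hasDerivAt_snd p.1 p.2).deriv]
    exact (hf.smooth.fderiv_right (m := (⊤ : ℕ∞)) (by simp)).clm_apply contDiff_const
  · simp only [hf.periodic]

lemma add {g : ℝ → ℝ → ℝ} (hf : IsSmoothPeriodic f) (hg : IsSmoothPeriodic g) :
    IsSmoothPeriodic fun x y => f x y + g x y :=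
  ⟨hf.smooth.add hg.smooth, fun x y => by rw [hf.periodic, hg.periodic]⟩

lemma neg (hf : IsSmoothPeriodic f) : IsSmoothPeriodic fun x y => -f x y :=
  ⟨hf.smooth.neg, fun x y => by rw [hf.periodic]⟩

lemma continuous_slice (hf : IsSmoothPeriodic f) (y : ℝ) : Continuous fun x => f x y :=
  hf.continuous.comp (continuous_id.prodMk continuous_const)

end IsSmoothPeriodic

lemma continuous_mode_integrand {f : ℝ → ℝ → ℝ} (k : ℤ) {y : ℝ}
    (hf : Continuous fun x => f x y) :
    Continuous fun x : ℝ => Complex.exp (-(Complex.I * (k : ℂ) * (x : ℂ))) * (f x y : ℂ) := by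
  fun_prop

lemma mode_add {f g : ℝ → ℝ → ℝ} (k : ℤ) {y : ℝ} (hf : Continuous fun x => f x y)
    (hg : Continuous fun x => g x y) :
    mode k (fun x y => f x y + g x y) y = mode k f y + mode k g y := by
  simp only [mode, Complex.ofReal_add, mul_add]
  exact intervalIntegral.integral_add ((continuous_mode_integrand k hf).intervalIntegrable _ _)
    ((continuous_mode_integrand k hg).intervalIntegrable _ _)

lemma mode_mul (f : ℝ → ℝ → ℝ) (c : ℝ → ℝ) (k : ℤ) (y : ℝ) :
    mode k (fun x y => c y * f x y) y = c y * mode k f y := by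
  simp only [mode, Complex.ofReal_mul, ← intervalIntegral.integral_const_mul]
  congr 1 with x
  ring

lemma IsSmoothPeriodic.mode_deriv_fst {f : ℝ → ℝ → ℝ} (hf : IsSmoothPeriodic f) (k : ℤ) (y : ℝ) :
    mode k (fun x y => deriv (fun x' => f x' y) x) y = Complex.I * k * mode k f y := by
  have hE : ∀ x : ℝ, HasDerivAt (fun x : ℝ => Complex.exp (-(Complex.I * (k : ℂ) * (x : ℂ))))
      (-(Complex.I * k) * Complex.exp (-(Complex.I * (k : ℂ) * (x : ℂ)))) x := by
    intro x
    have := ((((hasDerivAt_id (x : ℂ)).const_mul (Complex.I * k)).neg).cexp).comp_ofReal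
    refine this.congr_deriv ?_
    simp only [id_eq, mul_one, Pi.neg_apply]
    ring
  have hfd : ∀ x : ℝ, HasDerivAt (fun x => (f x y : ℂ)) ((deriv (fun x' => f x' y) x : ℝ) : ℂ) x :=
    fun x => (hf.hasDerivAt_fst x y).differentiableAt.hasDerivAt.ofReal_comp
  have hc : Continuous fun x : ℝ => Complex.exp (-(Complex.I * (k : ℂ) * (x : ℂ))) := by fun_prop
  have h := intervalIntegral.integral_mul_deriv_eq_deriv_mul (a := 0) (b := 2 * Real.pi)
    (fun x _ => hE x) (fun x _ => hfd x) ((continuous_const.mul hc).intervalIntegrable _ _)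
    ((Complex.continuous_ofReal.comp (hf.deriv_fst.continuous_slice y)).intervalIntegrable _ _)
  have hper : f (2 * Real.pi) y = f 0 y := by
    have := hf.periodic 0 y
    rwa [zero_add] at this
  have hexp : Complex.exp (-(Complex.I * (k : ℂ) * ((2 * Real.pi : ℝ) : ℂ))) = 1 := by
    rw [Complex.exp_eq_one_iff]
    exact ⟨-k, by push_cast; ring⟩
  rw [hper, hexp] at h
  rw [mode, h]
  simp only [mode, ← intervalIntegral.integral_const_mul, Complex.ofReal_zero, mul_zero, neg_zero,
    Complex.exp_zero, sub_self, zero_sub, ← intervalIntegral.integral_neg]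
  congr 1 with x
  ring

lemma IsSmoothPeriodic.hasDerivAt_mode {f : ℝ → ℝ → ℝ} (hf : IsSmoothPeriodic f) (k : ℤ)
    (y : ℝ) :
    HasDerivAt (mode k f) (mode k (fun x y => deriv (fun y' => f x y') y) y) y := by
  refine hasDerivAt_intervalIntegral_param isOpen_univ (mem_univ y) 0 (2 * Real.pi)
    (F := fun y x => Complex.exp (-(Complex.I * (k : ℂ) * (x : ℂ))) * (f x y : ℂ))
    (F' := fun y x => Complex.exp (-(Complex.I * (k : ℂ) * (x : ℂ)))
      * ((deriv (fun y' => f x y') y : ℝ) : ℂ))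
    (fun t _ => continuous_mode_integrand k (hf.continuous_slice t)) (fun t _ x => ?_) ?_
  · exact ((hf.hasDerivAt_snd x t).differentiableAt.hasDerivAt.ofReal_comp).const_mul _
  · have := hf.deriv_snd.continuous
    have h2 : Continuous fun p : ℝ × ℝ => deriv (fun y' => f p.2 y') p.1 :=
      this.comp continuous_swap
    exact Continuous.continuousOn (by fun_prop)

lemma IsSmoothPeriodic.continuous_mode {f : ℝ → ℝ → ℝ} (hf : IsSmoothPeriodic f) (k : ℤ) :
    Continuous (mode k f) :=
  continuous_iff_continuousAt.2 fun y => (hf.hasDerivAt_mode k y).continuousAt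

lemma IsSmoothPeriodic.integrable_mode_mul {f : ℝ → ℝ → ℝ} (hf : IsSmoothPeriodic f) (k : ℤ)
    {θ : ℝ → ℂ} (hθ : IsTest θ) : Integrable fun y => mode k f y * θ y :=
  ((hf.continuous_mode k).mul hθ.1.continuous).integrable_of_hasCompactSupport hθ.2.mul_left

lemma IsSmoothPeriodic.integral_mode_deriv_snd {f : ℝ → ℝ → ℝ} (hf : IsSmoothPeriodic f) (k : ℤ)
    {θ : ℝ → ℂ} (hθ : IsTest θ) :
    ∫ y, mode k (fun x y => deriv (fun y' => f x y') y) y * θ y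
      = -∫ y, mode k f y * deriv θ y := by
  have h := integral_mul_deriv_eq_deriv_mul_of_integrable (u := mode k f) (v := θ)
    (fun y _ => hf.hasDerivAt_mode k y)
    (fun y _ => (hθ.1.differentiable (by simp) y).hasDerivAt)
    (hf.integrable_mode_mul k hθ.deriv) (hf.deriv_snd.integrable_mode_mul k hθ)
    (hf.integrable_mode_mul k hθ)
  rw [h, neg_neg]

lemma IsSmoothPeriodic.integrableOn {f : ℝ → ℝ → ℝ} (hf : IsSmoothPeriodic f) (R : ℝ) :
    IntegrableOn (fun p : ℝ × ℝ => f p.1 p.2) (univ ×ˢ Icc (-R) R) cylMeasure := by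
  have e : cylMeasure.restrict (univ ×ˢ Icc (-R) R)
      = (volume : Measure (ℝ × ℝ)).restrict (Ioc 0 (2 * Real.pi) ×ˢ Icc (-R) R) := by
    rw [cylMeasure, ← Measure.prod_restrict, Measure.restrict_univ, Measure.prod_restrict]
    rfl
  rw [IntegrableOn, e]
  have : IntegrableOn (fun p : ℝ × ℝ => f p.1 p.2) (Icc 0 (2 * Real.pi) ×ˢ Icc (-R) R) volume :=
    hf.continuous.continuousOn.integrableOn_compact (isCompact_Icc.prod isCompact_Icc)
  exact this.mono_set (prod_mono Ioc_subset_Icc_self subset_rfl)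

/-- The Fourier transform of a derivative in `x`. -/
lemma IsSmoothPeriodic.hasFourierTransform_deriv_fst {f : ℝ → ℝ → ℝ} (hf : IsSmoothPeriodic f)
    {g : ℤ → ℝ → ℂ} (hg : HasFourierTransform f g) :
    HasFourierTransform (fun x y => deriv (fun x' => f x' y) x)
      fun k ξ => Complex.I * k * g k ξ := by
  refine ⟨hf.deriv_fst.integrableOn, fun k => IsTempered.const_mul (hg.tempered k) _,
    fun k θ hθ hθc => ?_⟩
  have h := hg.pairing' k ⟨hθ, hθc⟩
  change ∫ y, mode k (fun x y => deriv (fun x' => f x' y) x) y * θ y = _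
  simp only [← fourierLine_neg]
  simp only [hf.mode_deriv_fst, mul_assoc, integral_const_mul, h]

/-- The Fourier transform of a derivative in `y`. -/
lemma IsSmoothPeriodic.hasFourierTransform_deriv_snd {f : ℝ → ℝ → ℝ} (hf : IsSmoothPeriodic f)
    {g : ℤ → ℝ → ℂ} (hg : HasFourierTransform f g) :
    HasFourierTransform (fun x y => deriv (fun y' => f x y') y)
      fun k ξ => Complex.I * ξ * g k ξ := by
  refine ⟨hf.deriv_snd.integrableOn, fun k => IsTempered.mul_freq (hg.tempered k),
    fun k θ hθ hθc => ?_⟩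
  have hT : IsTest θ := ⟨hθ, hθc⟩
  have h := hg.pairing' k hT.deriv
  change ∫ y, mode k (fun x y => deriv (fun y' => f x y') y) y * θ y = _
  rw [hf.integral_mode_deriv_snd k hT, h, ← integral_neg]
  congr 1 with ξ
  rw [hT.fourierLine_deriv, fourierLine_neg]
  ring

lemma HasFourierTransform.add {f f' : ℝ → ℝ → ℝ} {g g' : ℤ → ℝ → ℂ} (hf : IsSmoothPeriodic f)
    (hf' : IsSmoothPeriodic f') (hg : HasFourierTransform f g) (hg' : HasFourierTransform f' g') :
    HasFourierTransform (fun x y => f x y + f' x y) fun k ξ => g k ξ + g' k ξ := by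
  refine ⟨(hf.add hf').integrableOn, fun k => IsTempered.add (hg.tempered k) (hg'.tempered k),
    fun k θ hθ hθc => ?_⟩
  have hT : IsTest θ := ⟨hθ, hθc⟩
  change ∫ y, mode k (fun x y => f x y + f' x y) y * θ y = _
  simp only [mode_add k (hf.continuous_slice _) (hf'.continuous_slice _), add_mul,
    ← fourierLine_neg]
  rw [integral_add (hf.integrable_mode_mul k hT) (hf'.integrable_mode_mul k hT),
    integral_add (IsTempered.integrable_mul_fourierLine (hg.tempered k) hT)
      (IsTempered.integrable_mul_fourierLine (hg'.tempered k) hT),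
    hg.pairing' k hT, hg'.pairing' k hT]

lemma HasFourierTransform.neg {f : ℝ → ℝ → ℝ} {g : ℤ → ℝ → ℂ} (hf : IsSmoothPeriodic f)
    (hg : HasFourierTransform f g) :
    HasFourierTransform (fun x y => -f x y) fun k ξ => -g k ξ := by
  refine ⟨hf.neg.integrableOn, fun k => ?_, fun k θ hθ hθc => ?_⟩
  · have h := IsTempered.const_mul (hg.tempered k) (-1)
    simp only [neg_one_mul] at h
    exact h
  · have h := hg.pairing' k ⟨hθ, hθc⟩
    have e : ∀ y, mode k (fun x y => -f x y) y = -mode k f y := fun y => by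
      simpa using mode_mul f (fun _ => -1) k y
    change ∫ y, mode k (fun x y => -f x y) y * θ y = _
    simp only [e, neg_mul, integral_neg, ← fourierLine_neg, h]

/-- A function with zero average in `x` has no zero mode. -/
lemma HasFourierTransform.ae_eq_zero_of_zeroAverage {f : ℝ → ℝ → ℝ} {g : ℤ → ℝ → ℂ}
    (hg : HasFourierTransform f g) (h0 : HasZeroAverage f) : g 0 =ᵐ[volume] 0 := by
  refine IsTempered.ae_eq_zero (hg.tempered 0) fun θ hθ => ?_
  rw [← hg.pairing' 0 hθ]
  have : ∀ y, mode 0 f y = 0 := by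
    intro y
    have := h0 y
    simp only [mode, Int.cast_zero, mul_zero, zero_mul, neg_zero, Complex.exp_zero, one_mul]
    rw [intervalIntegral.integral_ofReal, this, Complex.ofReal_zero]
  simp [this]

/-! ### Localized transforms -/

lemma continuousOn_intervalIntegral_param {X : Type*} [TopologicalSpace X] {F : X → ℝ → ℂ}
    {S : Set X} (hF : ContinuousOn (fun p : X × ℝ => F p.1 p.2) (S ×ˢ univ)) (a b : ℝ) :
    ContinuousOn (fun x => ∫ y in a..b, F x y) S := by
  rw [continuousOn_iff_continuous_domRestrict]
  refine intervalIntegral.continuous_parametric_intervalIntegral_of_continuous'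
    (f := fun (x : S) y => F x y) ?_ a b
  exact hF.comp_continuous (f := fun p : S × ℝ => ((p.1 : X), p.2)) (by fun_prop)
    fun p => ⟨p.1.2, mem_univ _⟩

/-- The Fourier transform of `w f`, where `w` is a cutoff in the variable `y`. -/
def localized (w : ℝ → ℂ) (k : ℤ) (f : ℝ → ℝ → ℝ) (ξ : ℝ) : ℂ :=
  (((2 * Real.pi)⁻¹ : ℝ) : ℂ) * fourierLine (fun y => w y * mode k f y) ξ

lemma IsTest.mul_exp {w : ℝ → ℂ} (hw : IsTest w) (ξ : ℝ) :
    IsTest fun y : ℝ => Complex.exp (-(Complex.I * (ξ : ℂ) * (y : ℂ))) * w y := by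
  refine ⟨ContDiff.mul ?_ hw.1, hw.2.mul_left⟩
  exact ((contDiff_const.mul Complex.ofRealCLM.contDiff).neg).cexp

lemma localized_eq (w : ℝ → ℂ) (k : ℤ) (f : ℝ → ℝ → ℝ) (ξ : ℝ) :
    localized w k f ξ = (((2 * Real.pi)⁻¹ : ℝ) : ℂ)
      * ∫ y, mode k f y * (Complex.exp (-(Complex.I * (ξ : ℂ) * (y : ℂ))) * w y) := by
  rw [localized, fourierLine]
  congr 2 with y
  ring

section Slice

variable {f g : ℝ → ℝ → ℝ} {w : ℝ → ℂ}

lemma localized_add (hf : IsSmoothPeriodic f) (hg : IsSmoothPeriodic g) (hw : IsTest w) (k : ℤ)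
    (ξ : ℝ) :
    localized w k (fun x y => f x y + g x y) ξ = localized w k f ξ + localized w k g ξ := by
  simp only [localized_eq, mode_add k (hf.continuous_slice _) (hg.continuous_slice _), add_mul]
  rw [integral_add (hf.integrable_mode_mul k (hw.mul_exp ξ))
    (hg.integrable_mode_mul k (hw.mul_exp ξ)), mul_add]

lemma localized_const_mul (f : ℝ → ℝ → ℝ) (w : ℝ → ℂ) (c : ℝ) (k : ℤ) (ξ : ℝ) :
    localized w k (fun x y => c * f x y) ξ = c * localized w k f ξ := by
  simp only [localized_eq, mode_mul f (fun _ => c), mul_assoc, integral_const_mul]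
  ring

lemma localized_deriv_fst (hf : IsSmoothPeriodic f) (w : ℝ → ℂ) (k : ℤ) (ξ : ℝ) :
    localized w k (fun x y => deriv (fun x' => f x' y) x) ξ
      = Complex.I * k * localized w k f ξ := by
  simp only [localized_eq, hf.mode_deriv_fst, mul_assoc, integral_const_mul]
  ring

lemma localized_deriv_snd (hf : IsSmoothPeriodic f) (hw : IsTest w) (k : ℤ) (ξ : ℝ) :
    localized w k (fun x y => deriv (fun y' => f x y') y) ξ
      = Complex.I * ξ * localized w k f ξ - localized (deriv w) k f ξ := by
  have hd : ∀ y : ℝ, deriv (fun y : ℝ => Complex.exp (-(Complex.I * (ξ : ℂ) * (y : ℂ))) * w y) y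
      = -(Complex.I * ξ) * (Complex.exp (-(Complex.I * (ξ : ℂ) * (y : ℂ))) * w y)
        + Complex.exp (-(Complex.I * (ξ : ℂ) * (y : ℂ))) * deriv w y := by
    intro y
    have hE := ((((hasDerivAt_id (y : ℂ)).const_mul (Complex.I * ξ)).neg).cexp).comp_ofReal
    have h := hE.mul (hw.1.differentiable (by simp) y).hasDerivAt
    refine (h.congr_deriv ?_).deriv
    simp only [id_eq, mul_one, Pi.neg_apply]
    ring
  simp only [localized_eq]
  rw [hf.integral_mode_deriv_snd k (hw.mul_exp ξ)]
  simp only [hd, mul_add]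
  have e : ∀ y : ℝ, mode k f y * (-(Complex.I * ξ) *
      (Complex.exp (-(Complex.I * (ξ : ℂ) * (y : ℂ))) * w y)) = -(Complex.I * ξ) *
      (mode k f y * (Complex.exp (-(Complex.I * (ξ : ℂ) * (y : ℂ))) * w y)) := fun y => by ring
  have hi := (hf.integrable_mode_mul k (hw.mul_exp ξ)).const_mul (-(Complex.I * ξ))
  simp only [e]
  rw [integral_add hi (hf.integrable_mode_mul k (hw.deriv.mul_exp ξ)), integral_const_mul]
  ring

end Slice

namespace IsSmoothField

section Vector

variable {E : Type*} [NormedAddCommGroup E] [NormedSpace ℝ E] {f : ℝ → ℝ → ℝ → E}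

lemma contDiffAt (hf : IsSmoothField f) {t : ℝ} (ht : 0 < t) (x y : ℝ) :
    ContDiffAt ℝ (⊤ : ℕ∞) (fun p : ℝ × ℝ × ℝ => f p.1 p.2.1 p.2.2) (t, x, y) :=
  hf.smooth.contDiffAt (prod_mem_nhds (Ici_mem_nhds ht) Filter.univ_mem)

lemma aestronglyMeasurable (hf : IsSmoothField f) {t : ℝ} (ht : 0 ≤ t) :
    AEStronglyMeasurable (fun p : ℝ × ℝ => f t p.1 p.2) cylMeasure := by
  have : Continuous fun p : ℝ × ℝ => f t p.1 p.2 :=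
    hf.smooth.continuousOn.comp_continuous (f := fun p : ℝ × ℝ => (t, p.1, p.2)) (by fun_prop)
      fun p => ⟨ht, mem_univ _⟩
  exact this.aestronglyMeasurable

lemma memLp (hf : IsSmoothField f) {t : ℝ} (ht : 0 ≤ t) :
    MemLp (fun p : ℝ × ℝ => f t p.1 p.2) 2 cylMeasure := by
  obtain ⟨B, hB⟩ := hf.locallyBounded t
  exact ⟨hf.aestronglyMeasurable ht, (hB t ⟨ht, le_rfl⟩).trans_lt ENNReal.ofReal_lt_top⟩

end Vector

lemma component {u : ℝ → ℝ → ℝ → Plane} (hu : IsSmoothField u) (i : Fin 2) :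
    IsSmoothField fun t x y => u t x y i := by
  refine ⟨?_, fun t ht x y => by rw [hu.periodic t ht], fun τ => ?_⟩
  · exact (EuclideanSpace.proj (𝕜 := ℝ) i : Plane →L[ℝ] ℝ).contDiff.comp_contDiffOn
      hu.smooth
  · obtain ⟨B, hB⟩ := hu.locallyBounded τ
    exact ⟨B, fun t ht => (eLpNorm_mono fun p => PiLp.norm_apply_le _ i).trans (hB t ht)⟩

variable {f : ℝ → ℝ → ℝ → ℝ}

lemma isSmoothPeriodic (hf : IsSmoothField f) {t : ℝ} (ht : 0 ≤ t) : IsSmoothPeriodic (f t) :=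
  ⟨hf.smooth.comp_contDiff (f := fun p : ℝ × ℝ => (t, p.1, p.2)) (by fun_prop)
    fun p => ⟨ht, mem_univ _⟩, hf.periodic t ht⟩

lemma hasDerivAt_time (hf : IsSmoothField f) {t : ℝ} (ht : 0 < t) (x y : ℝ) :
    HasDerivAt (fun s => f s x y) (fderiv ℝ (fun p : ℝ × ℝ × ℝ => f p.1 p.2.1 p.2.2) (t, x, y)
      (1, 0, 0)) t := by
  have h := ((hf.contDiffAt ht x y).differentiableAt (by simp)).hasFDerivAt
  exact h.comp_hasDerivAt t ((hasDerivAt_id t).prodMk ((hasDerivAt_const t x).prodMk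
    (hasDerivAt_const t y)))

lemma contDiffOn_deriv_time (hf : IsSmoothField f) :
    ContDiffOn ℝ (⊤ : ℕ∞) (fun p : ℝ × ℝ × ℝ => deriv (fun s => f s p.2.1 p.2.2) p.1)
      (Ioi 0 ×ˢ univ) := by
  have ho : IsOpen (Ioi (0 : ℝ) ×ˢ (univ : Set (ℝ × ℝ))) := isOpen_Ioi.prod isOpen_univ
  have h := (hf.smooth.mono (prod_mono Ioi_subset_Ici_self subset_rfl)).fderiv_of_isOpen ho
    (m := (⊤ : ℕ∞)) (by simp)
  refine (h.clm_apply (contDiffOn_const (c := ((1, 0, 0) : ℝ × ℝ × ℝ)))).congr fun p hp => ?_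
  exact (hf.hasDerivAt_time hp.1 p.2.1 p.2.2).deriv

lemma deriv_time_isSmoothPeriodic (hf : IsSmoothField f) {t : ℝ} (ht : 0 < t) :
    IsSmoothPeriodic fun x y => deriv (fun s => f s x y) t := by
  refine ⟨hf.contDiffOn_deriv_time.comp_contDiff (f := fun p : ℝ × ℝ => (t, p.1, p.2))
    (by fun_prop) fun p => ⟨ht, mem_univ _⟩, fun x y => ?_⟩
  apply Filter.EventuallyEq.deriv_eq
  filter_upwards [Ioi_mem_nhds ht] with s hs
  exact hf.periodic s (le_of_lt hs) x y

lemma continuousOn_mode (hf : IsSmoothField f) (k : ℤ) :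
    ContinuousOn (fun p : ℝ × ℝ => mode k (f p.1) p.2) (Ici 0 ×ˢ univ) := by
  refine continuousOn_intervalIntegral_param (F := fun p : ℝ × ℝ => fun x =>
    Complex.exp (-(Complex.I * (k : ℂ) * (x : ℂ))) * (f p.1 x p.2 : ℂ)) ?_ _ _
  refine ContinuousOn.mul (by fun_prop) (Complex.continuous_ofReal.comp_continuousOn ?_)
  exact hf.smooth.continuousOn.comp (f := fun q : (ℝ × ℝ) × ℝ => (q.1.1, q.2, q.1.2))
    (by fun_prop) fun q hq => ⟨hq.1.1, mem_univ _⟩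

lemma continuousOn_mode_deriv_time (hf : IsSmoothField f) (k : ℤ) :
    ContinuousOn (fun p : ℝ × ℝ => mode k (fun x y => deriv (fun s => f s x y) p.1) p.2)
      (Ioi 0 ×ˢ univ) := by
  refine continuousOn_intervalIntegral_param (F := fun p : ℝ × ℝ => fun x =>
    Complex.exp (-(Complex.I * (k : ℂ) * (x : ℂ)))
      * ((deriv (fun s => f s x p.2) p.1 : ℝ) : ℂ)) ?_ _ _
  refine ContinuousOn.mul (by fun_prop) (Complex.continuous_ofReal.comp_continuousOn ?_)
  exact hf.contDiffOn_deriv_time.continuousOn.comp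
    (f := fun q : (ℝ × ℝ) × ℝ => (q.1.1, q.2, q.1.2))
    (by fun_prop) fun q hq => ⟨hq.1.1, mem_univ _⟩

lemma hasDerivAt_mode_time (hf : IsSmoothField f) (k : ℤ) {t : ℝ} (ht : 0 < t) (y : ℝ) :
    HasDerivAt (fun s => mode k (f s) y) (mode k (fun x y => deriv (fun s => f s x y) t) y) t := by
  refine hasDerivAt_intervalIntegral_param (U := Ioi 0) isOpen_Ioi ht 0 (2 * Real.pi)
    (F := fun s x => Complex.exp (-(Complex.I * (k : ℂ) * (x : ℂ))) * (f s x y : ℂ))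
    (F' := fun s x => Complex.exp (-(Complex.I * (k : ℂ) * (x : ℂ)))
      * ((deriv (fun s => f s x y) s : ℝ) : ℂ))
    (fun s hs => continuous_mode_integrand k
      ((hf.isSmoothPeriodic (le_of_lt hs)).continuous_slice y)) (fun s hs x => ?_) ?_
  · exact ((hf.hasDerivAt_time hs x y).differentiableAt.hasDerivAt.ofReal_comp).const_mul _
  · refine ContinuousOn.mul (by fun_prop) (Complex.continuous_ofReal.comp_continuousOn ?_)
    exact hf.contDiffOn_deriv_time.continuousOn.comp (f := fun q : ℝ × ℝ => (q.1, q.2, y))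
      (by fun_prop) fun q hq => ⟨hq.1, mem_univ _⟩

end IsSmoothField

lemma IsTest.exists_integral_eq {w : ℝ → ℂ} (hw : IsTest w) :
    ∃ R : ℝ, ∀ h : ℝ → ℂ, ∫ y, h y * w y = ∫ y in (-R)..R, h y * w y := by
  obtain ⟨R, hR⟩ := hw.2.isCompact.isBounded.subset_ball (0 : ℝ)
  refine ⟨R, fun h => (intervalIntegral.integral_eq_integral_of_support_subset ?_).symm⟩
  intro y hy
  have hy' : w y ≠ 0 := fun h0 => hy (by simp [h0])
  have := hR (subset_tsupport w hy')
  rw [Real.ball_eq_Ioo, zero_sub, zero_add] at this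
  exact ⟨this.1, this.2.le⟩

lemma IsSmoothField.continuousOn_localized {f : ℝ → ℝ → ℝ → ℝ} (hf : IsSmoothField f) {w : ℝ → ℂ}
    (hw : IsTest w) (k : ℤ) :
    ContinuousOn (fun p : ℝ × ℝ => localized w k (f p.1) p.2) (Ici 0 ×ˢ univ) := by
  obtain ⟨R, hR⟩ := hw.exists_integral_eq
  have e : (fun p : ℝ × ℝ => localized w k (f p.1) p.2) = fun p : ℝ × ℝ =>
      (((2 * Real.pi)⁻¹ : ℝ) : ℂ) * ∫ y in (-R)..R,
        (mode k (f p.1) y * Complex.exp (-(Complex.I * (p.2 : ℂ) * (y : ℂ)))) * w y := by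
    ext p
    rw [localized_eq, ← hR]
    congr 2 with y
    ring
  rw [e]
  refine continuousOn_const.mul (continuousOn_intervalIntegral_param
    (F := fun (p : ℝ × ℝ) y =>
      (mode k (f p.1) y * Complex.exp (-(Complex.I * (p.2 : ℂ) * (y : ℂ)))) * w y) ?_ _ _)
  have hwc := hw.1.continuous
  refine ContinuousOn.mul (ContinuousOn.mul ?_ (by fun_prop)) (by fun_prop)
  exact (hf.continuousOn_mode k).comp (f := fun q : (ℝ × ℝ) × ℝ => (q.1.1, q.2))
    (by fun_prop) fun q hq => ⟨hq.1.1, mem_univ _⟩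

/-- Along the characteristics `ξ - k s` of the transport by the Couette flow, the localized
transform is differentiable, with the localized transform of `∂ₜf + y ∂ₓf` as its derivative. -/
lemma IsSmoothField.hasDerivAt_localized {f : ℝ → ℝ → ℝ → ℝ} (hf : IsSmoothField f) {w : ℝ → ℂ}
    (hw : IsTest w) (k : ℤ) (ξ : ℝ) {t : ℝ} (ht : 0 < t) :
    HasDerivAt (fun s => localized w k (f s) (ξ - k * s))
      (localized w k (fun x y => deriv (fun s => f s x y) t + y * deriv (fun x' => f t x' y) x)
        (ξ - k * t)) t := by
  obtain ⟨R, hR⟩ := hw.exists_integral_eq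
  have e : ∀ (h : ℝ → ℝ → ℝ) (ζ : ℝ), localized w k h ζ =
      (((2 * Real.pi)⁻¹ : ℝ) : ℂ) * ∫ y in (-R)..R,
        (mode k h y * Complex.exp (-(Complex.I * (ζ : ℂ) * (y : ℂ)))) * w y := by
    intro h ζ
    rw [localized_eq, ← hR]
    congr 2 with y
    ring
  have hwc := hw.1.continuous
  have hE : ∀ s y : ℝ, HasDerivAt
      (fun s : ℝ => Complex.exp (-(Complex.I * ((ξ - k * s : ℝ) : ℂ) * (y : ℂ))))
      (Complex.I * k * y * Complex.exp (-(Complex.I * ((ξ - k * s : ℝ) : ℂ) * (y : ℂ)))) s := by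
    intro s y
    have h1 : HasDerivAt (fun s : ℝ => ((ξ - k * s : ℝ) : ℂ)) ((-k : ℝ) : ℂ) s := by
      have := (((hasDerivAt_id s).const_mul (k : ℝ)).const_sub ξ).ofReal_comp
      simpa using this
    have h2 := (((h1.const_mul Complex.I).mul_const (y : ℂ)).neg).cexp
    refine h2.congr_deriv ?_
    simp only [Pi.neg_apply]
    push_cast
    ring
  simp only [e]
  refine HasDerivAt.const_mul _ ?_
  refine (hasDerivAt_intervalIntegral_param (U := Ioi 0) isOpen_Ioi ht (-R) R
    (F := fun s y => (mode k (f s) y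
      * Complex.exp (-(Complex.I * ((ξ - k * s : ℝ) : ℂ) * (y : ℂ)))) * w y)
    (F' := fun s y => (mode k (fun x y => deriv (fun s => f s x y) s) y
        * Complex.exp (-(Complex.I * ((ξ - k * s : ℝ) : ℂ) * (y : ℂ)))
      + mode k (f s) y * (Complex.I * k * y
        * Complex.exp (-(Complex.I * ((ξ - k * s : ℝ) : ℂ) * (y : ℂ))))) * w y)
    (fun s hs => ?_) (fun s hs y => ?_) ?_).congr_deriv ?_
  · have := (hf.isSmoothPeriodic (le_of_lt hs)).continuous_mode k
    fun_prop
  · exact ((hf.hasDerivAt_mode_time k hs y).mul (hE s y)).mul_const (w y)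
  · have h1 := hf.continuousOn_mode_deriv_time k
    have h2 := (hf.continuousOn_mode k).mono (prod_mono Ioi_subset_Ici_self subset_rfl)
    refine ContinuousOn.mul (ContinuousOn.add (h1.mul (by fun_prop)) (h2.mul ?_)) (by fun_prop)
    fun_prop
  · congr 1 with y
    have hsp := hf.isSmoothPeriodic ht.le
    have hc : Continuous fun x => y * deriv (fun x' => f t x' y) x :=
      continuous_const.mul (hsp.deriv_fst.continuous_slice y)
    have hm : mode k (fun x y => deriv (fun s => f s x y) t + y * deriv (fun x' => f t x' y) x) y
        = mode k (fun x y => deriv (fun s => f s x y) t) y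
          + y * (Complex.I * k * mode k (f t) y) := by
      rw [mode_add (f := fun x y => deriv (fun s => f s x y) t)
        (g := fun x y => y * deriv (fun x' => f t x' y) x) k
        ((hf.deriv_time_isSmoothPeriodic ht).continuous_slice y) hc,
        mode_mul (fun x y => deriv (fun x' => f t x' y) x) (fun y => y), hsp.mode_deriv_fst]
    rw [hm]
    ring

/-! ### The localized system of a smooth solution -/

lemma IsSmoothPeriodic.const_mul {f : ℝ → ℝ → ℝ} (hf : IsSmoothPeriodic f) (c : ℝ) :
    IsSmoothPeriodic fun x y => c * f x y :=
  ⟨contDiff_const.mul hf.smooth, fun x y => by rw [hf.periodic]⟩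

/-- The localized transforms of a smooth solution satisfy the localized system. -/
theorem IsSmoothSolution.isLocalizedSolution {P : Parameters} {η φ : ℝ → ℝ → ℝ → ℝ}
    {u : ℝ → ℝ → ℝ → Plane} (h : IsSmoothSolution P η u φ) {w : ℝ → ℂ} (hw : IsTest w) (k : ℤ)
    (ξ : ℝ) :
    IsLocalizedSolution P k ξ (fun s => localized w k (η s) (ξ - k * s))
      (fun s => localized w k (fun x y => u s x y 0) (ξ - k * s))
      (fun s => localized w k (fun x y => u s x y 1) (ξ - k * s))
      (fun s => localized w k (φ s) (ξ - k * s))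
      (fun s => localized (deriv w) k (η s) (ξ - k * s))
      (fun s => localized (deriv w) k (fun x y => u s x y 1) (ξ - k * s))
      (fun s => localized (deriv w) k (φ s) (ξ - k * s))
      (fun s => localized (deriv (deriv w)) k (φ s) (ξ - k * s)) := by
  have hη := h.density_field
  have hu0 := h.velocity_field.component 0
  have hu1 := h.velocity_field.component 1
  have hφ := h.potential_field
  have hcont : ∀ {f : ℝ → ℝ → ℝ → ℝ} (hf : IsSmoothField f) {w : ℝ → ℂ} (hw : IsTest w),
      ContinuousOn (fun s => localized w k (f s) (ξ - k * s)) (Ici 0) := fun hf _ hw =>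
    (hf.continuousOn_localized hw k).comp (f := fun s : ℝ => (s, ξ - k * s)) (by fun_prop)
      fun s hs => ⟨hs, mem_univ _⟩
  have hζ : ∀ s : ℝ, ((ξ - k * s : ℝ) : ℂ) = ξ - k * s := fun s => by push_cast; ring
  refine ⟨hcont hη hw, hcont hu0 hw, hcont hu1 hw, hcont hη hw.deriv, hcont hu1 hw.deriv,
    hcont hφ hw.deriv, hcont hφ hw.deriv.deriv, fun s hs => ?_, fun s hs => ?_, fun s hs => ?_,
    fun s hs => ?_⟩
  · have pu0 := hu0.isSmoothPeriodic hs.le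
    have pu1 := hu1.isSmoothPeriodic hs.le
    refine (hη.hasDerivAt_localized hw k ξ hs).congr_deriv ?_
    have e : (fun x y => deriv (fun s => η s x y) s + y * deriv (fun x' => η s x' y) x)
        = fun x y => (-1) * (deriv (fun x' => u s x' y 0) x + deriv (fun y' => u s x y' 1) y) := by
      ext x y
      have := h.continuity_eq s hs x y
      rw [divergence] at this
      linarith
    rw [e, localized_const_mul (fun x y => deriv (fun x' => u s x' y 0) x
      + deriv (fun y' => u s x y' 1) y), localized_add pu0.deriv_fst pu1.deriv_snd hw,
      localized_deriv_fst pu0, localized_deriv_snd pu1 hw, hζ]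
    push_cast
    ring
  · have pη := hη.isSmoothPeriodic hs.le
    have pu1 := hu1.isSmoothPeriodic hs.le
    have pφ := hφ.isSmoothPeriodic hs.le
    refine (hu0.hasDerivAt_localized hw k ξ hs).congr_deriv ?_
    have e : (fun x y => deriv (fun s => u s x y 0) s + y * deriv (fun x' => u s x' y 0) x)
        = fun x y => (-1) * u s x y 1 + (-(P.TPlus / P.mPlus) * deriv (fun x' => η s x' y) x
          + -(P.e / P.mPlus) * deriv (fun x' => φ s x' y) x) := by
      ext x y
      linarith [h.momentum_x_eq s hs x y]
    rw [e, localized_add (pu1.const_mul (-1)) ((pη.deriv_fst.const_mul _).add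
      (pφ.deriv_fst.const_mul _)) hw, localized_add (pη.deriv_fst.const_mul _)
      (pφ.deriv_fst.const_mul _) hw, localized_const_mul (fun x y => u s x y 1),
      localized_const_mul (fun x y => deriv (fun x' => η s x' y) x),
      localized_const_mul (fun x y => deriv (fun x' => φ s x' y) x), localized_deriv_fst pη,
      localized_deriv_fst pφ]
    push_cast
    ring
  · have pη := hη.isSmoothPeriodic hs.le
    have pφ := hφ.isSmoothPeriodic hs.le
    refine (hu1.hasDerivAt_localized hw k ξ hs).congr_deriv ?_
    have e : (fun x y => deriv (fun s => u s x y 1) s + y * deriv (fun x' => u s x' y 1) x)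
        = fun x y => -(P.TPlus / P.mPlus) * deriv (fun y' => η s x y') y
          + -(P.e / P.mPlus) * deriv (fun y' => φ s x y') y := by
      ext x y
      linarith [h.momentum_y_eq s hs x y]
    rw [e, localized_add (pη.deriv_snd.const_mul _) (pφ.deriv_snd.const_mul _) hw,
      localized_const_mul (fun x y => deriv (fun y' => η s x y') y),
      localized_const_mul (fun x y => deriv (fun y' => φ s x y') y), localized_deriv_snd pη hw,
      localized_deriv_snd pφ hw, hζ]
    push_cast
    ring
  · have pη := hη.isSmoothPeriodic hs.le
    have pφ := hφ.isSmoothPeriodic hs.le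
    have e : (fun x y => deriv (fun x' => deriv (fun x'' => φ s x'' y) x') x
          + deriv (fun y' => deriv (fun y'' => φ s x y'') y') y)
        = fun x y => (4 * Real.pi * P.e * (P.e / P.TMinus)) * φ s x y
          + (-(4 * Real.pi * P.e)) * η s x y := by
      ext x y
      have := h.poisson_eq s hs x y
      simp only [iteratedDeriv_succ, iteratedDeriv_zero] at this
      linarith
    have e2 := congrArg (fun f => localized w k f (ξ - k * s)) e
    rw [localized_add pφ.deriv_fst.deriv_fst pφ.deriv_snd.deriv_snd hw,
      localized_deriv_fst pφ.deriv_fst, localized_deriv_fst pφ,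
      localized_deriv_snd pφ.deriv_snd hw, localized_deriv_snd pφ hw,
      localized_deriv_snd pφ hw.deriv, localized_add (pφ.const_mul _) (pη.const_mul _) hw,
      localized_const_mul (φ s), localized_const_mul (η s), hζ] at e2
    push_cast at e2 ⊢
    linear_combination e2 - k ^ 2 * localized w k (φ s) (ξ - k * s) * Complex.I_sq

/-! ### Removal of the cutoffs -/

section Cutoffs

open Filter Topology

/-- Cutoffs that tend to `1`, with derivatives that tend to `0` uniformly. -/
lemma exists_cutoffs : ∃ (w : ℕ → ℝ → ℂ) (ε : ℕ → ℝ), (∀ n, IsTest (w n)) ∧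
    (∀ n y, ‖w n y‖ ≤ 1) ∧ (∀ y, Tendsto (fun n => w n y) atTop (𝓝 1)) ∧
    Tendsto ε atTop (𝓝 0) ∧ (∀ n y, ‖deriv (w n) y‖ ≤ ε n) ∧
    ∀ n y, ‖deriv (deriv (w n)) y‖ ≤ ε n := by
  let b : ContDiffBump (0 : ℝ) := ⟨1, 2, one_pos, one_lt_two⟩
  let χ : ℝ → ℂ := fun y => (b y : ℂ)
  have hχ : IsTest χ :=
    ⟨Complex.ofRealCLM.contDiff.comp b.contDiff, b.hasCompactSupport.comp_left Complex.ofReal_zero⟩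
  obtain ⟨C₁, hC₁⟩ := hχ.deriv.2.exists_bound_of_continuous hχ.deriv.1.continuous
  obtain ⟨C₂, hC₂⟩ := hχ.deriv.deriv.2.exists_bound_of_continuous hχ.deriv.deriv.1.continuous
  have hC₁0 : 0 ≤ C₁ := (norm_nonneg _).trans (hC₁ 0)
  have hC₂0 : 0 ≤ C₂ := (norm_nonneg _).trans (hC₂ 0)
  have hd : ∀ (θ : ℝ → ℂ) (c : ℝ), IsTest θ →
      deriv (fun y => θ (c * y)) = fun y => (c : ℂ) * deriv θ (c * y) := by
    intro θ c hθ
    ext y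
    have h1 : HasDerivAt (fun y => c * y) c y := by simpa using (hasDerivAt_id y).const_mul c
    have h := ((hθ.1.differentiable (by simp) (c * y)).hasDerivAt).scomp y h1
    rw [← Complex.real_smul]
    exact h.deriv
  let a : ℕ → ℝ := fun n => 1 / ((n : ℝ) + 1)
  have ha : ∀ n, 0 < a n := fun n => by positivity
  have ha1 : ∀ n, a n ≤ 1 := fun n => by
    rw [div_le_one (by positivity)]
    linarith [(Nat.cast_nonneg n : (0 : ℝ) ≤ n)]
  have hat : Tendsto a atTop (𝓝 0) := tendsto_one_div_add_atTop_nhds_zero_nat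
  refine ⟨fun n y => χ (a n * y), fun n => a n * (C₁ + C₂), fun n => ?_, fun n y => ?_, fun y => ?_,
    by simpa using hat.mul_const (C₁ + C₂), fun n y => ?_, fun n y => ?_⟩
  · refine ⟨hχ.1.comp (contDiff_const.mul contDiff_id), ?_⟩
    exact hχ.2.comp_homeomorph (Homeomorph.mulLeft₀ (a n) (ha n).ne')
  · simp only [χ]
    rw [Complex.norm_real, Real.norm_of_nonneg b.nonneg]
    exact b.le_one
  · have h1 : Tendsto (fun n => χ (a n * y)) atTop (𝓝 (χ (0 * y))) :=
      (hχ.1.continuous.tendsto _).comp (hat.mul_const y)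
    have h2 : χ (0 * y) = 1 := by
      have : b (0 : ℝ) = 1 := b.one_of_mem_closedBall (by simp [b])
      simp only [χ, zero_mul, this, Complex.ofReal_one]
    rwa [h2] at h1
  · rw [hd χ _ hχ, norm_mul, Complex.norm_real, Real.norm_of_nonneg (ha n).le]
    refine mul_le_mul_of_nonneg_left ?_ (ha n).le
    linarith [hC₁ (a n * y)]
  · rw [hd χ _ hχ]
    have e : deriv (fun y => (a n : ℂ) * deriv χ (a n * y)) y
        = a n * (a n * deriv (deriv χ) (a n * y)) := by
      rw [deriv_const_mul_field, hd _ _ hχ.deriv]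
    rw [e, norm_mul, norm_mul, Complex.norm_real, Real.norm_of_nonneg (ha n).le]
    refine mul_le_mul_of_nonneg_left ?_ (ha n).le
    refine (mul_le_of_le_one_left (norm_nonneg _) (ha1 n)).trans ?_
    linarith [hC₂ (a n * y)]

/-- Plancherel's identity for Fourier integrals, as the case in which the limit in
`exists_plancherel` is attained. -/
lemma lintegral_fourierLine_sq {φ : ℝ → ℂ} (hφ : Integrable φ) (hφ2 : MemLp φ 2) :
    ∫⁻ ξ, ‖fourierLine φ ξ‖ₑ ^ 2 = ENNReal.ofReal (2 * Real.pi) * ∫⁻ y, ‖φ y‖ₑ ^ 2 := by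
  obtain ⟨G, hG, h, -⟩ := exists_plancherel hφ2
  have h1 := h φ hφ hφ2
  have h2 := h (fun _ => 0) (integrable_zero ℝ ℂ volume) MemLp.zero
  simp only [sub_self, enorm_zero, ne_eq, OfNat.ofNat_ne_zero, not_false_eq_true, zero_pow,
    lintegral_const, zero_mul, mul_zero] at h1
  have hm : AEMeasurable (fun ξ => ‖fourierLine φ ξ - G ξ‖ₑ ^ 2) volume :=
    (((continuous_fourierLine hφ).aestronglyMeasurable.sub
      hG.aestronglyMeasurable).enorm.pow_const 2)
  rw [lintegral_eq_zero_iff' hm] at h1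
  simp only [fourierLine, mul_zero, integral_zero, zero_sub, enorm_neg] at h2
  rw [← h2]
  apply lintegral_congr_ae
  filter_upwards [h1] with ξ hξ
  have : fourierLine φ ξ - G ξ = 0 := by simpa using hξ
  rw [sub_eq_zero.1 this]

section Slice

variable {f : ℝ → ℝ → ℝ} {w : ℝ → ℂ}

lemma IsSmoothPeriodic.integrable_cutoff_mul (hf : IsSmoothPeriodic f) (hw : IsTest w) (k : ℤ) :
    Integrable fun y => w y * mode k f y :=
  (hw.1.continuous.mul (hf.continuous_mode k)).integrable_of_hasCompactSupport hw.2.mul_right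

lemma IsSmoothPeriodic.memLp_cutoff_mul (hf : IsSmoothPeriodic f) (hw : IsTest w) (k : ℤ) :
    MemLp (fun y => w y * mode k f y) 2 :=
  (hw.1.continuous.mul (hf.continuous_mode k)).memLp_of_hasCompactSupport hw.2.mul_right

lemma continuous_localized (hf : IsSmoothPeriodic f) (hw : IsTest w) (k : ℤ) :
    Continuous (localized w k f) :=
  continuous_const.mul (continuous_fourierLine (hf.integrable_cutoff_mul hw k))

/-- A cutoff of size `ε` gives a localized transform of size `ε` in `L²`. -/
lemma lintegral_localized_sq_le (hf : IsSmoothPeriodic f) (hf2 : IsL2 f) (hw : IsTest w) {ε : ℝ}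
    (hε : ∀ y, ‖w y‖ ≤ ε) (k : ℤ) :
    ∫⁻ ξ, ‖localized w k f ξ‖ₑ ^ 2 ≤ ENNReal.ofReal ε ^ 2 * L2norm f ^ 2 := by
  have hπ : 0 < 2 * Real.pi := by positivity
  simp only [localized, enorm_mul, mul_pow]
  rw [lintegral_const_mul' _ _ (by finiteness), lintegral_fourierLine_sq
    (hf.integrable_cutoff_mul hw k) (hf.memLp_cutoff_mul hw k), enorm_ofReal,
    Real.enorm_of_nonneg (by positivity), ← mul_assoc]
  have h1 : ∫⁻ y, ‖w y * mode k f y‖ₑ ^ 2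
      ≤ ENNReal.ofReal ε ^ 2 * (ENNReal.ofReal (2 * Real.pi) * L2norm f ^ 2) := by
    refine le_trans (lintegral_mono fun y => ?_) ((lintegral_const_mul' (ENNReal.ofReal ε ^ 2)
      (fun y => ‖mode k f y‖ₑ ^ 2) (by finiteness)).trans_le ?_)
    · simp only [enorm_mul, mul_pow]
      gcongr
      rw [← ofReal_norm]
      exact ENNReal.ofReal_le_ofReal (hε y)
    · gcongr
      exact (ENNReal.le_tsum k).trans hf2.tsum_lintegral_mode_le
  calc _ ≤ ENNReal.ofReal (2 * Real.pi)⁻¹ ^ 2 * ENNReal.ofReal (2 * Real.pi)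
        * (ENNReal.ofReal ε ^ 2 * (ENNReal.ofReal (2 * Real.pi) * L2norm f ^ 2)) := by gcongr
    _ = (ENNReal.ofReal (2 * Real.pi)⁻¹ * ENNReal.ofReal (2 * Real.pi)) ^ 2
        * (ENNReal.ofReal ε ^ 2 * L2norm f ^ 2) := by ring
    _ = _ := by
      rw [← ENNReal.ofReal_mul (by positivity), inv_mul_cancel₀ hπ.ne', ENNReal.ofReal_one,
        one_pow, one_mul]

/-- Localized transforms tend to the full transform in `L²` when the cutoffs tend to `1`. -/
lemma tendsto_lintegral_localized_sub (hf : IsSmoothPeriodic f) (hf2 : IsL2 f) {w : ℕ → ℝ → ℂ}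
    (hw : ∀ n, IsTest (w n)) (hw1 : ∀ n y, ‖w n y‖ ≤ 1)
    (hlim : ∀ y, Tendsto (fun n => w n y) atTop (𝓝 1)) (k : ℤ) :
    Tendsto (fun n => ∫⁻ ξ, ‖localized (w n) k f ξ - fourierTransform f k ξ‖ₑ ^ 2) atTop (𝓝 0) := by
  have e : ∀ n, ∫⁻ ξ, ‖localized (w n) k f ξ - fourierTransform f k ξ‖ₑ ^ 2
      = ENNReal.ofReal (2 * Real.pi)⁻¹ * ∫⁻ y, ‖w n y * mode k f y - mode k f y‖ₑ ^ 2 := fun n =>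
    hf2.lintegral_fourierLine_sub k (hf.integrable_cutoff_mul (hw n) k)
      (hf.memLp_cutoff_mul (hw n) k)
  simp only [e]
  rw [← mul_zero (ENNReal.ofReal (2 * Real.pi)⁻¹)]
  refine ENNReal.Tendsto.const_mul ?_ (Or.inr ENNReal.ofReal_ne_top)
  have hc := hf.continuous_mode k
  have h := tendsto_lintegral_of_dominated_convergence' (μ := volume)
    (F := fun n y => ‖w n y * mode k f y - mode k f y‖ₑ ^ 2) (f := fun _ => 0)
    (fun y => 4 * ‖mode k f y‖ₑ ^ 2) (fun n => ?_) (fun n => .of_forall fun y => ?_) ?_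
    (.of_forall fun y => ?_)
  · simpa using h
  · have := (hw n).1.continuous
    have hcont : Continuous fun y => w n y * mode k f y - mode k f y := by fun_prop
    exact hcont.aestronglyMeasurable.enorm.pow_const 2
  · have h1 : ‖w n y * mode k f y - mode k f y‖ₑ ≤ 2 * ‖mode k f y‖ₑ := by
      rw [← ofReal_norm, ← ofReal_norm, ← ENNReal.ofReal_ofNat, ← ENNReal.ofReal_mul (by norm_num)]
      apply ENNReal.ofReal_le_ofReal
      calc _ ≤ ‖w n y * mode k f y‖ + ‖mode k f y‖ := norm_sub_le _ _
        _ ≤ 1 * ‖mode k f y‖ + ‖mode k f y‖ := by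
          have := mul_le_mul_of_nonneg_right (hw1 n y) (norm_nonneg (mode k f y))
          rw [norm_mul]
          linarith
        _ = _ := by ring
    calc _ ≤ (2 * ‖mode k f y‖ₑ) ^ 2 := pow_le_pow_left' h1 2
      _ = _ := by rw [mul_pow]; norm_num
  · rw [lintegral_const_mul' _ _ (by finiteness)]
    exact ENNReal.mul_ne_top (by finiteness) (eLpNorm_two_lt_top_iff.1 (hf2.memLp_mode k).2).ne
  · have h1 : Tendsto (fun n => w n y * mode k f y - mode k f y) atTop
        (𝓝 (1 * mode k f y - mode k f y)) := ((hlim y).mul_const _).sub_const _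
    rw [one_mul, sub_self] at h1
    have h2 := (ENNReal.continuous_pow 2).tendsto _ |>.comp h1.enorm
    simpa [Function.comp_def] using h2

end Slice

/-- Sequences of real functions that tend to zero in `L²`. -/
def TendsToZeroL2 (d : ℕ → ℝ → ℝ) : Prop :=
  (∀ n, AEStronglyMeasurable (d n) volume) ∧
    Tendsto (fun n => eLpNorm (d n) 2 volume) atTop (𝓝 0)

lemma TendsToZeroL2.add {d d' : ℕ → ℝ → ℝ} (h : TendsToZeroL2 d) (h' : TendsToZeroL2 d') :
    TendsToZeroL2 fun n ξ => d n ξ + d' n ξ := by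
  refine ⟨fun n => (h.1 n).add (h'.1 n), ?_⟩
  have := h.2.add h'.2
  rw [add_zero] at this
  exact tendsto_of_tendsto_of_tendsto_of_le_of_le tendsto_const_nhds this (fun _ => bot_le)
    fun n => eLpNorm_add_le (h.1 n) (h'.1 n) one_le_two

lemma tendsToZeroL2_of_lintegral {d : ℕ → ℝ → ℝ} (hd : ∀ n, AEStronglyMeasurable (d n) volume)
    (h : Tendsto (fun n => ∫⁻ ξ, ‖d n ξ‖ₑ ^ 2) atTop (𝓝 0)) : TendsToZeroL2 d := by
  refine ⟨hd, ?_⟩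
  simp only [eLpNorm_two_eq]
  have := ((ENNReal.continuous_rpow_const (y := 1 / 2)).tendsto 0).comp h
  rw [ENNReal.zero_rpow_of_pos (by norm_num)] at this
  exact this

lemma TendsToZeroL2.exists_seq {d : ℕ → ℝ → ℝ} (h : TendsToZeroL2 d) :
    ∃ σ : ℕ → ℕ, ∀ᵐ ξ, Tendsto (fun j => d (σ j) ξ) atTop (𝓝 0) := by
  have h1 : TendstoInMeasure volume d atTop 0 :=
    tendstoInMeasure_of_tendsto_eLpNorm two_ne_zero h.1 aestronglyMeasurable_zero (by
      simpa using h.2)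
  obtain ⟨σ, -, hσ⟩ := h1.exists_seq_tendsto_ae
  exact ⟨σ, hσ⟩

namespace IsSmoothField

variable {f : ℝ → ℝ → ℝ → ℝ}

lemma aestronglyMeasurable_localized (hf : IsSmoothField f) {w : ℝ → ℂ} (hw : IsTest w) (k : ℤ)
    (T : ℝ) :
    AEStronglyMeasurable (fun p : ℝ × ℝ => localized w k (f p.2) (p.1 - k * p.2))
      (volume.prod (volume.restrict (Ioc 0 T))) := by
  have e : (volume : Measure ℝ).prod (volume.restrict (Ioc 0 T))
      = (volume : Measure (ℝ × ℝ)).restrict (univ ×ˢ Ioc 0 T) := by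
    rw [Measure.volume_eq_prod, ← Measure.prod_restrict, Measure.restrict_univ]
  rw [e]
  refine ContinuousOn.aestronglyMeasurable ?_ (MeasurableSet.univ.prod measurableSet_Ioc)
  exact (hf.continuousOn_localized hw k).comp (f := fun p : ℝ × ℝ => (p.2, p.1 - k * p.2))
    (by fun_prop) fun p hp => ⟨hp.2.1.le, mem_univ _⟩

lemma aestronglyMeasurable_integral_localized (hf : IsSmoothField f) {w : ℝ → ℂ} (hw : IsTest w)
    (k : ℤ) {T : ℝ} (hT : 0 ≤ T) :
    AEStronglyMeasurable (fun ξ => ∫ s in (0 : ℝ)..T, ‖localized w k (f s) (ξ - k * s)‖)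
      volume := by
  simp only [intervalIntegral.integral_of_le hT]
  exact (hf.aestronglyMeasurable_localized hw k T).norm.integral_prod_right'

/-- The commutators with a cutoff are small in `L²` when the cutoff has small derivatives. -/
lemma lintegral_integral_localized_sq_le (hf : IsSmoothField f) {T : ℝ} (hT : 0 ≤ T) {B : ℝ}
    (hB : ∀ t ∈ Icc 0 T, L2norm (f t) ≤ ENNReal.ofReal B) {w : ℝ → ℂ} (hw : IsTest w) {ε : ℝ}
    (hε : ∀ y, ‖w y‖ ≤ ε) (k : ℤ) :
    ∫⁻ ξ, ‖∫ s in (0 : ℝ)..T, ‖localized w k (f s) (ξ - k * s)‖‖ₑ ^ 2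
      ≤ ENNReal.ofReal ε ^ 2 * (ENNReal.ofReal B ^ 2 * ENNReal.ofReal T ^ 2) := by
  have hm := hf.aestronglyMeasurable_localized hw k T
  have h1 : ∀ᵐ ξ, ‖∫ s in (0 : ℝ)..T, ‖localized w k (f s) (ξ - k * s)‖‖ₑ ^ 2
      ≤ ENNReal.ofReal T * ∫⁻ s in Ioc 0 T, ‖localized w k (f s) (ξ - k * s)‖ₑ ^ 2 := by
    filter_upwards [hm.prodMk_left] with ξ hξ
    have h2 := eLpNorm_le_eLpNorm_mul_rpow_measure_univ (p := 1) (q := 2) one_le_two hξ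
    have h3 : ‖∫ s in (0 : ℝ)..T, ‖localized w k (f s) (ξ - k * s)‖‖ₑ
        ≤ ∫⁻ s in Ioc 0 T, ‖localized w k (f s) (ξ - k * s)‖ₑ := by
      rw [intervalIntegral.integral_of_le hT]
      refine (enorm_integral_le_lintegral_enorm _).trans_eq ?_
      simp only [enorm_norm]
    rw [eLpNorm_one_eq_lintegral_enorm] at h2
    calc _ ≤ (eLpNorm (fun s => localized w k (f s) (ξ - k * s)) 2 (volume.restrict (Ioc 0 T))
          * ENNReal.ofReal T ^ (1 / 2 : ℝ)) ^ 2 := by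
          refine pow_le_pow_left' (h3.trans (h2.trans_eq ?_)) 2
          rw [Measure.restrict_apply_univ, Real.volume_Ioc, sub_zero]
          norm_num
      _ = _ := by
          rw [mul_pow, eLpNorm_two_sq, ← ENNReal.rpow_natCast, ← ENNReal.rpow_mul, mul_comm]
          norm_num
  refine (lintegral_mono_ae h1).trans ?_
  rw [lintegral_const_mul' _ _ ENNReal.ofReal_ne_top,
    lintegral_lintegral_swap (hm.enorm.pow_const 2)]
  have h4 : ∀ s ∈ Ioc 0 T, ∫⁻ ξ, ‖localized w k (f s) (ξ - k * s)‖ₑ ^ 2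
      ≤ ENNReal.ofReal ε ^ 2 * ENNReal.ofReal B ^ 2 := by
    intro s hs
    rw [lintegral_sub_right_eq_self (fun ξ => ‖localized w k (f s) ξ‖ₑ ^ 2) (k * s)]
    refine (lintegral_localized_sq_le (hf.isSmoothPeriodic hs.1.le) (hf.memLp hs.1.le) hw hε
      k).trans ?_
    gcongr
    exact hB s ⟨hs.1.le, hs.2⟩
  calc _ ≤ ENNReal.ofReal T * ∫⁻ _ in Ioc 0 T, ENNReal.ofReal ε ^ 2 * ENNReal.ofReal B ^ 2 := by
        exact mul_le_mul' le_rfl (setLIntegral_mono' measurableSet_Ioc h4)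
    _ = _ := by
        rw [setLIntegral_const, Real.volume_Ioc, sub_zero]
        ring

/-- The distance between the localized and the full transform, at the times `0` and `T`, together
with the commutators with the cutoff. -/
def localizationError (f : ℝ → ℝ → ℝ → ℝ) (k : ℤ) (T : ℝ) (w : ℝ → ℂ) (ξ : ℝ) : ℝ :=
  ‖localized w k (f 0) ξ - fourierTransform (f 0) k ξ‖
    + ‖localized w k (f T) (ξ - k * T) - fourierTransform (f T) k (ξ - k * T)‖
    + (∫ s in (0 : ℝ)..T, ‖localized (deriv w) k (f s) (ξ - k * s)‖)
    + ∫ s in (0 : ℝ)..T, ‖localized (deriv (deriv w)) k (f s) (ξ - k * s)‖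

lemma tendsToZeroL2_localizationError (hf : IsSmoothField f) (k : ℤ) {T : ℝ} (hT : 0 ≤ T)
    {w : ℕ → ℝ → ℂ} {ε : ℕ → ℝ} (hw : ∀ n, IsTest (w n)) (hw1 : ∀ n y, ‖w n y‖ ≤ 1)
    (hlim : ∀ y, Tendsto (fun n => w n y) atTop (𝓝 1)) (hε : Tendsto ε atTop (𝓝 0))
    (hd : ∀ n y, ‖deriv (w n) y‖ ≤ ε n) (hdd : ∀ n y, ‖deriv (deriv (w n)) y‖ ≤ ε n) :
    TendsToZeroL2 fun n ξ => localizationError f k T (w n) ξ := by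
  obtain ⟨B, hB⟩ := hf.locallyBounded T
  have hmeas : ∀ {t : ℝ}, 0 ≤ t → ∀ n, AEStronglyMeasurable
      (fun ξ => ‖localized (w n) k (f t) ξ - fourierTransform (f t) k ξ‖) volume := fun ht n =>
    ((continuous_localized (hf.isSmoothPeriodic ht) (hw n) k).aestronglyMeasurable.sub
      (IsL2.memLp_fourierTransform (hf.memLp ht) k).aestronglyMeasurable).norm
  have hend : ∀ {t : ℝ}, 0 ≤ t → Tendsto
      (fun n => ∫⁻ ξ, ‖localized (w n) k (f t) ξ - fourierTransform (f t) k ξ‖ₑ ^ 2)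
      atTop (𝓝 0) := fun ht =>
    tendsto_lintegral_localized_sub (hf.isSmoothPeriodic ht) (hf.memLp ht) hw hw1 hlim k
  have hcomm : ∀ {v : ℕ → ℝ → ℂ}, (∀ n, IsTest (v n)) → (∀ n y, ‖v n y‖ ≤ ε n) →
      TendsToZeroL2 fun n ξ => ∫ s in (0 : ℝ)..T, ‖localized (v n) k (f s) (ξ - k * s)‖ := by
    intro v hv hvε
    refine tendsToZeroL2_of_lintegral
      (fun n => hf.aestronglyMeasurable_integral_localized (hv n) k hT) ?_
    refine tendsto_of_tendsto_of_tendsto_of_le_of_le tendsto_const_nhds ?_ (fun _ => bot_le)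
      fun n => hf.lintegral_integral_localized_sq_le hT hB (hv n) (hvε n) k
    have h1 := ENNReal.Tendsto.mul_const (b := ENNReal.ofReal B ^ 2 * ENNReal.ofReal T ^ 2)
      (((ENNReal.continuous_pow 2).tendsto _).comp
      ((ENNReal.continuous_ofReal.tendsto 0).comp hε)) (Or.inr (by finiteness))
    simpa using h1
  refine (TendsToZeroL2.add (TendsToZeroL2.add ?_ ?_) (hcomm (fun n => (hw n).deriv) hd)).add
    (hcomm (fun n => (hw n).deriv.deriv) hdd)
  · refine tendsToZeroL2_of_lintegral (hmeas le_rfl) ?_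
    simpa only [enorm_norm] using hend le_rfl
  · refine tendsToZeroL2_of_lintegral (fun n => ?_) ?_
    · exact (hmeas hT n).comp_quasiMeasurePreserving
        (measurePreserving_sub_right volume ((k : ℝ) * T)).quasiMeasurePreserving
    · simp only [enorm_norm]
      have e : ∀ n, ∫⁻ ξ, ‖localized (w n) k (f T) (ξ - k * T)
          - fourierTransform (f T) k (ξ - k * T)‖ₑ ^ 2
          = ∫⁻ ξ, ‖localized (w n) k (f T) ξ - fourierTransform (f T) k ξ‖ₑ ^ 2 := fun n =>
        lintegral_sub_right_eq_self (fun ξ =>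
          ‖localized (w n) k (f T) ξ - fourierTransform (f T) k ξ‖ₑ ^ 2) ((k : ℝ) * T)
      simp only [e]
      exact hend hT

end IsSmoothField

end Cutoffs

/-! ### The estimate at fixed frequency -/

section Limit

open Filter Topology

namespace IsSmoothField

lemma norm_localized_sub_le (f : ℝ → ℝ → ℝ → ℝ) (k : ℤ) {T : ℝ} (hT : 0 ≤ T) (w : ℝ → ℂ)
    (ξ : ℝ) :
    ‖localized w k (f 0) ξ - fourierTransform (f 0) k ξ‖ ≤ localizationError f k T w ξ ∧
    ‖localized w k (f T) (ξ - k * T) - fourierTransform (f T) k (ξ - k * T)‖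
      ≤ localizationError f k T w ξ ∧
    (∫ s in (0 : ℝ)..T, ‖localized (deriv w) k (f s) (ξ - k * s)‖)
      + (∫ s in (0 : ℝ)..T, ‖localized (deriv (deriv w)) k (f s) (ξ - k * s)‖)
      ≤ localizationError f k T w ξ := by
  have h1 := norm_nonneg (localized w k (f 0) ξ - fourierTransform (f 0) k ξ)
  have h2 := norm_nonneg (localized w k (f T) (ξ - k * T) - fourierTransform (f T) k (ξ - k * T))
  have h3 : 0 ≤ ∫ s in (0 : ℝ)..T, ‖localized (deriv w) k (f s) (ξ - k * s)‖ :=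
    intervalIntegral.integral_nonneg hT fun _ _ => norm_nonneg _
  have h4 : 0 ≤ ∫ s in (0 : ℝ)..T, ‖localized (deriv (deriv w)) k (f s) (ξ - k * s)‖ :=
    intervalIntegral.integral_nonneg hT fun _ _ => norm_nonneg _
  unfold localizationError
  exact ⟨by linarith, by linarith, by linarith⟩

lemma tendsto_of_norm_sub_le {a : ℕ → ℂ} {b : ℂ} {e : ℕ → ℝ} (he : Tendsto e atTop (𝓝 0))
    (h : ∀ j, ‖a j - b‖ ≤ e j) : Tendsto a atTop (𝓝 b) :=
  tendsto_iff_norm_sub_tendsto_zero.2 (squeeze_zero (fun _ => norm_nonneg _) h he)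

end IsSmoothField

open IsSmoothField in
/-- The frequency-wise estimate for a smooth solution: the data and the accumulated forcing are
controlled by the symmetrized solution at time `T`. The cutoffs of the localized system have been
removed. -/
theorem exists_ae_norm_data_add_forcing_le (P : Parameters) :
    ∃ C : ℝ, 0 < C ∧ ∀ (η : ℝ → ℝ → ℝ → ℝ) (u : ℝ → ℝ → ℝ → Plane) (φ : ℝ → ℝ → ℝ → ℝ),
      IsSmoothSolution P η u φ → ∀ (k : ℤ) (_ : k ≠ 0) (T : ℝ) (_ : 0 ≤ T), ∀ᵐ ξ : ℝ, ∀ i,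
      ‖symmetrized P k ξ 0 (fourierTransform (η 0) k ξ)
            (Complex.I * k * fourierTransform (fun x y => u 0 x y 0) k ξ
              + Complex.I * ξ * fourierTransform (fun x y => u 0 x y 1) k ξ) i
          + (∫ s in (0 : ℝ)..T, ((solutionOperator P k ξ 0 s).mulVec (Mvector k ξ s) i : ℂ))
            * (fourierTransform (η 0) k ξ
              - Complex.I * ξ * fourierTransform (fun x y => u 0 x y 0) k ξ
              + Complex.I * k * fourierTransform (fun x y => u 0 x y 1) k ξ)‖
        ≤ C * ∑ j, ‖symmetrized P k ξ T (fourierTransform (η T) k (ξ - k * T))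
            (Complex.I * k * fourierTransform (fun x y => u T x y 0) k (ξ - k * T)
              + Complex.I * (ξ - k * T)
                * fourierTransform (fun x y => u T x y 1) k (ξ - k * T)) j‖ := by
  obtain ⟨C, hC, h⟩ := exists_norm_data_add_forcing_le P
  refine ⟨C, hC, fun η u φ hs k hk T hT => ?_⟩
  obtain ⟨C', hC', h⟩ := h k hk T hT
  obtain ⟨w, ε, hw, hw1, hlim, hε, hd, hdd⟩ := exists_cutoffs
  have hη := hs.density_field
  have hu0 := hs.velocity_field.component 0
  have hu1 := hs.velocity_field.component 1
  have hφ := hs.potential_field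
  have herr := (((hη.tendsToZeroL2_localizationError k hT hw hw1 hlim hε hd hdd).add
    (hu0.tendsToZeroL2_localizationError k hT hw hw1 hlim hε hd hdd)).add
    (hu1.tendsToZeroL2_localizationError k hT hw hw1 hlim hε hd hdd)).add
    (hφ.tendsToZeroL2_localizationError k hT hw hw1 hlim hε hd hdd)
  -- along a subsequence the errors of all four fields tend to zero for almost every frequency
  obtain ⟨σ, hσ⟩ := herr.exists_seq
  filter_upwards [hσ] with ξ hξ i
  set e : ℕ → ℝ := fun j => localizationError η k T (w (σ j)) ξ
    + localizationError (fun t x y => u t x y 0) k T (w (σ j)) ξ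
    + localizationError (fun t x y => u t x y 1) k T (w (σ j)) ξ
    + localizationError φ k T (w (σ j)) ξ with he
  have hb := fun (f : ℝ → ℝ → ℝ → ℝ) j => norm_localized_sub_le f k hT (w (σ j)) ξ
  have hpos : ∀ (f : ℝ → ℝ → ℝ → ℝ) j, 0 ≤ localizationError f k T (w (σ j)) ξ := fun f j =>
    (norm_nonneg _).trans (hb f j).1
  have key := fun j => h ξ _ _ _ _ _ _ _ _ (hs.isLocalizedSolution (hw (σ j)) k ξ) i
  have hle : ∀ j, localizationError η k T (w (σ j)) ξ ≤ e j ∧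
      localizationError (fun t x y => u t x y 0) k T (w (σ j)) ξ ≤ e j ∧
      localizationError (fun t x y => u t x y 1) k T (w (σ j)) ξ ≤ e j := fun j => by
    have h1 := hpos η j
    have h2 := hpos (fun t x y => u t x y 0) j
    have h3 := hpos (fun t x y => u t x y 1) j
    have h4 := hpos φ j
    simp only [he]
    exact ⟨by linarith, by linarith, by linarith⟩
  have hN0 := tendsto_of_norm_sub_le hξ fun j => (hb η j).1.trans (hle j).1
  have hU0 := tendsto_of_norm_sub_le hξ fun j =>
    (hb (fun t x y => u t x y 0) j).1.trans (hle j).2.1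
  have hV0 := tendsto_of_norm_sub_le hξ fun j =>
    (hb (fun t x y => u t x y 1) j).1.trans (hle j).2.2
  have hNT := tendsto_of_norm_sub_le hξ fun j => (hb η j).2.1.trans (hle j).1
  have hUT := tendsto_of_norm_sub_le hξ fun j =>
    (hb (fun t x y => u t x y 0) j).2.1.trans (hle j).2.1
  have hVT := tendsto_of_norm_sub_le hξ fun j =>
    (hb (fun t x y => u t x y 1) j).2.1.trans (hle j).2.2
  have hsym : ∀ {s : ℝ} {a b : ℕ → ℂ} {a' b' : ℂ}, Tendsto a atTop (𝓝 a') → Tendsto b atTop (𝓝 b') →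
      ∀ i, Tendsto (fun j => symmetrized P k ξ s (a j) (b j) i) atTop
        (𝓝 (symmetrized P k ξ s a' b' i)) := by
    intro s a b a' b' ha hb
    rw [Fin.forall_fin_two]
    exact ⟨ha.const_mul _, hb.const_mul _⟩
  have hint : ∀ j, ∫ s in (0 : ℝ)..T, (‖localized (deriv (w (σ j))) k (η s) (ξ - k * s)‖
      + ‖localized (deriv (w (σ j))) k (fun x y => u s x y 1) (ξ - k * s)‖
      + ‖localized (deriv (w (σ j))) k (φ s) (ξ - k * s)‖
      + ‖localized (deriv (deriv (w (σ j)))) k (φ s) (ξ - k * s)‖) ≤ e j := by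
    intro j
    have hsol := hs.isLocalizedSolution (hw (σ j)) k ξ
    have hi : ∀ {F : ℝ → ℂ}, ContinuousOn F (Ici 0) →
        IntervalIntegrable (fun s => ‖F s‖) volume 0 T := fun hF =>
      ContinuousOn.intervalIntegrable (by
        rw [uIcc_of_le hT]
        exact (hF.mono Icc_subset_Ici_self).norm)
    rw [intervalIntegral.integral_add (((hi hsol.contN₁).add (hi hsol.contV₁)).add
        (hi hsol.contΦ₁)) (hi hsol.contΦ₂), intervalIntegral.integral_add
        ((hi hsol.contN₁).add (hi hsol.contV₁)) (hi hsol.contΦ₁),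
      intervalIntegral.integral_add (hi hsol.contN₁) (hi hsol.contV₁)]
    have h1 := (hb η j).2.2
    have h2 := (hb (fun t x y => u t x y 1) j).2.2
    have h3 := (hb φ j).2.2
    have h4 := hpos (fun t x y => u t x y 0) j
    have h5 : ∀ f : ℝ → ℝ → ℝ → ℝ, 0 ≤ ∫ s in (0 : ℝ)..T,
        ‖localized (deriv (deriv (w (σ j)))) k (f s) (ξ - k * s)‖ := fun f =>
      intervalIntegral.integral_nonneg hT fun _ _ => norm_nonneg _
    have h6 := h5 η
    have h7 := h5 (fun t x y => u t x y 1)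
    simp only [he] at *
    linarith
  have hL := (((hsym (s := 0) hN0 ((hU0.const_mul (Complex.I * k)).add
    (hV0.const_mul (Complex.I * ξ))) i).add
    (((hN0.sub (hU0.const_mul (Complex.I * ξ))).add (hV0.const_mul (Complex.I * k))).const_mul
      (∫ s in (0 : ℝ)..T, ((solutionOperator P k ξ 0 s).mulVec (Mvector k ξ s) i : ℂ))))).norm
  have hR := (tendsto_finsetSum Finset.univ fun (j : Fin 2) _ => (hsym (s := T) hNT
    ((hUT.const_mul (Complex.I * k)).add (hVT.const_mul (Complex.I * (ξ - k * T)))) j).norm).const_mul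
    C
  have hR2 := hR.add (hξ.const_mul C')
  rw [mul_zero, add_zero] at hR2
  refine le_of_tendsto_of_tendsto' hL hR2 fun j => ?_
  have h1 := key j
  simp only [mul_zero, sub_zero] at h1
  refine h1.trans ?_
  have := hint j
  gcongr

end Limit

/-! ### The weak Helmholtz decomposition -/

/-- Smooth `2π`-periodic functions on the line. -/
structure IsPeriodicTest (a : ℝ → ℝ) : Prop where
  smooth : ContDiff ℝ (⊤ : ℕ∞) a
  periodic : ∀ x, a (x + 2 * Real.pi) = a x

/-- Real test functions on the line. -/
structure IsRealTest (θ : ℝ → ℝ) : Prop where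
  smooth : ContDiff ℝ (⊤ : ℕ∞) θ
  compact : HasCompactSupport θ

lemma IsPeriodicTest.continuous_deriv {a : ℝ → ℝ} (ha : IsPeriodicTest a) : Continuous (deriv a) :=
  ha.smooth.continuous_deriv (by simp)

lemma IsRealTest.deriv {θ : ℝ → ℝ} (hθ : IsRealTest θ) : IsRealTest (deriv θ) :=
  ⟨(contDiff_infty_iff_deriv.1 hθ.smooth).2, hθ.compact.deriv⟩

/-- The gradient of `a(x) θ(y)`. -/
def gradField (a θ : ℝ → ℝ) (p : ℝ × ℝ) : Plane :=
  !₂[deriv a p.1 * θ p.2, a p.1 * deriv θ p.2]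

/-- The perpendicular gradient of `a(x) θ(y)`. -/
def perpField (a θ : ℝ → ℝ) (p : ℝ × ℝ) : Plane :=
  !₂[-(a p.1 * deriv θ p.2), deriv a p.1 * θ p.2]

lemma integrable_mul_prod_cylMeasure {a θ : ℝ → ℝ} (ha : Continuous a) (hθ : Continuous θ)
    (hθc : HasCompactSupport θ) :
    Integrable (fun p : ℝ × ℝ => a p.1 * θ p.2) cylMeasure :=
  ((ha.integrableOn_Icc (a := 0) (b := 2 * Real.pi)).mono_set Ioc_subset_Icc_self).mul_prod
    (hθ.integrable_of_hasCompactSupport hθc)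

lemma memLp_mul_prod_cylMeasure {a θ : ℝ → ℝ} (ha : Continuous a) (hθ : Continuous θ)
    (hθc : HasCompactSupport θ) :
    MemLp (fun p : ℝ × ℝ => a p.1 * θ p.2) 2 cylMeasure := by
  have hc : Continuous fun p : ℝ × ℝ => a p.1 * θ p.2 := by fun_prop
  rw [memLp_two_iff_integrable_sq hc.aestronglyMeasurable]
  have hs : HasCompactSupport fun y => θ y ^ 2 := hθc.comp_left (g := fun r : ℝ => r ^ 2) (by simp)
  refine (integrable_mul_prod_cylMeasure (a := fun x => a x ^ 2) (θ := fun y => θ y ^ 2)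
    (by fun_prop) (by fun_prop) hs).congr (.of_forall fun p => ?_)
  simp only
  ring

lemma memLp_plane {f g : ℝ × ℝ → ℝ} (hf : MemLp f 2 cylMeasure) (hg : MemLp g 2 cylMeasure) :
    MemLp (fun p => (!₂[f p, g p] : Plane)) 2 cylMeasure := by
  let e : Fin 2 → Plane := fun i => EuclideanSpace.single i (1 : ℝ)
  have key : (fun p => (!₂[f p, g p] : Plane)) = fun p => f p • e 0 + g p • e 1 := by
    ext p i
    fin_cases i <;> simp [e]
  rw [key]
  have hs : ∀ {f : ℝ × ℝ → ℝ} (v : Plane), MemLp f 2 cylMeasure →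
      MemLp (fun p => f p • v) 2 cylMeasure := fun v hf =>
    (ContinuousLinearMap.toSpanSingleton ℝ v).comp_memLp' hf
  exact (hs (e 0) hf).add (hs (e 1) hg)

lemma memLp_gradField {a θ : ℝ → ℝ} (ha : IsPeriodicTest a) (hθ : IsRealTest θ) :
    MemLp (gradField a θ) 2 cylMeasure :=
  memLp_plane (memLp_mul_prod_cylMeasure ha.continuous_deriv hθ.smooth.continuous hθ.compact)
    (memLp_mul_prod_cylMeasure ha.smooth.continuous hθ.deriv.smooth.continuous hθ.deriv.compact)

lemma memLp_perpField {a θ : ℝ → ℝ} (ha : IsPeriodicTest a) (hθ : IsRealTest θ) :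
    MemLp (perpField a θ) 2 cylMeasure :=
  memLp_plane (memLp_mul_prod_cylMeasure ha.smooth.continuous hθ.deriv.smooth.continuous
    hθ.deriv.compact).neg (memLp_mul_prod_cylMeasure ha.continuous_deriv hθ.smooth.continuous
    hθ.compact)

lemma inner_plane (v w : Plane) : inner ℝ v w = w 0 * v 0 + w 1 * v 1 := by
  rw [PiLp.inner_apply, Fin.sum_univ_two]
  rfl

/-- Gradients are orthogonal to perpendicular gradients: integrate by parts in both variables. -/
lemma integral_inner_gradField_perpField {a b θ ϑ : ℝ → ℝ} (ha : IsPeriodicTest a)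
    (hb : IsPeriodicTest b) (hθ : IsRealTest θ) (hϑ : IsRealTest ϑ) :
    ∫ p, inner ℝ (gradField a θ p) (perpField b ϑ p) ∂cylMeasure = 0 := by
  have hX : ∫ x in Ioc 0 (2 * Real.pi), b x * deriv a x
      = -∫ x in Ioc 0 (2 * Real.pi), deriv b x * a x := by
    rw [← intervalIntegral.integral_of_le (by positivity),
      ← intervalIntegral.integral_of_le (by positivity)]
    have h := intervalIntegral.integral_mul_deriv_eq_deriv_mul (a := 0) (b := 2 * Real.pi)
      (fun x _ => (hb.smooth.differentiable (by simp) x).hasDerivAt)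
      (fun x _ => (ha.smooth.differentiable (by simp) x).hasDerivAt)
      (hb.continuous_deriv.intervalIntegrable _ _) (ha.continuous_deriv.intervalIntegrable _ _)
    have ea := ha.periodic 0
    have eb := hb.periodic 0
    rw [zero_add] at ea eb
    rw [h, ea, eb]
    ring
  have hY : ∫ y, deriv ϑ y * θ y = -∫ y, ϑ y * deriv θ y := by
    have hi : ∀ {f g : ℝ → ℝ}, IsRealTest f → IsRealTest g → Integrable (f * g) := fun hf hg =>
      (hf.smooth.continuous.mul hg.smooth.continuous).integrable_of_hasCompactSupport
        hf.compact.mul_right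
    have h := integral_mul_deriv_eq_deriv_mul_of_integrable (u := ϑ) (v := θ)
      (fun y _ => (hϑ.smooth.differentiable (by simp) y).hasDerivAt)
      (fun y _ => (hθ.smooth.differentiable (by simp) y).hasDerivAt)
      (hi hϑ hθ.deriv) (hi hϑ.deriv hθ) (hi hϑ hθ)
    rw [h, neg_neg]
  have e : ∀ p, inner ℝ (gradField a θ p) (perpField b ϑ p)
      = (deriv b p.1 * a p.1) * (ϑ p.2 * deriv θ p.2)
        - (b p.1 * deriv a p.1) * (deriv ϑ p.2 * θ p.2) := by
    intro p
    rw [inner_plane]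
    simp only [gradField, perpField, PiLp.toLp_apply, Matrix.cons_val_zero, Matrix.cons_val_one]
    ring
  simp only [e]
  have hi : ∀ {a b f g : ℝ → ℝ}, Continuous a → Continuous b → IsRealTest f → IsRealTest g →
      Integrable (fun p : ℝ × ℝ => (a p.1 * b p.1) * (f p.2 * g p.2)) cylMeasure :=
    fun ha hb hf hg => integrable_mul_prod_cylMeasure (a := fun x => _ * _) (θ := fun y => _ * _)
      (ha.mul hb) (hf.smooth.continuous.mul hg.smooth.continuous) hf.compact.mul_right
  rw [integral_sub (hi hb.continuous_deriv ha.smooth.continuous hϑ hθ.deriv)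
    (hi hb.smooth.continuous ha.continuous_deriv hϑ.deriv hθ)]
  simp only [cylMeasure]
  rw [integral_prod_mul (fun x => deriv b x * a x) fun y => ϑ y * deriv θ y,
    integral_prod_mul (fun x => b x * deriv a x) fun y => deriv ϑ y * θ y, hX, hY]
  ring

/-- The Helmholtz decomposition of a square integrable field in weak form, obtained from the
orthogonal projection onto the closure of the gradients. -/
theorem exists_weak_helmholtz {v : ℝ → ℝ → Plane}
    (hv : MemLp (fun p : ℝ × ℝ => v p.1 p.2) 2 cylMeasure) :
    ∃ q : ℝ → ℝ → Plane, MemLp (fun p : ℝ × ℝ => q p.1 p.2) 2 cylMeasure ∧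
      ∀ a θ, IsPeriodicTest a → IsRealTest θ →
        ∫ p : ℝ × ℝ, inner ℝ (gradField a θ p) (q p.1 p.2) ∂cylMeasure
          = ∫ p : ℝ × ℝ, inner ℝ (gradField a θ p) (v p.1 p.2) ∂cylMeasure ∧
        ∫ p : ℝ × ℝ, inner ℝ (perpField a θ p) (q p.1 p.2) ∂cylMeasure = 0 := by
  let S : Set (Lp Plane 2 cylMeasure) :=
    {g | ∃ a θ, ∃ (ha : IsPeriodicTest a) (hθ : IsRealTest θ), g = (memLp_gradField ha hθ).toLp _}
  let W : Submodule ℝ (Lp Plane 2 cylMeasure) := (Submodule.span ℝ S).topologicalClosure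
  let Q : Lp Plane 2 cylMeasure := W.starProjection (hv.toLp _)
  have hinner : ∀ {F G : ℝ × ℝ → Plane} (hF : MemLp F 2 cylMeasure) (H : Lp Plane 2 cylMeasure),
      H =ᵐ[cylMeasure] G → inner ℝ (hF.toLp F) H = ∫ p, inner ℝ (F p) (G p) ∂cylMeasure := by
    intro F G hF H hH
    rw [L2.inner_def]
    apply integral_congr_ae
    filter_upwards [hF.coeFn_toLp, hH] with p h1 h2
    rw [h1, h2]
  refine ⟨fun x y => Q (x, y), Lp.memLp Q, fun a θ ha hθ => ⟨?_, ?_⟩⟩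
  · have hmem : (memLp_gradField ha hθ).toLp _ ∈ W :=
      Submodule.le_topologicalClosure _ (Submodule.subset_span ⟨a, θ, ha, hθ, rfl⟩)
    have h := Submodule.starProjection_inner_eq_zero (K := W) (hv.toLp _) _ hmem
    rw [real_inner_comm, inner_sub_right, sub_eq_zero,
      hinner (memLp_gradField ha hθ) _ hv.coeFn_toLp,
      hinner (memLp_gradField ha hθ) Q (.of_forall fun _ => rfl)] at h
    exact h.symm
  · have hW : W ≤ (Submodule.span ℝ {(memLp_perpField ha hθ).toLp _})ᗮ := by
      refine Submodule.topologicalClosure_minimal _ (Submodule.span_le.2 ?_)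
        (Submodule.isClosed_orthogonal _)
      rintro _ ⟨b, ϑ, hb, hϑ, rfl⟩
      rw [SetLike.mem_coe, Submodule.mem_orthogonal_singleton_iff_inner_left,
        hinner (memLp_gradField hb hϑ) _ (memLp_perpField ha hθ).coeFn_toLp]
      exact integral_inner_gradField_perpField hb ha hϑ hθ
    have hQ : Q ∈ W := Submodule.starProjection_apply_mem W _
    have h := Submodule.mem_orthogonal_singleton_iff_inner_right.1 (hW hQ)
    rwa [hinner (memLp_perpField ha hθ) Q (.of_forall fun _ => rfl)] at h

/-! ### The potential part -/

lemma IsRealTest.isTest {θ : ℝ → ℝ} (hθ : IsRealTest θ) : IsTest fun y => (θ y : ℂ) :=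
  ⟨Complex.ofRealCLM.contDiff.comp hθ.smooth, hθ.compact.comp_left Complex.ofReal_zero⟩

lemma IsRealTest.deriv_ofReal {θ : ℝ → ℝ} (hθ : IsRealTest θ) :
    _root_.deriv (fun y => (θ y : ℂ)) = fun y => ((_root_.deriv θ y : ℝ) : ℂ) :=
  funext fun y => ((hθ.smooth.differentiable (by simp) y).hasDerivAt.ofReal_comp).deriv

/-- Real test functions suffice to identify a function of polynomial growth. -/
lemma IsTempered.ae_eq_of_real {u v : ℝ → ℂ} (hu : IsTempered u) (hv : IsTempered v)
    (h : ∀ θ, IsRealTest θ → ∫ ξ, u ξ * fourierLine (fun y => (θ y : ℂ)) (-ξ)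
      = ∫ ξ, v ξ * fourierLine (fun y => (θ y : ℂ)) (-ξ)) : u =ᵐ[volume] v := by
  refine hu.ae_eq hv fun θ hθ => ?_
  have hre : IsRealTest fun y => (θ y).re :=
    ⟨Complex.reCLM.contDiff.comp hθ.1, hθ.2.comp_left Complex.zero_re⟩
  have him : IsRealTest fun y => (θ y).im :=
    ⟨Complex.imCLM.contDiff.comp hθ.1, hθ.2.comp_left Complex.zero_im⟩
  have hsplit : ∀ ξ, fourierLine θ (-ξ) = fourierLine (fun y => ((θ y).re : ℂ)) (-ξ)
      + Complex.I * fourierLine (fun y => ((θ y).im : ℂ)) (-ξ) := by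
    intro ξ
    have e : θ = (fun y => ((θ y).re : ℂ)) - fun y => -Complex.I * ((θ y).im : ℂ) := by
      ext y
      simp only [Pi.sub_apply]
      rw [neg_mul, sub_neg_eq_add, mul_comm, Complex.re_add_im]
    have e2 : fourierLine (fun y => -Complex.I * ((θ y).im : ℂ)) (-ξ)
        = -Complex.I * fourierLine (fun y => ((θ y).im : ℂ)) (-ξ) := by
      simp only [fourierLine, ← integral_const_mul]
      congr 1 with y
      ring
    conv_lhs => rw [e]
    rw [fourierLine_sub hre.isTest.integrable (him.isTest.const_mul _).integrable, e2]
    ring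
  have key : ∀ {w : ℝ → ℂ}, IsTempered w → ∫ ξ, w ξ * fourierLine θ (-ξ)
      = (∫ ξ, w ξ * fourierLine (fun y => ((θ y).re : ℂ)) (-ξ))
        + Complex.I * ∫ ξ, w ξ * fourierLine (fun y => ((θ y).im : ℂ)) (-ξ) := by
    intro w hw
    rw [← integral_const_mul, ← integral_add (hw.integrable_mul_fourierLine hre.isTest)
      ((hw.integrable_mul_fourierLine him.isTest).const_mul _)]
    congr 1 with ξ
    rw [hsplit]
    ring
  rw [key hu, key hv, h _ hre, h _ him]

/-- The pairing of `f` with the product `a(x) θ(y)` over the cylinder. -/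
def sepPairing (f : ℝ → ℝ → ℝ) (a θ : ℝ → ℝ) : ℝ :=
  ∫ p : ℝ × ℝ, f p.1 p.2 * (a p.1 * θ p.2) ∂cylMeasure

lemma isPeriodicTest_cos (k : ℤ) : IsPeriodicTest fun x => Real.cos (k * x) := by
  refine ⟨by fun_prop, fun x => ?_⟩
  rw [mul_add]
  exact Real.cos_add_int_mul_two_pi _ k

lemma isPeriodicTest_sin (k : ℤ) : IsPeriodicTest fun x => Real.sin (k * x) := by
  refine ⟨by fun_prop, fun x => ?_⟩
  rw [mul_add]
  exact Real.sin_add_int_mul_two_pi _ k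

lemma IsL2.integrable_mul_prod {f : ℝ → ℝ → ℝ} (hf : IsL2 f) {a θ : ℝ → ℝ} (ha : Continuous a)
    (hθ : IsRealTest θ) :
    Integrable (fun p : ℝ × ℝ => f p.1 p.2 * (a p.1 * θ p.2)) cylMeasure :=
  hf.integrable_mul (memLp_mul_prod_cylMeasure ha hθ.smooth.continuous hθ.compact)

lemma IsL2.integral_mode_mul {f : ℝ → ℝ → ℝ} (hf : IsL2 f) (k : ℤ) {θ : ℝ → ℝ}
    (hθ : IsRealTest θ) :
    ∫ y, mode k f y * (θ y : ℂ) = (sepPairing f (fun x => Real.cos (k * x)) θ : ℂ)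
      - Complex.I * (sepPairing f (fun x => Real.sin (k * x)) θ : ℂ) := by
  have hA : Integrable (fun p : ℝ × ℝ => ((f p.1 p.2 * (Real.cos (k * p.1) * θ p.2) : ℝ) : ℂ))
      cylMeasure := (hf.integrable_mul_prod (isPeriodicTest_cos k).smooth.continuous hθ).ofReal
  have hB : Integrable (fun p : ℝ × ℝ => Complex.I
      * ((f p.1 p.2 * (Real.sin (k * p.1) * θ p.2) : ℝ) : ℂ)) cylMeasure :=
    (hf.integrable_mul_prod (isPeriodicTest_sin k).smooth.continuous hθ).ofReal.const_mul _
  have h := integral_sub hA hB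
  rw [integral_const_mul, integral_complex_ofReal, integral_complex_ofReal] at h
  have hprod := integral_prod_symm (μ := volume.restrict (Ioc 0 (2 * Real.pi))) (ν := volume) _
    (hA.sub hB)
  rw [sepPairing, sepPairing, ← h]
  refine Eq.trans ?_ hprod.symm
  congr 1 with y
  rw [mode, intervalIntegral.integral_of_le (by positivity), ← integral_mul_const]
  congr 1 with x
  rw [Pi.sub_apply]
  have e : Complex.exp (-(Complex.I * (k : ℂ) * (x : ℂ)))
      = (Real.cos (k * x) : ℂ) - Complex.I * (Real.sin (k * x) : ℂ) := by
    rw [show -(Complex.I * (k : ℂ) * (x : ℂ)) = (-((k : ℂ) * x)) * Complex.I by ring,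
      Complex.exp_mul_I, Complex.cos_neg, Complex.sin_neg]
    push_cast
    ring
  rw [e]
  push_cast
  ring

lemma HasFourierTransform.congr {f : ℝ → ℝ → ℝ} {g g' : ℤ → ℝ → ℂ} (h : HasFourierTransform f g)
    (hg : ∀ k, g k =ᵐ[volume] g' k) : HasFourierTransform f g' := by
  refine ⟨h.locallyIntegrable, fun k => IsTempered.congr (h.tempered k) (hg k),
    fun k θ hθ hθc => ?_⟩
  rw [h.pairing k θ hθ hθc]
  apply integral_congr_ae
  filter_upwards [hg k] with ξ hξ
  rw [hξ]

/-- The weak Helmholtz decomposition on the Fourier side: at almost every frequency `q` has the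
divergence of `v` and no vorticity. -/
theorem exists_helmholtz_fourier {v : ℝ → ℝ → Plane}
    (hv : MemLp (fun p : ℝ × ℝ => v p.1 p.2) 2 cylMeasure) {v0 v1 : ℤ → ℝ → ℂ}
    (hv0 : HasFourierTransform (fun x y => v x y 0) v0)
    (hv1 : HasFourierTransform (fun x y => v x y 1) v1) :
    ∃ (q : ℝ → ℝ → Plane) (q0 q1 : ℤ → ℝ → ℂ),
      MemLp (fun p : ℝ × ℝ => q p.1 p.2) 2 cylMeasure ∧
      HasFourierTransform (fun x y => q x y 0) q0 ∧ HasFourierTransform (fun x y => q x y 1) q1 ∧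
      ∀ k : ℤ, ∀ᵐ ξ : ℝ,
        Complex.I * k * q0 k ξ + Complex.I * ξ * q1 k ξ
          = Complex.I * k * v0 k ξ + Complex.I * ξ * v1 k ξ ∧
        Complex.I * ξ * q0 k ξ = Complex.I * k * q1 k ξ := by
  obtain ⟨q, hq, hweak⟩ := exists_weak_helmholtz hv
  have hcomp : ∀ {v : ℝ → ℝ → Plane}, MemLp (fun p : ℝ × ℝ => v p.1 p.2) 2 cylMeasure → ∀ i,
      IsL2 fun x y => v x y i := fun hv i =>
    (EuclideanSpace.proj (𝕜 := ℝ) i : Plane →L[ℝ] ℝ).comp_memLp' hv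
  have hQ0 := hcomp hq 0
  have hQ1 := hcomp hq 1
  have hV0 := hcomp hv 0
  have hV1 := hcomp hv 1
  have hF0 := hQ0.hasFourierTransform
  have hF1 := hQ1.hasFourierTransform
  refine ⟨q, _, _, hq, hF0, hF1, fun k => ?_⟩
  have hgrad : ∀ {w : ℝ → ℝ → Plane}, MemLp (fun p : ℝ × ℝ => w p.1 p.2) 2 cylMeasure →
      ∀ {a θ}, IsPeriodicTest a → IsRealTest θ →
      ∫ p : ℝ × ℝ, inner ℝ (gradField a θ p) (w p.1 p.2) ∂cylMeasure
        = sepPairing (fun x y => w x y 0) (deriv a) θ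
          + sepPairing (fun x y => w x y 1) a (deriv θ) := by
    intro w hw a θ ha hθ
    rw [sepPairing, sepPairing, ← integral_add
      ((hcomp hw 0).integrable_mul_prod ha.continuous_deriv hθ)
      ((hcomp hw 1).integrable_mul_prod ha.smooth.continuous hθ.deriv)]
    congr 1 with p
    rw [inner_plane]
    simp [gradField]
  have hperp : ∀ {a θ}, IsPeriodicTest a → IsRealTest θ →
      ∫ p : ℝ × ℝ, inner ℝ (perpField a θ p) (q p.1 p.2) ∂cylMeasure
        = sepPairing (fun x y => q x y 1) (deriv a) θ
          - sepPairing (fun x y => q x y 0) a (deriv θ) := by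
    intro a θ ha hθ
    rw [sepPairing, sepPairing, ← integral_sub
      (hQ1.integrable_mul_prod ha.continuous_deriv hθ)
      (hQ0.integrable_mul_prod ha.smooth.continuous hθ.deriv)]
    congr 1 with p
    rw [inner_plane]
    simp only [perpField, PiLp.toLp_apply, Matrix.cons_val_zero, Matrix.cons_val_one]
    ring
  have hcos : deriv (fun x => Real.cos (k * x)) = fun x => -k * Real.sin (k * x) := by
    ext x
    have h := (((hasDerivAt_id x).const_mul (k : ℝ)).cos).deriv
    simp only [id_eq, mul_one] at h
    rw [h]
    ring
  have hsin : deriv (fun x => Real.sin (k * x)) = fun x => k * Real.cos (k * x) := by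
    ext x
    have h := (((hasDerivAt_id x).const_mul (k : ℝ)).sin).deriv
    simp only [id_eq, mul_one] at h
    rw [h]
    ring
  have hsmul : ∀ (f : ℝ → ℝ → ℝ) (c : ℝ) (a θ : ℝ → ℝ),
      sepPairing f (fun x => c * a x) θ = c * sepPairing f a θ := by
    intro f c a θ
    rw [sepPairing, sepPairing, ← integral_const_mul]
    congr 1 with p
    ring
  have hP : ∀ {f : ℝ → ℝ → ℝ} {g : ℤ → ℝ → ℂ}, IsL2 f → HasFourierTransform f g →
      ∀ {θ}, IsRealTest θ →
      (∫ ξ, Complex.I * k * g k ξ * fourierLine (fun y => (θ y : ℂ)) (-ξ)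
        = Complex.I * k * ((sepPairing f (fun x => Real.cos (k * x)) θ : ℂ)
          - Complex.I * (sepPairing f (fun x => Real.sin (k * x)) θ : ℂ))) ∧
      ∫ ξ, Complex.I * ξ * g k ξ * fourierLine (fun y => (θ y : ℂ)) (-ξ)
        = -((sepPairing f (fun x => Real.cos (k * x)) (deriv θ) : ℂ)
          - Complex.I * (sepPairing f (fun x => Real.sin (k * x)) (deriv θ) : ℂ)) := by
    intro f g hf hg θ hθ
    rw [← hf.integral_mode_mul k hθ, ← hf.integral_mode_mul k hθ.deriv, hg.pairing' k hθ.isTest,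
      hg.pairing' k hθ.deriv.isTest, ← hθ.deriv_ofReal, ← integral_const_mul, ← integral_neg]
    simp only [hθ.isTest.fourierLine_deriv]
    constructor <;> congr 1 with ξ <;> ring
  have hint : ∀ {f : ℝ → ℝ → ℝ} {g : ℤ → ℝ → ℂ}, HasFourierTransform f g →
      ∀ {θ}, IsRealTest θ →
      Integrable (fun ξ => Complex.I * k * g k ξ * fourierLine (fun y => (θ y : ℂ)) (-ξ)) ∧
      Integrable (fun ξ => Complex.I * ξ * g k ξ * fourierLine (fun y => (θ y : ℂ)) (-ξ)) :=
    fun hg θ hθ => ⟨(IsTempered.const_mul (hg.tempered k) _).integrable_mul_fourierLine hθ.isTest,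
      (IsTempered.mul_freq (hg.tempered k)).integrable_mul_fourierLine hθ.isTest⟩
  have htemp : ∀ {f f' : ℝ → ℝ → ℝ} {g g' : ℤ → ℝ → ℂ}, HasFourierTransform f g →
      HasFourierTransform f' g' →
      IsTempered fun ξ => Complex.I * k * g k ξ + Complex.I * ξ * g' k ξ := fun hg hg' =>
    (IsTempered.const_mul (hg.tempered k) _).add (IsTempered.mul_freq (hg'.tempered k))
  have h1 := (htemp hF0 hF1).ae_eq_of_real (htemp hv0 hv1) fun θ hθ => by
    simp only [add_mul]
    rw [integral_add (hint hF0 hθ).1 (hint hF1 hθ).2, integral_add (hint hv0 hθ).1 (hint hv1 hθ).2,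
      (hP hQ0 hF0 hθ).1, (hP hQ1 hF1 hθ).2, (hP hV0 hv0 hθ).1, (hP hV1 hv1 hθ).2]
    have c := (hweak _ θ (isPeriodicTest_cos k) hθ).1
    have s := (hweak _ θ (isPeriodicTest_sin k) hθ).1
    rw [hgrad hq (isPeriodicTest_cos k) hθ, hgrad hv (isPeriodicTest_cos k) hθ, hcos, hsmul,
      hsmul] at c
    rw [hgrad hq (isPeriodicTest_sin k) hθ, hgrad hv (isPeriodicTest_sin k) hθ, hsin, hsmul,
      hsmul] at s
    have c' := congrArg (fun r : ℝ => (r : ℂ)) c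
    have s' := congrArg (fun r : ℝ => (r : ℂ)) s
    push_cast at c' s'
    linear_combination -c' + Complex.I * s' - k * (sepPairing (fun x y => q x y 0)
      (fun x => Real.sin (k * x)) θ - sepPairing (fun x y => v x y 0)
      (fun x => Real.sin (k * x)) θ) * Complex.I_sq
  have h2 := (IsTempered.mul_freq (hF0.tempered k)).ae_eq_of_real
    (IsTempered.const_mul (hF1.tempered k) (Complex.I * k)) fun θ hθ => by
    rw [(hP hQ0 hF0 hθ).2, (hP hQ1 hF1 hθ).1]
    have c := (hweak _ θ (isPeriodicTest_cos k) hθ).2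
    have s := (hweak _ θ (isPeriodicTest_sin k) hθ).2
    rw [hperp (isPeriodicTest_cos k) hθ, hcos, hsmul] at c
    rw [hperp (isPeriodicTest_sin k) hθ, hsin, hsmul] at s
    have c' := congrArg (fun r : ℝ => (r : ℂ)) c
    have s' := congrArg (fun r : ℝ => (r : ℂ)) s
    push_cast at c' s'
    linear_combination c' - Complex.I * s' + k * sepPairing (fun x y => q x y 1)
      (fun x => Real.sin (k * x)) θ * Complex.I_sq
  filter_upwards [h1, h2] with ξ e1 e2 using ⟨e1, e2⟩

lemma hasFourierTransform_divergence {v : ℝ → ℝ → Plane} {v0 v1 : ℤ → ℝ → ℂ}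
    (p0 : IsSmoothPeriodic fun x y => v x y 0) (p1 : IsSmoothPeriodic fun x y => v x y 1)
    (hv0 : HasFourierTransform (fun x y => v x y 0) v0)
    (hv1 : HasFourierTransform (fun x y => v x y 1) v1) :
    HasFourierTransform (divergence v) fun k ξ => Complex.I * k * v0 k ξ + Complex.I * ξ * v1 k ξ :=
  HasFourierTransform.add p0.deriv_fst p1.deriv_snd (p0.hasFourierTransform_deriv_fst hv0)
    (p1.hasFourierTransform_deriv_snd hv1)

lemma hasFourierTransform_vorticity {v : ℝ → ℝ → Plane} {v0 v1 : ℤ → ℝ → ℂ}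
    (p0 : IsSmoothPeriodic fun x y => v x y 0) (p1 : IsSmoothPeriodic fun x y => v x y 1)
    (hv0 : HasFourierTransform (fun x y => v x y 0) v0)
    (hv1 : HasFourierTransform (fun x y => v x y 1) v1) :
    HasFourierTransform (vorticity v)
      fun k ξ => -(Complex.I * ξ * v0 k ξ) + Complex.I * k * v1 k ξ :=
  HasFourierTransform.add p0.deriv_snd.neg p1.deriv_fst
    ((p0.hasFourierTransform_deriv_snd hv0).neg p0.deriv_snd)
    (p1.hasFourierTransform_deriv_fst hv1)

/-- Smooth square integrable fields have a potential part, so that the choice in `potentialPart` is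
a genuine one. Divergence and vorticity determine `q̂` wherever `(k, ξ) ≠ 0`. -/
theorem isPotentialPart_potentialPart {v : ℝ → ℝ → Plane}
    (hv : MemLp (fun p : ℝ × ℝ => v p.1 p.2) 2 cylMeasure)
    (p0 : IsSmoothPeriodic fun x y => v x y 0) (p1 : IsSmoothPeriodic fun x y => v x y 1)
    {v0 v1 : ℤ → ℝ → ℂ} (hv0 : HasFourierTransform (fun x y => v x y 0) v0)
    (hv1 : HasFourierTransform (fun x y => v x y 1) v1) :
    IsPotentialPart v (potentialPart v) := by
  obtain ⟨q, q0, q1, hq, hq0, hq1, h⟩ := exists_helmholtz_fourier hv hv0 hv1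
  have hdiv := fourierTransform_ae_eq (hasFourierTransform_divergence p0 p1 hv0 hv1)
  -- excludes `(k, ξ) = 0`
  have hne : ∀ᵐ ξ : ℝ, ξ ≠ 0 := by
    rw [ae_iff]
    simp
  have hsol : ∀ k : ℤ, ∀ᵐ ξ : ℝ,
      q0 k ξ = Complex.I * (k : ℂ) * (-((k : ℂ) ^ 2 + (ξ : ℂ) ^ 2))⁻¹
        * fourierTransform (divergence v) k ξ ∧
      q1 k ξ = Complex.I * (ξ : ℂ) * (-((k : ℂ) ^ 2 + (ξ : ℂ) ^ 2))⁻¹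
        * fourierTransform (divergence v) k ξ := by
    intro k
    filter_upwards [h k, hdiv k, hne] with ξ h1 h2 h3
    have hpos : (0 : ℝ) < (k : ℝ) ^ 2 + ξ ^ 2 := by positivity
    have hc : -((k : ℂ) ^ 2 + (ξ : ℂ) ^ 2) ≠ 0 := by
      rw [neg_ne_zero]
      exact_mod_cast hpos.ne'
    rw [h2, ← h1.1]
    have h4 := h1.2
    refine ⟨mul_left_cancel₀ hc ?_, mul_left_cancel₀ hc ?_⟩
    · rw [mul_comm (Complex.I * (k : ℂ)), mul_assoc, mul_inv_cancel_left₀ hc]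
      linear_combination (Complex.I * ξ) * h4 - (k ^ 2 + ξ ^ 2) * q0 k ξ * Complex.I_sq
    · rw [mul_comm (Complex.I * (ξ : ℂ)), mul_assoc, mul_inv_cancel_left₀ hc]
      linear_combination -(Complex.I * k) * h4 - (k ^ 2 + ξ ^ 2) * q1 k ξ * Complex.I_sq
  exact Classical.epsilon_spec (p := IsPotentialPart v) ⟨q, hq,
    hq0.congr fun k => (hsol k).mono fun ξ h => h.1,
    hq1.congr fun k => (hsol k).mono fun ξ h => h.2⟩

/-- Bessel's inequality for the potential part. -/
theorem IsPotentialPart.tsum_lintegral_le {v q : ℝ → ℝ → Plane} (h : IsPotentialPart v q) :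
    ∑' k : ℤ, ∫⁻ ξ : ℝ, ENNReal.ofReal ((k : ℝ) ^ 2 + ξ ^ 2)⁻¹
      * ‖fourierTransform (divergence v) k ξ‖ₑ ^ 2 ≤ L2norm q ^ 2 := by
  have hcomp : ∀ i, IsL2 fun x y => q x y i := fun i =>
    (EuclideanSpace.proj (𝕜 := ℝ) i : Plane →L[ℝ] ℝ).comp_memLp' h.memLp
  have hsplit : L2norm q ^ 2 = L2norm (fun x y => q x y 0) ^ 2 + L2norm (fun x y => q x y 1) ^ 2 := by
    simp only [L2norm, eLpNorm_two_sq]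
    rw [← lintegral_add_left' ((hcomp 0).aestronglyMeasurable.enorm.pow_const 2)]
    congr 1 with p
    have hp := EuclideanSpace.norm_sq_eq (q p.1 p.2)
    rw [Fin.sum_univ_two] at hp
    rw [← ofReal_norm, ← ofReal_norm, ← ofReal_norm, ← ENNReal.ofReal_pow (norm_nonneg _), hp,
      ENNReal.ofReal_add (by positivity) (by positivity), ENNReal.ofReal_pow (norm_nonneg _),
      ENNReal.ofReal_pow (norm_nonneg _)]
  rw [hsplit]
  refine le_trans (le_of_eq ?_) (add_le_add (h.fst.tsum_lintegral_le (hcomp 0))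
    (h.snd.tsum_lintegral_le (hcomp 1)))
  rw [← ENNReal.tsum_add]
  congr 1 with k
  rw [← lintegral_add_left' ((IsTempered.aestronglyMeasurable (h.fst.tempered k)).enorm.pow_const 2)]
  congr 1 with ξ
  have hr : ‖(-((k : ℂ) ^ 2 + (ξ : ℂ) ^ 2))⁻¹‖ = ((k : ℝ) ^ 2 + ξ ^ 2)⁻¹ := by
    rw [norm_inv, norm_neg, show (k : ℂ) ^ 2 + (ξ : ℂ) ^ 2 = (((k : ℝ) ^ 2 + ξ ^ 2 : ℝ) : ℂ) by
      push_cast; ring, Complex.norm_real, Real.norm_of_nonneg (by positivity)]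
  have e : ∀ z : ℂ, ‖z‖ₑ ^ 2 = ENNReal.ofReal (‖z‖ ^ 2) := fun z => by
    rw [ENNReal.ofReal_pow (norm_nonneg _), ofReal_norm]
  rw [e, e, e, ← ENNReal.ofReal_mul (by positivity), ← ENNReal.ofReal_add (by positivity)
    (by positivity)]
  congr 1
  simp only [norm_mul, Complex.norm_I, one_mul, hr, Complex.norm_intCast, Complex.norm_real,
    Real.norm_eq_abs, mul_pow, sq_abs]
  rcases eq_or_ne ((k : ℝ) ^ 2 + ξ ^ 2) 0 with h0 | h0
  -- at `(k, ξ) = 0` both sides vanish by the convention `0⁻¹ = 0`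
  · simp [h0]
  · field_simp

/-! ### The lower bound -/

lemma one_le_bracket (a : ℝ) : 1 ≤ bracket a :=
  Real.one_le_sqrt.2 (by nlinarith [sq_nonneg a])

lemma bracket_pos (a : ℝ) : 0 < bracket a := one_pos.trans_le (one_le_bracket a)

lemma bracket_sq (a : ℝ) : bracket a ^ 2 = 1 + a ^ 2 := Real.sq_sqrt (by positivity)

/-- The source of the growth: as `α ≥ 1 + (t - ξ/k)²` and `|ξ/k| ≤ |ξ|`, Peetre's inequality gives
`⟨t⟩ ≲ ⟨ξ⟩ α^{1/2}`, so large times are paid for by a weight in the frequency. -/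
lemma bracket_le_mul_alpha {k : ℤ} (hk : k ≠ 0) (ξ t : ℝ) :
    bracket t ≤ 2 * (bracket ξ * √(alpha k ξ t)) := by
  have hα := alpha_pos hk ξ t
  have h1 := one_le_sq_intCast hk
  refine (pow_le_pow_iff_left₀ (bracket_pos t).le (by have := bracket_pos ξ; positivity)
    two_ne_zero).1 ?_
  rw [mul_pow, mul_pow, bracket_sq, bracket_sq, Real.sq_sqrt hα.le]
  set b : ℝ := ξ / k with hb
  have hξ : b ^ 2 ≤ ξ ^ 2 := by
    rw [hb, div_pow]
    exact div_le_self (sq_nonneg _) h1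
  have ha : 1 + (t - b) ^ 2 ≤ alpha k ξ t := by
    rw [alpha_eq hk]
    nlinarith [sq_nonneg (t - b)]
  have h2 : (1 + b ^ 2) * (1 + (t - b) ^ 2) ≤ (1 + ξ ^ 2) * alpha k ξ t := by gcongr
  nlinarith [sq_nonneg (t - 2 * b), sq_nonneg (b * (t - b)), sq_nonneg t]

lemma anisotropicNorm_sq {E : Type*} [NormedAddCommGroup E] (r s : ℝ) (g : ℤ → ℝ → E) :
    anisotropicNorm r s g ^ 2 = ∑' k : ℤ, ∫⁻ ξ : ℝ,
      ENNReal.ofReal (bracket (k : ℝ) ^ (2 * r) * bracket ξ ^ (2 * s)) * ‖g k ξ‖ₑ ^ 2 := by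
  rw [anisotropicNorm, ← ENNReal.rpow_natCast, ← ENNReal.rpow_mul]
  norm_num

lemma alpha_zero (k : ℤ) (ξ : ℝ) : alpha k ξ 0 = (k : ℝ) ^ 2 + ξ ^ 2 := by
  simp [alpha]

lemma Rvector_apply (P : Parameters) (ηin ψin ωin : ℝ → ℝ → ℝ) (t : ℝ) (k : ℤ) (ξ : ℝ)
    (i : Fin 2) :
    Rvector P ηin ψin ωin t k ξ i
      = symmetrized P k ξ 0 (fourierTransform ηin k ξ) (fourierTransform ψin k ξ) i
        + (∫ s in (0 : ℝ)..t, ((solutionOperator P k ξ 0 s).mulVec (Mvector k ξ s) i : ℂ))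
          * (fourierTransform ηin k ξ + fourierTransform ωin k ξ) := by
  simp only [Rvector, Ain, symmetrized, alpha_zero, intervalIntegral.integral_mul_const]

/-- The total forcing is bounded, uniformly in time and frequency: up to a constant it is the
increment of the phase `arctan (t - ξ/k)`. -/
lemma exists_norm_integral_forcing_le (P : Parameters) :
    ∃ D : ℝ, 0 < D ∧ ∀ (k : ℤ) (_ : k ≠ 0) (ξ t : ℝ) (_ : 0 ≤ t) (i : Fin 2),
      ‖∫ s in (0 : ℝ)..t, ((solutionOperator P k ξ 0 s).mulVec (Mvector k ξ s) i : ℂ)‖ ≤ D := by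
  obtain ⟨C, hC, hS⟩ := exists_abs_solutionOperator_le P
  refine ⟨C * (2 * Real.pi), by positivity, fun k hk ξ t ht i => ?_⟩
  have hcont : Continuous fun s => C * (2 * ((k : ℝ) ^ 2 / alpha k ξ s)) := by
    refine continuous_const.mul (continuous_const.mul (continuous_const.div (continuous_alpha k ξ)
      fun s => (alpha_pos hk ξ s).ne'))
  have h1 := intervalIntegral.norm_integral_le_of_norm_le (μ := volume) (a := 0) (b := t)
    (f := fun s => ((solutionOperator P k ξ 0 s).mulVec (Mvector k ξ s) i : ℂ)) ht
    (.of_forall fun s _ => ?_) (hcont.intervalIntegrable 0 t)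
  · refine h1.trans ?_
    rw [intervalIntegral.integral_const_mul, intervalIntegral.integral_const_mul,
      intervalIntegral.integral_eq_sub_of_hasDerivAt
        (fun s _ => hasDerivAt_arctan_phase hk ξ s)
        ((continuous_const.div (continuous_alpha k ξ)
          fun s => (alpha_pos hk ξ s).ne').intervalIntegrable 0 t)]
    have h2 := Real.arctan_lt_pi_div_two (t - ξ / k)
    have h3 := Real.neg_pi_div_two_lt_arctan (0 - ξ / k)
    gcongr
    linarith
  · rw [Complex.norm_real, mulVec_Mvector, norm_mul]
    exact mul_le_mul (hS k hk ξ s 0 i 1) (abs_Mvector_one_le hk ξ s) (norm_nonneg _) hC.le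

/-- The symmetrized unknowns measure the energy density, up to the factor `α^{-1/2}`. -/
lemma norm_symmetrized_sq (P : Parameters) {k : ℤ} (hk : k ≠ 0) (ξ t : ℝ) (N Ψ : ℂ) :
    ∑ j, ‖symmetrized P k ξ t N Ψ j‖ ^ 2
      = (√(alpha k ξ t))⁻¹
        * (P.TPlus / P.mPlus * ‖N‖ ^ 2 + (alpha k ξ t)⁻¹ * ‖Ψ‖ ^ 2) := by
  have hα := alpha_pos hk ξ t
  have hT : 0 < P.TPlus / P.mPlus := div_pos P.TPlus_pos P.mPlus_pos
  -- all powers of `α` that occur are integer powers of `a`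
  set a : ℝ := alpha k ξ t ^ (1 / 4 : ℝ) with ha
  have ha0 : 0 < a := Real.rpow_pos_of_pos hα _
  have h4 : alpha k ξ t = a ^ 4 := by
    rw [ha, ← Real.rpow_natCast, ← Real.rpow_mul hα.le]; norm_num
  have h3 : alpha k ξ t ^ (3 / 4 : ℝ) = a ^ 3 := by
    rw [ha, ← Real.rpow_natCast, ← Real.rpow_mul hα.le]; norm_num
  have h2 : √(alpha k ξ t) = a ^ 2 := by
    rw [h4, show a ^ 4 = (a ^ 2) ^ 2 by ring, Real.sqrt_sq (by positivity)]
  rw [Fin.sum_univ_two]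
  simp only [symmetrized, Matrix.cons_val_zero, Matrix.cons_val_one, norm_mul, Complex.norm_real,
    Real.norm_eq_abs, mul_pow, sq_abs, div_pow, Real.sq_sqrt hT.le, ← ha]
  rw [h3, h2, h4]
  field_simp

/-- The transform of the divergence is determined by those of the components. -/
lemma IsSmoothField.fourierTransform_divergence_ae_eq {u : ℝ → ℝ → ℝ → Plane}
    (hu : IsSmoothField u) {t : ℝ} (ht : 0 ≤ t) (k : ℤ) :
    fourierTransform (divergence (u t)) k =ᵐ[volume] fun ξ =>
      Complex.I * k * fourierTransform (fun x y => u t x y 0) k ξ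
        + Complex.I * ξ * fourierTransform (fun x y => u t x y 1) k ξ :=
  fourierTransform_ae_eq (hasFourierTransform_divergence
    ((hu.component 0).isSmoothPeriodic ht) ((hu.component 1).isSmoothPeriodic ht)
    (IsL2.hasFourierTransform ((hu.component 0).memLp ht))
    (IsL2.hasFourierTransform ((hu.component 1).memLp ht))) k

lemma IsSmoothField.fourierTransform_vorticity_ae_eq {u : ℝ → ℝ → ℝ → Plane}
    (hu : IsSmoothField u) {t : ℝ} (ht : 0 ≤ t) (k : ℤ) :
    fourierTransform (vorticity (u t)) k =ᵐ[volume] fun ξ =>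
      -(Complex.I * ξ * fourierTransform (fun x y => u t x y 0) k ξ)
        + Complex.I * k * fourierTransform (fun x y => u t x y 1) k ξ :=
  fourierTransform_ae_eq (hasFourierTransform_vorticity
    ((hu.component 0).isSmoothPeriodic ht) ((hu.component 1).isSmoothPeriodic ht)
    (IsL2.hasFourierTransform ((hu.component 0).memLp ht))
    (IsL2.hasFourierTransform ((hu.component 1).memLp ht))) k

/-- The density of `(T₊/m₊) ‖f‖² + ‖∇Δ⁻¹ g‖²` in frequency. -/
def energyDensity (P : Parameters) (f g : ℝ → ℝ → ℝ) (k : ℤ) (ξ : ℝ) : ℝ≥0∞ :=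
  ENNReal.ofReal (P.TPlus / P.mPlus) * ‖fourierTransform f k ξ‖ₑ ^ 2
    + ENNReal.ofReal ((k : ℝ) ^ 2 + ξ ^ 2)⁻¹ * ‖fourierTransform g k ξ‖ₑ ^ 2

lemma enorm_sq_eq {E : Type*} [NormedAddCommGroup E] (z : E) :
    ‖z‖ₑ ^ 2 = ENNReal.ofReal (‖z‖ ^ 2) := by
  rw [ENNReal.ofReal_pow (norm_nonneg _), ofReal_norm]

/-- The lower bound at a fixed nonzero frequency in `x`. -/
theorem exists_lintegral_Rvector_le (P : Parameters) :
    ∃ C : ℝ, 0 < C ∧ ∀ (η : ℝ → ℝ → ℝ → ℝ) (u : ℝ → ℝ → ℝ → Plane) (φ : ℝ → ℝ → ℝ → ℝ),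
      IsSmoothSolution P η u φ → ∀ (k : ℤ) (_ : k ≠ 0) (t : ℝ) (_ : 0 ≤ t),
      ∫⁻ ξ : ℝ, ENNReal.ofReal (bracket (k : ℝ) ^ (2 * (0 : ℝ)) * bracket ξ ^ (2 * (-1 / 2 : ℝ)))
          * ‖Rvector P (η 0) (divergence (u 0)) (vorticity (u 0)) t k ξ‖ₑ ^ 2
        ≤ ENNReal.ofReal (C / bracket t)
          * ∫⁻ ξ : ℝ, energyDensity P (η t) (divergence (u t)) k ξ := by
  obtain ⟨C, hC, h⟩ := exists_ae_norm_data_add_forcing_le P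
  have hT : 0 < P.TPlus / P.mPlus := div_pos P.TPlus_pos P.mPlus_pos
  refine ⟨8 * C ^ 2, by positivity, fun η u φ hs k hk t ht => ?_⟩
  have hu := hs.velocity_field
  -- the solution at time `t` enters at the frequency `ξ - k t`; translation in `ξ` is harmless
  rw [← lintegral_sub_right_eq_self (fun ξ => energyDensity P (η t) (divergence (u t)) k ξ)
    ((k : ℝ) * t), ← lintegral_const_mul' _ _ ENNReal.ofReal_ne_top]
  apply lintegral_mono_ae
  have hshift := (measurePreserving_sub_right (volume : Measure ℝ)
    ((k : ℝ) * t)).quasiMeasurePreserving.ae (hu.fourierTransform_divergence_ae_eq ht k)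
  filter_upwards [h η u φ hs k hk t ht, hu.fourierTransform_divergence_ae_eq le_rfl k,
    hu.fourierTransform_vorticity_ae_eq le_rfl k, hshift] with ξ h1 h2 h3 h4
  have hα := alpha_pos hk ξ t
  set G : ℝ := P.TPlus / P.mPlus * ‖fourierTransform (η t) k (ξ - k * t)‖ ^ 2
    + (alpha k ξ t)⁻¹ * ‖fourierTransform (divergence (u t)) k (ξ - k * t)‖ ^ 2 with hG
  have hG0 : 0 ≤ G := by positivity
  have hGe : energyDensity P (η t) (divergence (u t)) k (ξ - k * t) = ENNReal.ofReal G := by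
    rw [energyDensity, hG, enorm_sq_eq, enorm_sq_eq, ← ENNReal.ofReal_mul hT.le,
      ← ENNReal.ofReal_mul (by positivity), ← ENNReal.ofReal_add (by positivity) (by positivity)]
    rfl
  set R := Rvector P (η 0) (divergence (u 0)) (vorticity (u 0)) t k ξ with hR
  have hRi : ∀ i, ‖R i‖ ≤ C * ∑ j, ‖symmetrized P k ξ t (fourierTransform (η t) k (ξ - k * t))
      (fourierTransform (divergence (u t)) k (ξ - k * t)) j‖ := by
    intro i
    have e := h1 i
    rw [hR, Rvector_apply, h2, h3, h4]
    push_cast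
    rw [show ∀ a b c : ℂ, a + (-b + c) = a - b + c from fun a b c => by ring]
    exact e
  -- `2 C² (p + q)² ≤ 4 C² (p² + q²)` for the two components `p, q`
  have hRsq : ‖R‖ ^ 2 ≤ 4 * C ^ 2 * ((√(alpha k ξ t))⁻¹ * G) := by
    rw [EuclideanSpace.norm_sq_eq, hG, ← norm_symmetrized_sq P hk, Fin.sum_univ_two,
      Fin.sum_univ_two]
    have e0 := pow_le_pow_left₀ (norm_nonneg _) (hRi 0) 2
    have e1 := pow_le_pow_left₀ (norm_nonneg _) (hRi 1) 2
    rw [Fin.sum_univ_two, mul_pow] at e0 e1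
    refine (add_le_add e0 e1).trans ?_
    rw [← mul_add, show 4 * C ^ 2 = C ^ 2 * 4 by ring, mul_assoc]
    gcongr
    set p := ‖symmetrized P k ξ t (fourierTransform (η t) k (ξ - k * t))
      (fourierTransform (divergence (u t)) k (ξ - k * t)) 0‖
    set q := ‖symmetrized P k ξ t (fourierTransform (η t) k (ξ - k * t))
      (fourierTransform (divergence (u t)) k (ξ - k * t)) 1‖
    nlinarith [sq_nonneg (p - q)]
  rw [hGe, enorm_sq_eq, ← ENNReal.ofReal_mul
      (by have := bracket_pos ξ; have := bracket_pos (k : ℝ); positivity),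
    ← ENNReal.ofReal_mul (by have := bracket_pos t; positivity)]
  apply ENNReal.ofReal_le_ofReal
  have hb := bracket_pos ξ
  have ht' := bracket_pos t
  have hsα : 0 < √(alpha k ξ t) := Real.sqrt_pos.2 hα
  rw [mul_zero, Real.rpow_zero, one_mul, show 2 * (-1 / 2 : ℝ) = -1 by norm_num,
    Real.rpow_neg_one]
  calc (bracket ξ)⁻¹ * ‖R‖ ^ 2 ≤ (bracket ξ)⁻¹ * (4 * C ^ 2 * ((√(alpha k ξ t))⁻¹ * G)) := by
        gcongr
    _ = 4 * C ^ 2 * (bracket ξ * √(alpha k ξ t))⁻¹ * G := by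
        rw [mul_inv]; ring
    _ ≤ 4 * C ^ 2 * (bracket t / 2)⁻¹ * G := by
        gcongr
        linarith [bracket_le_mul_alpha hk ξ t]
    _ = 8 * C ^ 2 / bracket t * G := by
        field_simp
        ring

/-- The total energy density is bounded by the `L²` norms. -/
lemma IsSmoothSolution.tsum_lintegral_energyDensity_le {P : Parameters} {η φ : ℝ → ℝ → ℝ → ℝ}
    {u : ℝ → ℝ → ℝ → Plane} (hs : IsSmoothSolution P η u φ) {t : ℝ} (ht : 0 ≤ t) :
    ∑' k : ℤ, ∫⁻ ξ : ℝ, energyDensity P (η t) (divergence (u t)) k ξ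
      ≤ (L2norm (potentialPart (u t))
        + ENNReal.ofReal √(P.TPlus / P.mPlus) * L2norm (η t)) ^ 2 := by
  have hT : 0 < P.TPlus / P.mPlus := div_pos P.TPlus_pos P.mPlus_pos
  have hη : IsL2 (η t) := hs.density_field.memLp ht
  have hu := hs.velocity_field
  have hq := isPotentialPart_potentialPart (hu.memLp ht) ((hu.component 0).isSmoothPeriodic ht)
    ((hu.component 1).isSmoothPeriodic ht)
    (IsL2.hasFourierTransform ((hu.component 0).memLp ht))
    (IsL2.hasFourierTransform ((hu.component 1).memLp ht))
  have e : ∀ k : ℤ, ∫⁻ ξ : ℝ, energyDensity P (η t) (divergence (u t)) k ξ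
      = ENNReal.ofReal (P.TPlus / P.mPlus) * (∫⁻ ξ, ‖fourierTransform (η t) k ξ‖ₑ ^ 2)
        + ∫⁻ ξ : ℝ, ENNReal.ofReal ((k : ℝ) ^ 2 + ξ ^ 2)⁻¹
          * ‖fourierTransform (divergence (u t)) k ξ‖ₑ ^ 2 := by
    intro k
    simp only [energyDensity]
    rw [lintegral_add_left' (((hη.memLp_fourierTransform
      k).aestronglyMeasurable.enorm.pow_const 2).const_mul _),
      lintegral_const_mul' _ _ ENNReal.ofReal_ne_top]
  simp only [e]
  rw [ENNReal.tsum_add, ENNReal.tsum_mul_left]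
  have hsq : ENNReal.ofReal (P.TPlus / P.mPlus) = ENNReal.ofReal √(P.TPlus / P.mPlus) ^ 2 := by
    rw [← ENNReal.ofReal_pow (Real.sqrt_nonneg _), Real.sq_sqrt hT.le]
  calc _ ≤ ENNReal.ofReal (P.TPlus / P.mPlus) * L2norm (η t) ^ 2
        + L2norm (potentialPart (u t)) ^ 2 := by
        gcongr
        · exact hη.hasFourierTransform.tsum_lintegral_le hη
        · exact hq.tsum_lintegral_le
    _ ≤ _ := by
        rw [hsq, add_comm, add_sq, ← mul_pow]
        gcongr
        exact le_self_add

/-- For data with zero average the functional has no contribution from `k = 0`, where the solution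
operator carries no information. -/
lemma Rvector_zero_ae {P : Parameters} {ηin ψin ωin : ℝ → ℝ → ℝ} {gη gψ gω : ℤ → ℝ → ℂ}
    (hη : HasFourierTransform ηin gη) (hψ : HasFourierTransform ψin gψ)
    (hω : HasFourierTransform ωin gω) (hη0 : HasZeroAverage ηin) (hψ0 : HasZeroAverage ψin)
    (hω0 : HasZeroAverage ωin) (t : ℝ) :
    ∀ᵐ ξ : ℝ, Rvector P ηin ψin ωin t 0 ξ = 0 := by
  filter_upwards [(hasFourierTransform_fourierTransform hη).ae_eq_zero_of_zeroAverage hη0,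
    (hasFourierTransform_fourierTransform hψ).ae_eq_zero_of_zeroAverage hψ0,
    (hasFourierTransform_fourierTransform hω).ae_eq_zero_of_zeroAverage hω0] with ξ h1 h2 h3
  ext i
  rw [Rvector_apply, h1, h2, h3]
  revert i
  rw [Fin.forall_fin_two]
  simp [symmetrized]

/-- The lower bound for the solution by the functional of the data. -/
theorem exists_Cin_le (P : Parameters) :
    ∃ c : ℝ, 0 < c ∧ ∀ (η : ℝ → ℝ → ℝ → ℝ) (u : ℝ → ℝ → ℝ → Plane) (φ : ℝ → ℝ → ℝ → ℝ),
      IsSmoothSolution P η u φ → HasZeroAverage (η 0) → HasZeroAverage (divergence (u 0)) →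
      HasZeroAverage (vorticity (u 0)) → ∀ t : ℝ, 0 ≤ t →
      ENNReal.ofReal (c * bracket t ^ (1 / 2 : ℝ))
          * Cin P (η 0) (divergence (u 0)) (vorticity (u 0)) t
        ≤ L2norm (potentialPart (u t)) + ENNReal.ofReal √(P.TPlus / P.mPlus) * L2norm (η t) := by
  obtain ⟨C, hC, h⟩ := exists_lintegral_Rvector_le P
  refine ⟨(√C)⁻¹, by positivity, fun η u φ hs hη0 hψ0 hω0 t ht => ?_⟩
  have hu := hs.velocity_field
  have p0 := (hu.component 0).isSmoothPeriodic le_rfl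
  have p1 := (hu.component 1).isSmoothPeriodic le_rfl
  have f0 := IsL2.hasFourierTransform (f := fun x y => u 0 x y 0) ((hu.component 0).memLp le_rfl)
  have f1 := IsL2.hasFourierTransform (f := fun x y => u 0 x y 1) ((hu.component 1).memLp le_rfl)
  have hR0 := Rvector_zero_ae (P := P)
    (IsL2.hasFourierTransform (hs.density_field.memLp le_rfl))
    (hasFourierTransform_divergence p0 p1 f0 f1) (hasFourierTransform_vorticity p0 p1 f0 f1)
    hη0 hψ0 hω0 t
  have hbt := bracket_pos t
  have hsq : Cin P (η 0) (divergence (u 0)) (vorticity (u 0)) t ^ 2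
      ≤ ENNReal.ofReal (C / bracket t) * (L2norm (potentialPart (u t))
        + ENNReal.ofReal √(P.TPlus / P.mPlus) * L2norm (η t)) ^ 2 := by
    rw [Cin, anisotropicNorm_sq]
    refine le_trans ?_ (mul_le_mul' le_rfl (hs.tsum_lintegral_energyDensity_le ht))
    rw [← ENNReal.tsum_mul_left]
    refine ENNReal.tsum_le_tsum fun k => ?_
    rcases eq_or_ne k 0 with rfl | hk
    · refine le_of_eq_of_le (lintegral_eq_zero_of_ae_eq_zero ?_) bot_le
      filter_upwards [hR0] with ξ hξ
      rw [hξ]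
      simp
    · exact h η u φ hs k hk t ht
  refine (ENNReal.pow_le_pow_left_iff two_ne_zero).1 ?_
  rw [mul_pow]
  refine (mul_le_mul' le_rfl hsq).trans ?_
  rw [← mul_assoc, ← ENNReal.ofReal_pow (by positivity), ← ENNReal.ofReal_mul (by positivity)]
  have e : ((√C)⁻¹ * bracket t ^ (1 / 2 : ℝ)) ^ 2 * (C / bracket t) = 1 := by
    rw [mul_pow, inv_pow, Real.sq_sqrt hC.le, ← Real.sqrt_eq_rpow, Real.sq_sqrt hbt.le]
    field_simp
  rw [e, ENNReal.ofReal_one, one_mul]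

/-- The functional of the data controls the divergence: the second component of `ℛ` is
`ψ̂ / (k² + ξ²)^{3/4}` up to a bounded multiple of `η̂ + ω̂`, and `k² + ξ² ≤ ⟨k⟩² ⟨ξ⟩²` turns the
weight `⟨ξ⟩^{-1}` into `⟨k⟩^{-3} ⟨ξ⟩^{-4}`. -/
theorem exists_sobolevNorm_le (P : Parameters) :
    ∃ K : ℝ, 0 < K ∧ ∀ (ηin ψin ωin : ℝ → ℝ → ℝ), (∃ g, HasFourierTransform ηin g) →
      (∃ g, HasFourierTransform ψin g) → (∃ g, HasFourierTransform ωin g) →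
      HasZeroAverage ψin → ∀ t : ℝ, 0 ≤ t →
      sobolevNorm (-3 / 2) (-2) ψin ≤ ENNReal.ofReal K * (Cin P ηin ψin ωin t
        + sobolevNorm 0 (-1 / 2) ηin + sobolevNorm 0 (-1 / 2) ωin) := by
  obtain ⟨D, hD, hF⟩ := exists_norm_integral_forcing_le P
  refine ⟨2 * (1 + D), by positivity, ?_⟩
  rintro ηin ψin ωin ⟨gη, hη⟩ ⟨gψ, hψ⟩ ⟨gω, hω⟩ hψ0 t ht
  have mη := fun k => IsTempered.aestronglyMeasurable
    ((hasFourierTransform_fourierTransform hη).tempered k)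
  have mω := fun k => IsTempered.aestronglyMeasurable
    ((hasFourierTransform_fourierTransform hω).tempered k)
  have hψz := (hasFourierTransform_fourierTransform hψ).ae_eq_zero_of_zeroAverage hψ0
  let W : ℤ → ℝ → ℝ≥0∞ := fun k ξ =>
    ENNReal.ofReal (bracket (k : ℝ) ^ (2 * (0 : ℝ)) * bracket ξ ^ (2 * (-1 / 2 : ℝ)))
  have hWm : ∀ k, Measurable (W k) := fun k => by
    have hc : Continuous fun ξ => bracket (k : ℝ) ^ (2 * (0 : ℝ)) * bracket ξ ^ (2 * (-1 / 2 : ℝ)) :=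
      continuous_const.mul (Continuous.rpow_const (by unfold bracket; fun_prop)
        fun ξ => Or.inl (bracket_pos ξ).ne')
    exact (ENNReal.continuous_ofReal.comp hc).measurable
  have key : ∀ (k : ℤ), ∀ᵐ ξ : ℝ, ENNReal.ofReal (bracket (k : ℝ) ^ (2 * (-3 / 2 : ℝ))
        * bracket ξ ^ (2 * (-2 : ℝ))) * ‖fourierTransform ψin k ξ‖ₑ ^ 2
      ≤ ENNReal.ofReal (3 * (1 + D) ^ 2) * (W k ξ * ‖Rvector P ηin ψin ωin t k ξ‖ₑ ^ 2
        + W k ξ * ‖fourierTransform ηin k ξ‖ₑ ^ 2 + W k ξ * ‖fourierTransform ωin k ξ‖ₑ ^ 2) := by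
    intro k
    rcases eq_or_ne k 0 with rfl | hk
    · filter_upwards [hψz] with ξ hξ
      rw [hξ]
      simp
    refine .of_forall fun ξ => ?_
    have hb := bracket_pos ξ
    have hbk := bracket_pos (k : ℝ)
    simp only [W, enorm_sq_eq]
    rw [← ENNReal.ofReal_mul (by positivity), ← ENNReal.ofReal_mul (by positivity),
      ← ENNReal.ofReal_mul (by positivity), ← ENNReal.ofReal_mul (by positivity),
      ← ENNReal.ofReal_add (by positivity) (by positivity),
      ← ENNReal.ofReal_add (by positivity) (by positivity), ← ENNReal.ofReal_mul (by positivity)]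
    apply ENNReal.ofReal_le_ofReal
    rw [mul_zero, Real.rpow_zero, one_mul, show 2 * (-1 / 2 : ℝ) = -1 by norm_num,
      Real.rpow_neg_one, show 2 * (-3 / 2 : ℝ) = -(3 : ℕ) by norm_num,
      show 2 * (-2 : ℝ) = -(4 : ℕ) by norm_num, Real.rpow_neg hbk.le, Real.rpow_neg hb.le,
      Real.rpow_natCast, Real.rpow_natCast, ← mul_add, ← mul_add]
    set r : ℝ := √((k : ℝ) ^ 2 + ξ ^ 2) with hr
    have hα := alpha_pos hk ξ 0
    rw [alpha_zero] at hα
    have hr0 : 0 < r := Real.sqrt_pos.2 hα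
    have hr2 : r ^ 2 = (k : ℝ) ^ 2 + ξ ^ 2 := Real.sq_sqrt hα.le
    have hrle : r ≤ bracket (k : ℝ) * bracket ξ := by
      refine (pow_le_pow_iff_left₀ hr0.le (by positivity) two_ne_zero).1 ?_
      rw [hr2, mul_pow, bracket_sq, bracket_sq]
      nlinarith [mul_nonneg (sq_nonneg (k : ℝ)) (sq_nonneg ξ)]
    have h34 : (((k : ℝ) ^ 2 + ξ ^ 2) ^ (3 / 4 : ℝ)) ^ 2 = r ^ 3 := by
      rw [hr]
      generalize (k : ℝ) ^ 2 + ξ ^ 2 = x at hα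
      rw [Real.sqrt_eq_rpow, ← Real.rpow_natCast, ← Real.rpow_natCast (x ^ (1 / 2 : ℝ)),
        ← Real.rpow_mul hα.le, ← Real.rpow_mul hα.le]
      norm_num
    have h34' : 0 < ((k : ℝ) ^ 2 + ξ ^ 2) ^ (3 / 4 : ℝ) := Real.rpow_pos_of_pos hα _
    set a := ‖Rvector P ηin ψin ωin t k ξ‖
    set b := ‖fourierTransform ηin k ξ‖
    set c := ‖fourierTransform ωin k ξ‖
    have ha0 : 0 ≤ a := norm_nonneg _
    have hb0 : 0 ≤ b := norm_nonneg _
    have hc0 : 0 ≤ c := norm_nonneg _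
    have h1 : ‖fourierTransform ψin k ξ‖ / ((k : ℝ) ^ 2 + ξ ^ 2) ^ (3 / 4 : ℝ)
        ≤ (1 + D) * (a + b + c) := by
      have e1 := Rvector_apply P ηin ψin ωin t k ξ 1
      have e2 : ‖symmetrized P k ξ 0 (fourierTransform ηin k ξ) (fourierTransform ψin k ξ) 1‖
          = ‖fourierTransform ψin k ξ‖ / ((k : ℝ) ^ 2 + ξ ^ 2) ^ (3 / 4 : ℝ) := by
        simp only [symmetrized, Matrix.cons_val_one, Matrix.cons_val_fin_one, alpha_zero]
        rw [norm_mul, Complex.norm_real, Real.norm_of_nonneg (by positivity)]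
        ring
      rw [← e2, ← sub_eq_iff_eq_add.2 e1]
      refine (norm_sub_le _ _).trans ?_
      rw [norm_mul]
      have e3 : ‖Rvector P ηin ψin ωin t k ξ 1‖ ≤ a := PiLp.norm_apply_le _ 1
      have e4 := norm_add_le (fourierTransform ηin k ξ) (fourierTransform ωin k ξ)
      have e5 := mul_le_mul (hF k hk ξ t ht 1) e4 (norm_nonneg _) hD.le
      nlinarith
    have h2 : ‖fourierTransform ψin k ξ‖ ^ 2 ≤ r ^ 3 * (3 * (1 + D) ^ 2 * (a ^ 2 + b ^ 2 + c ^ 2)) := by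
      rw [div_le_iff₀ h34'] at h1
      have h3 := pow_le_pow_left₀ (norm_nonneg _) h1 2
      rw [mul_pow, h34, mul_pow] at h3
      have h4 : (a + b + c) ^ 2 ≤ 3 * (a ^ 2 + b ^ 2 + c ^ 2) := by
        nlinarith [sq_nonneg (a - b), sq_nonneg (b - c), sq_nonneg (a - c)]
      calc _ ≤ (1 + D) ^ 2 * (a + b + c) ^ 2 * r ^ 3 := h3
        _ ≤ (1 + D) ^ 2 * (3 * (a ^ 2 + b ^ 2 + c ^ 2)) * r ^ 3 := by gcongr
        _ = _ := by ring
    calc _ ≤ (bracket (k : ℝ) ^ 3)⁻¹ * (bracket ξ ^ 4)⁻¹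
          * ((bracket (k : ℝ) * bracket ξ) ^ 3 * (3 * (1 + D) ^ 2 * (a ^ 2 + b ^ 2 + c ^ 2))) := by
          refine mul_le_mul_of_nonneg_left (h2.trans ?_) (by positivity)
          gcongr
      _ = _ := by field_simp
  have hsq : sobolevNorm (-3 / 2) (-2) ψin ^ 2 ≤ ENNReal.ofReal (3 * (1 + D) ^ 2)
      * (Cin P ηin ψin ωin t ^ 2 + sobolevNorm 0 (-1 / 2) ηin ^ 2
        + sobolevNorm 0 (-1 / 2) ωin ^ 2) := by
    simp only [Cin, sobolevNorm, anisotropicNorm_sq]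
    rw [← ENNReal.tsum_add, ← ENNReal.tsum_add, ← ENNReal.tsum_mul_left]
    refine ENNReal.tsum_le_tsum fun k => ?_
    have m1 : AEMeasurable (fun ξ => W k ξ * ‖fourierTransform ηin k ξ‖ₑ ^ 2) volume :=
      (hWm k).aemeasurable.mul ((mη k).enorm.pow_const 2)
    have m2 : AEMeasurable (fun ξ => W k ξ * ‖fourierTransform ωin k ξ‖ₑ ^ 2) volume :=
      (hWm k).aemeasurable.mul ((mω k).enorm.pow_const 2)
    refine (lintegral_mono_ae (key k)).trans_eq ?_
    rw [lintegral_const_mul' _ _ ENNReal.ofReal_ne_top, lintegral_add_right' _ m2,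
      lintegral_add_right' _ m1]
  refine (ENNReal.pow_le_pow_left_iff two_ne_zero).1 (hsq.trans ?_)
  rw [mul_pow, ← ENNReal.ofReal_pow (by positivity)]
  gcongr
  · nlinarith [sq_nonneg (1 + D)]
  · rw [add_sq, add_sq]
    refine add_le_add (le_trans ?_ le_self_add) le_rfl
    gcongr
    exact le_self_add

end IonCouette

end

theorem theorem1p2 (P : IonCouette.Parameters) :
    ∃ c K : ℝ, 0 < c ∧ 0 < K ∧
      ∀ (η : ℝ → ℝ → ℝ → ℝ) (u : ℝ → ℝ → ℝ → IonCouette.Plane) (φ : ℝ → ℝ → ℝ → ℝ)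
        (ηin ψin ωin : ℝ → ℝ → ℝ),
        IonCouette.IsSmoothSolution P η u φ →
        ηin = η 0 → ψin = IonCouette.divergence (u 0) → ωin = IonCouette.vorticity (u 0) →
        IonCouette.HasZeroAverage ηin → IonCouette.HasZeroAverage ψin →
        IonCouette.HasZeroAverage ωin →
        IonCouette.MemSobolev 0 (-1 / 2) ηin → IonCouette.MemSobolev 0 (-1 / 2) ωin →
        IonCouette.MemSobolev (-3 / 2) (-2) ψin →
        ∀ t : ℝ, 0 ≤ t →
          ENNReal.ofReal (c * IonCouette.bracket t ^ (1 / 2 : ℝ))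
              * IonCouette.Cin P ηin ψin ωin t
            ≤ IonCouette.L2norm (IonCouette.potentialPart (u t))
              + ENNReal.ofReal (Real.sqrt (P.TPlus / P.mPlus)) * IonCouette.L2norm (η t) ∧
          IonCouette.sobolevNorm (-3 / 2) (-2) ψin
            ≤ ENNReal.ofReal K * (IonCouette.Cin P ηin ψin ωin t
                + IonCouette.sobolevNorm 0 (-1 / 2) ηin
                + IonCouette.sobolevNorm 0 (-1 / 2) ωin) := by
  obtain ⟨c, hc, hlow⟩ := IonCouette.exists_Cin_le P
  obtain ⟨K, hK, hdata⟩ := IonCouette.exists_sobolevNorm_le P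
  refine ⟨c, K, hc, hK, ?_⟩
  rintro η u φ _ _ _ hs rfl rfl rfl hη0 hψ0 hω0 hη hω hψ t ht
  exact ⟨hlow η u φ hs hη0 hψ0 hω0 t ht, hdata _ _ _ hη.1 hψ.1 hω.1 hψ0 t ht⟩
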